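/- **Setting.** Let $A\in\mathbb R^{n\times n}$, $B\in\mathbb R^{n\times p}$, $C\in\mathbb R^{m\times n}$, $D\in\mathbb R^{m\times p}$, $B_w\in\mathbb R^{n\times d_w}$, $D_z\in\mathbb R^{m\times d_z}$, and consider the system $$x_1=0,\qquad x_{t+1}=Ax_t+Bu_t+B_ww_t,\qquad y_t=Cx_t+Du_t+D_zz_t\quad(t\ge 1),\qquad y_0:=0 .$$ Let $T,L\ge 1$ be integers, $N_1=TL$, and let $(\mathcal F_t)_{t\in\mathbb Z}$ be a filtration such that for $1\le t\le N$: $u_t$ is $\mathcal F_t$-measurable with $u_t\mid\mathcal F_{t-1}\sim\mathcal N(0,I_p)$, and $w_t,z_t$ are $\mathcal F_{t-T}$-measurable. In the *stochastic noise model*, $w_t$ and $z_t$ are moreover $1$-subgaussian conditionally on $\mathcal F_{t-T-1}$, i.e. $\mathbb E[\exp(\lambda\langle v,w_t\rangle)\mid\mathcal F_{t-T-1}]\le\exp(\lambda^2\|v\|_2^2)$ for all $\lambda\in\mathbb R$ and all vectors $v$, and likewise for $z_t$. In the *adversarial noise model*, $\|w_t\|_2^2\le d_w$ and $\|z_t\|_2^2\le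 d_z$ almost surely. Write $\|\cdot\|$ for the spectral norm, $\log_+x=\max\{1,\log x\}$, $\bar u_t=[u_t|u_{t-1}|\cdots|u_{t-T+1}]\in\mathbb R^{Tp}$, $k_t=[y_{t-T}|y_{t-2T}|\cdots|y_{t-TL}]\in\mathbb R^{Lm}$, $G_\star=[D\,|\,CB\,|\,CAB\,|\cdots|\,CA^{T-2}B]\in\mathbb R^{m\times Tp}$ and $\delta_t=y_t-G_\star\bar u_t$; let $\Delta$ and $K$ be the matrices with rows $\delta_t^\top$ and $k_t^\top$, $t=N_1,\dots,N$. For $\mu\ge1$ let $$\hat\phi\in\arg\min_{\phi\in\mathbb R^{m\times Lm}}\sum_{t=N_1}^N\|y_t-\phi k_t\|_2^2+\mu^2\|\phi\|_F^2,\qquad \widehat G_{\rm PF}\in\arg\min_{G\in\mathbb R^{m\times Tp}}\sum_{t=N_1}^N\|(y_t-\hat\phi k_t)-G\bar u_t\|_2^2,$$ $$\mathsf{Opt}_\mu=\min_{\phi\in\mathbb R^{m\times Lm}}\|\Delta-K\phi^\top\|+\mu\|\phi\| .$$ Given a Jordan decomposition $A=SJS^{-1}$ over $\mathbb C$, put $$\overline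 M=\|CS\|\left(\|S^{-1}B\|+\|S^{-1}B_w\|\right)+\|D\|+\|D_z\|,\qquad \tilde p=p\,\min\{T,\log^2(eTp)\log^2(Tp)\} .$$ **Claim.** There are universal constants $c,c'>0$ such that the following holds for every such system, every Jordan decomposition of $A$ and every $\delta\in(0,1)$, $\mu\ge1$. Suppose that the spectral radius satisfies $\rho(A)\le1$, that the largest Jordan block of $A$ has size $k$, and that $$N\ge N_{\min}=\max\{10TL,\;c\,Tp\log^4(2Tp)\}.$$ In the stochastic noise model, with $\bar d=\tilde p+Lm\left(\log_+\overline M+k\log_+N\right)$, it holds with probability at least $1-\delta-(2Np)^{-\log^2(2Tp)\log(2Np)}$ that every output $\widehat G_{\rm PF}$ of the above procedure satisfies $$\|\widehat G_{\rm PF}-G_\star\|\le c'\left(\frac{\mathsf{Opt}_\mu+\|G_\star\|\sqrt{T(\bar d+\log\frac1\delta)}+\mu}{\sqrt N}\right)\sqrt{\frac{T(\bar d+\log\frac1\delta)}{N}} .$$ In the adversarial noise model the same holds with $\bar d=\tilde p+Lm\left(\log_+\overline M+\log_+(d_z+d_w)+k\log_+N\right)$. -/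

import Mathlib

open MeasureTheory ProbabilityTheory Matrix

noncomputable section

namespace PFLS

/-- Spectral norm: the operator norm of a matrix with respect to Euclidean norms. -/
def opNorm {𝕜 ι κ : Type*} [RCLike 𝕜] [Fintype ι] [Fintype κ] [DecidableEq κ]
    (A : Matrix ι κ 𝕜) : ℝ :=
  ‖(Matrix.toEuclideanLin A).toContinuousLinearMap‖

/-- Squared Euclidean norm of a real vector. -/
def normSq {ι : Type*} [Fintype ι] (v : ι → ℝ) : ℝ := ∑ i, v i ^ 2

/-- Squared Frobenius norm of a real matrix. -/
def frobSq {ι κ : Type*} [Fintype ι] [Fintype κ] (A : Matrix ι κ ℝ) : ℝ :=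
  ∑ i, ∑ j, A i j ^ 2

/-- `log₊ x = max {1, log x}`. -/
def logPlus (x : ℝ) : ℝ := max 1 (Real.log x)

/-- Entrywise embedding of a real matrix into the complex matrices. -/
def cplx {ι κ : Type*} (A : Matrix ι κ ℝ) : Matrix ι κ ℂ := A.map (fun x : ℝ => (x : ℂ))

/-! ### Linear time-invariant systems -/

/-- The matrices of the system
`x_{t+1} = A x_t + B u_t + Bw w_t`, `y_t = C x_t + D u_t + Dz z_t`. -/
structure LTI (n p m dw dz : ℕ) where
  A : Matrix (Fin n) (Fin n) ℝ
  B : Matrix (Fin n) (Fin p) ℝ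
  C : Matrix (Fin m) (Fin n) ℝ
  D : Matrix (Fin m) (Fin p) ℝ
  Bw : Matrix (Fin n) (Fin dw) ℝ
  Dz : Matrix (Fin m) (Fin dz) ℝ

variable {n p m dw dz : ℕ}

/-- The states, started at `x_1 = 0`; the value at time `0` is a placeholder. -/
def LTI.state (sys : LTI n p m dw dz) (u : ℕ → Fin p → ℝ) (w : ℕ → Fin dw → ℝ) :
    ℕ → Fin n → ℝ
  | 0 => 0
  | 1 => 0
  | t + 2 => sys.A *ᵥ sys.state u w (t + 1) + sys.B *ᵥ u (t + 1) + sys.Bw *ᵥ w (t + 1)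

/-- The outputs `y_t` for `t ≥ 1`. Nothing happens before time `1`, so `y_0 = 0`. -/
def LTI.output (sys : LTI n p m dw dz) (u : ℕ → Fin p → ℝ) (w : ℕ → Fin dw → ℝ)
    (z : ℕ → Fin dz → ℝ) (t : ℕ) : Fin m → ℝ :=
  if t = 0 then 0 else sys.C *ᵥ sys.state u w t + sys.D *ᵥ u t + sys.Dz *ᵥ z t

/-- The length-`T` response `G⋆ = [D | C B | C A B | ⋯ | C A^(T-2) B]`, an `m × Tp` matrix whose
columns are indexed by the block number `j < T` and the position inside the block. -/
def LTI.response (sys : LTI n p m dw dz) (T : ℕ) : Matrix (Fin m) (Fin T × Fin p) ℝ :=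
  fun i c => (if (c.1 : ℕ) = 0 then sys.D else sys.C * sys.A ^ ((c.1 : ℕ) - 1) * sys.B) i c.2

/-! ### Jordan normal form -/

/-- The upper Jordan block of size `s` with eigenvalue `l`. -/
def jordanBlock (s : ℕ) (l : ℂ) : Matrix (Fin s) (Fin s) ℂ :=
  fun i j => if i = j then l else if (i : ℕ) + 1 = (j : ℕ) then 1 else 0

/-- A decomposition `A = S J S⁻¹` over `ℂ` of a real square matrix, with `J` block diagonal
and its blocks Jordan blocks of positive size. -/
structure JordanDecomp (A : Matrix (Fin n) (Fin n) ℝ) where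
  numBlocks : ℕ
  size : Fin numBlocks → ℕ
  size_pos : ∀ i, 0 < size i
  eig : Fin numBlocks → ℂ
  S : Matrix (Fin n) (Σ i, Fin (size i)) ℂ
  Sinv : Matrix (Σ i, Fin (size i)) (Fin n) ℂ
  mul_inv : S * Sinv = 1
  inv_mul : Sinv * S = 1
  decomp : cplx A = S * Matrix.blockDiagonal' (fun i => jordanBlock (size i) (eig i)) * Sinv

/-- The largest Jordan block has size `k`. -/
def JordanDecomp.LargestBlock {A : Matrix (Fin n) (Fin n) ℝ} (J : JordanDecomp A) (k : ℕ) :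
    Prop :=
  IsGreatest (Set.range J.size) k

/-- `M̄ = ‖C S‖ (‖S⁻¹ B‖ + ‖S⁻¹ Bw‖) + ‖D‖ + ‖Dz‖`. -/
def LTI.Mbar (sys : LTI n p m dw dz) (J : JordanDecomp sys.A) : ℝ :=
  opNorm (cplx sys.C * J.S) * (opNorm (J.Sinv * cplx sys.B) + opNorm (J.Sinv * cplx sys.Bw))
    + opNorm sys.D + opNorm sys.Dz

/-! ### The prefiltered least squares estimator -/

/-- `ū_t = [u_t | u_{t-1} | ⋯ | u_{t-T+1}]`. -/
def stackedInput (T : ℕ) (u : ℕ → Fin p → ℝ) (t : ℕ) : Fin T × Fin p → ℝ :=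
  fun c => u (t - (c.1 : ℕ)) c.2

/-- `k_t = [y_{t-T} | y_{t-2T} | ⋯ | y_{t-TL}]`. -/
def feature (T L : ℕ) (y : ℕ → Fin m → ℝ) (t : ℕ) : Fin L × Fin m → ℝ :=
  fun c => y (t - ((c.1 : ℕ) + 1) * T) c.2

/-- The regularized objective of the prefiltering step, over the times `N₁ ≤ t ≤ N`. -/
def ridgeLoss (T L N₁ N : ℕ) (μ : ℝ) (y : ℕ → Fin m → ℝ)
    (φ : Matrix (Fin m) (Fin L × Fin m) ℝ) : ℝ :=
  ∑ t ∈ Finset.Icc N₁ N, normSq (y t - φ *ᵥ feature T L y t) + μ ^ 2 * frobSq φ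

/-- The least squares objective with the filter `φ`, over the times `N₁ ≤ t ≤ N`. -/
def filteredLoss (T L N₁ N : ℕ) (y : ℕ → Fin m → ℝ) (u : ℕ → Fin p → ℝ)
    (φ : Matrix (Fin m) (Fin L × Fin m) ℝ) (G : Matrix (Fin m) (Fin T × Fin p) ℝ) : ℝ :=
  ∑ t ∈ Finset.Icc N₁ N,
    normSq ((y t - φ *ᵥ feature T L y t) - G *ᵥ stackedInput T u t)

/-- `G` is an output of prefiltered least squares: it minimizes the filtered least squares
objective for a filter that minimizes the ridge objective. -/
def IsPFLS (T L N₁ N : ℕ) (μ : ℝ) (y : ℕ → Fin m → ℝ) (u : ℕ → Fin p → ℝ)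
    (G : Matrix (Fin m) (Fin T × Fin p) ℝ) : Prop :=
  ∃ φ : Matrix (Fin m) (Fin L × Fin m) ℝ,
    (∀ φ', ridgeLoss T L N₁ N μ y φ ≤ ridgeLoss T L N₁ N μ y φ') ∧
    ∀ G', filteredLoss T L N₁ N y u φ G ≤ filteredLoss T L N₁ N y u φ G'

/-- `Δ`, with the rows `δ_t = y_t - G ū_t` for `t = N₁, …, N`. -/
def errorMatrix (T N₁ N : ℕ) (y : ℕ → Fin m → ℝ) (u : ℕ → Fin p → ℝ)
    (G : Matrix (Fin m) (Fin T × Fin p) ℝ) : Matrix (Fin (N - N₁ + 1)) (Fin m) ℝ :=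
  fun i => y (N₁ + i) - G *ᵥ stackedInput T u (N₁ + i)

/-- `K`, with the rows `k_t` for `t = N₁, …, N`. -/
def featureMatrix (T L N₁ N : ℕ) (y : ℕ → Fin m → ℝ) :
    Matrix (Fin (N - N₁ + 1)) (Fin L × Fin m) ℝ :=
  fun i => feature T L y (N₁ + i)

/-- `Opt_μ = min_φ ‖Δ - K φᵀ‖ + μ ‖φ‖`. -/
def opt (T L N₁ N : ℕ) (μ : ℝ) (y : ℕ → Fin m → ℝ) (u : ℕ → Fin p → ℝ)
    (G : Matrix (Fin m) (Fin T × Fin p) ℝ) : ℝ :=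
  ⨅ φ : Matrix (Fin m) (Fin L × Fin m) ℝ,
    (opNorm (errorMatrix T N₁ N y u G - featureMatrix T L N₁ N y * φᵀ) + μ * opNorm φ)

/-! ### Inputs and noise -/

variable {Ω : Type*} [mΩ : MeasurableSpace Ω]

/-- The inputs `u_t` are adapted with `u_t | 𝓕_{t-1} ∼ N(0, I_p)` (the conditional law given
`𝓕_{t-1}` is constant, i.e. `u_t` is independent of `𝓕_{t-1}` and standard Gaussian), and the
noises `w_t`, `z_t` are chosen with a delay of `T` steps: they are `𝓕_{t-T}`-measurable. -/
structure SemiAdversarial (P : Measure Ω) (𝓕 : Filtration ℤ mΩ) (T N : ℕ)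
    (u : ℕ → Ω → Fin p → ℝ) (w : ℕ → Ω → Fin dw → ℝ) (z : ℕ → Ω → Fin dz → ℝ) : Prop where
  input_adapted : ∀ t : ℕ, 1 ≤ t → t ≤ N → Measurable[𝓕 (t : ℤ)] (u t)
  input_law : ∀ t : ℕ, 1 ≤ t → t ≤ N →
    P.map (u t) = Measure.pi (fun _ : Fin p => gaussianReal 0 1)
  input_indep : ∀ t : ℕ, 1 ≤ t → t ≤ N →
    Indep (MeasurableSpace.comap (u t) inferInstance) (𝓕 ((t : ℤ) - 1)) P
  process_delayed : ∀ t : ℕ, 1 ≤ t → t ≤ N → Measurable[𝓕 ((t : ℤ) - T)] (w t)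
  sensor_delayed : ∀ t : ℕ, 1 ≤ t → t ≤ N → Measurable[𝓕 ((t : ℤ) - T)] (z t)

/-- `X` is `1`-subgaussian conditionally on `𝓖`:
`E[exp(a ⟨v, X⟩) | 𝓖] ≤ exp(a² ‖v‖²)` for all `a` and `v`. -/
def CondSubgaussian {d : ℕ} (P : Measure Ω) (𝓖 : MeasurableSpace Ω) (X : Ω → Fin d → ℝ) :
    Prop :=
  ∀ (a : ℝ) (v : Fin d → ℝ),
    Integrable (fun ω => Real.exp (a * (v ⬝ᵥ X ω))) P ∧
    P[fun ω => Real.exp (a * (v ⬝ᵥ X ω)) | 𝓖] ≤ᵐ[P] fun _ => Real.exp (a ^ 2 * normSq v)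

/-- Stochastic noise: `w_t` and `z_t`, which are revealed at time `t - T`, are
`1`-subgaussian conditionally on what was known just before. -/
def StochasticNoise (P : Measure Ω) (𝓕 : Filtration ℤ mΩ) (T N : ℕ)
    (w : ℕ → Ω → Fin dw → ℝ) (z : ℕ → Ω → Fin dz → ℝ) : Prop :=
  ∀ t : ℕ, 1 ≤ t → t ≤ N →
    CondSubgaussian P (𝓕 ((t : ℤ) - T - 1)) (w t) ∧
    CondSubgaussian P (𝓕 ((t : ℤ) - T - 1)) (z t)

/-- Adversarial noise: `‖w_t‖² ≤ d_w` and `‖z_t‖² ≤ d_z` almost surely. -/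
def AdversarialNoise (P : Measure Ω) (N : ℕ)
    (w : ℕ → Ω → Fin dw → ℝ) (z : ℕ → Ω → Fin dz → ℝ) : Prop :=
  ∀ t : ℕ, 1 ≤ t → t ≤ N →
    (∀ᵐ ω ∂P, normSq (w t ω) ≤ dw) ∧ (∀ᵐ ω ∂P, normSq (z t ω) ≤ dz)

/-! ### The quantities of the bound -/

/-- `p̃ = p min {T, log²(eTp) log²(Tp)}`. -/
def pTilde (T p : ℕ) : ℝ :=
  p * min (T : ℝ) (Real.log (Real.exp 1 * T * p) ^ 2 * Real.log (T * p) ^ 2)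

/-- `N_min = max {10 T L, c T p log⁴(2Tp)}`. -/
def Nmin (c : ℝ) (T L p : ℕ) : ℝ :=
  max (10 * T * L) (c * T * p * Real.log (2 * T * p) ^ 4)

/-- `d̄` in the stochastic noise model. -/
def dBarStoch (sys : LTI n p m dw dz) (J : JordanDecomp sys.A) (T L N k : ℕ) : ℝ :=
  pTilde T p + L * m * (logPlus (sys.Mbar J) + k * logPlus N)

/-- `d̄` in the adversarial noise model. -/
def dBarAdv (sys : LTI n p m dw dz) (J : JordanDecomp sys.A) (T L N k : ℕ) : ℝ :=
  pTilde T p + L * m * (logPlus (sys.Mbar J) + logPlus ((dz : ℝ) + dw) + k * logPlus N)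

/-- The exceptional probability `(2Np)^(-log²(2Tp) log(2Np))` of an ill-conditioned input. -/
def deltaU (T N p : ℕ) : ℝ :=
  (2 * N * p : ℝ) ^ (-(Real.log (2 * T * p) ^ 2 * Real.log (2 * N * p)))

/-- The error bound
`((Opt + g √(T (d + log (1/δ))) + μ) / √N) * √(T (d + log (1/δ)) / N)`. -/
def rate (T N : ℕ) (μ δ Opt g d : ℝ) : ℝ :=
  ((Opt + g * √(T * (d + Real.log (1 / δ))) + μ) / √N) * √(T * (d + Real.log (1 / δ)) / N)

/-- The event that some output of prefiltered least squares, run on the trajectory of the system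
from time `N₁ = T L` to time `N`, violates the error bound with constant `Cst` and dimension `d`. -/
def failure (sys : LTI n p m dw dz) (T L N : ℕ) (μ δ Cst d : ℝ)
    (u : ℕ → Ω → Fin p → ℝ) (w : ℕ → Ω → Fin dw → ℝ) (z : ℕ → Ω → Fin dz → ℝ) : Set Ω :=
  {ω | ∃ Ghat : Matrix (Fin m) (Fin T × Fin p) ℝ,
    IsPFLS T L (T * L) N μ
      (sys.output (fun t => u t ω) (fun t => w t ω) (fun t => z t ω)) (fun t => u t ω) Ghat ∧
    Cst * rate T N μ δ
        (opt T L (T * L) N μ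
          (sys.output (fun t => u t ω) (fun t => w t ω) (fun t => z t ω)) (fun t => u t ω)
          (sys.response T))
        (opNorm (sys.response T)) d
      < opNorm (Ghat - sys.response T)}

end PFLS

end

open MeasureTheory ProbabilityTheory Matrix

noncomputable section

namespace PFLS

set_option linter.unusedSectionVars false

section


open Filter Topology NormedSpace
open scoped Matrix.Norms.L2Operator

/-! ### The Golden–Thompson inequality -/

section GoldenThompson

variable {ι : Type*} [Fintype ι] [DecidableEq ι]

/-! The regressor `ζ_t = (δ_t, k_t)` is known at time `t - T`: subtracting `G⋆ ū_t` removes the last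
`T` inputs from `y_t`, the features are outputs of age at least `T`, and the noise is fixed `T`
steps in advance. The entries of `ū_t` are drawn after that. So `ζ_t` and `ū_t` are nearly
uncorrelated along the trajectory however the noise is chosen, and the proof quantifies this.

The deterministic core is `opNorm_sub_le_of_isPFLS`. For a unit vector `v`, the residual of the
filter `φ` in direction `v`, without the part `G⋆ ū_t`, is `⟨ζ_t, x⟩` with `x = (v, -φᵀ v)`. Let `X
x` stack the numbers `⟨ζ_t, x⟩` and the vector `μ x`, and suppose that `‖∑ ⟨ζ_t, x⟩ ū_t‖ ≤ R ‖X x‖`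
for all `x` and that the Gram matrix of the `ū_t` is at least `κ I`. The normal equations of the
second step give an error of at most `κ⁻¹ R ‖X x‖`. Those of the ridge step, which fits `y_t`
instead of `δ_t`, make `X x` orthogonal to all `X (0, d)` up to cross terms with `G⋆ ū_t`.
Comparison with an arbitrary competitor then gives `‖X x‖ ≤ 2 Opt + 2 μ + ‖G⋆‖ R`.

Three probabilistic facts supply `κ` and `R`.

Conditioning of the inputs, `κ = N / 8` (`SemiAdversarial.measure_illConditioned_le`): Gram matrices
over windows spaced by `2T` are independent and positive semidefinite with mean `T I`. A matrix
Chernoff bound for the lower tail, which rests on the Golden–Thompson inequality, needs only their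
second moments, and Wick's formula computes these.

Cross terms (`LTI.measure_selfNormalized_le`): for each lag `j < T` the input `u_{t-j}` is
independent of the past, which contains `ζ_t`. Hence `exp (⟨S, V⁻¹ S⟩ / 2) / √(det V)` has a
constant mean along the trajectory, and Markov's inequality with a union bound over lags and a net
of directions gives `R² / T` of order `log det V + p + log T + log (1/δ)`.

Size of the regressors (`LTI.log_det_regGram_le`): only the logarithm of `det V` matters, so crude
polynomial bounds suffice. Powers of `A` grow like `s ^ k` by the Jordan form, the energies of
inputs and stochastic noise have exponential tails even without independence, and adversarial noise
is bounded outright. This yields the dimension `L m (log₊ M̄ + k log₊ N)` and its adversarial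
analogue. -/

theorem trace_mul_le_half_add {X Y : Matrix ι ι ℝ} (hX : X.IsSymm) (hY : Y.IsSymm) :
    (X * Y).trace ≤ ((X * X).trace + (Y * Y).trace) / 2 := by
  have h : 0 ≤ ((X - Y) * (X - Y)ᵀ).trace := by
    simp only [trace, diag_apply, mul_apply, transpose_apply]
    exact Finset.sum_nonneg fun i _ => Finset.sum_nonneg fun j _ => mul_self_nonneg _
  rw [transpose_sub, hX.eq, hY.eq, sub_mul, mul_sub, mul_sub, trace_sub, trace_sub, trace_sub,
    trace_mul_comm Y X] at h
  linarith

/-- The two signs come from expanding the squared Frobenius norms of `M - Mᵀ` and `M + Mᵀ`. -/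
theorem abs_trace_mul_self_le (M : Matrix ι ι ℝ) : |(M * M).trace| ≤ (M * Mᵀ).trace := by
  have h1 : 0 ≤ ((M - Mᵀ) * (M - Mᵀ)ᵀ).trace := by
    simp only [trace, diag_apply, mul_apply, transpose_apply]
    exact Finset.sum_nonneg fun i _ => Finset.sum_nonneg fun j _ => mul_self_nonneg _
  have h2 : 0 ≤ ((M + Mᵀ) * (M + Mᵀ)ᵀ).trace := by
    simp only [trace, diag_apply, mul_apply, transpose_apply]
    exact Finset.sum_nonneg fun i _ => Finset.sum_nonneg fun j _ => mul_self_nonneg _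
  have h3 : (Mᵀ * Mᵀ).trace = (M * M).trace := by
    rw [← transpose_mul, trace_transpose]
  rw [transpose_sub, transpose_transpose, sub_mul, mul_sub, mul_sub, trace_sub, trace_sub,
    trace_sub, h3, trace_mul_comm Mᵀ M] at h1
  rw [transpose_add, transpose_transpose, add_mul, mul_add, mul_add, trace_add, trace_add,
    trace_add, h3, trace_mul_comm Mᵀ M] at h2
  rw [abs_le]
  constructor <;> linarith

theorem trace_mul_pow_comm (X Y : Matrix ι ι ℝ) (n : ℕ) :
    ((X * Y) ^ n).trace = ((Y * X) ^ n).trace := by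
  cases n with
  | zero => simp
  | succ n =>
    have h : (X * Y) ^ (n + 1) = X * ((Y * X) ^ n * Y) := by
      induction n with
      | zero => simp
      | succ n ih => rw [pow_succ, ih, pow_succ (Y * X)]; simp only [mul_assoc]
    rw [h, trace_mul_comm, pow_succ, mul_assoc]

/-- The two claims feed each other in a joint induction. For general `M`, the first claim applied to
`M²` leads to `(MᵀM)(MMᵀ)`, where the second claim separates the factors and AM-GM for traces
recombines them. For symmetric `P, Q`, the first claim applied to `PQ` leads to `P² Q²`, where the
second claim applies again. -/
theorem trace_two_pow_le (k : ℕ) :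
    (∀ M : Matrix ι ι ℝ, |(M ^ 2 ^ (k + 1)).trace| ≤ ((M * Mᵀ) ^ 2 ^ k).trace) ∧
    (∀ P Q : Matrix ι ι ℝ, P.IsSymm → Q.IsSymm →
      ((P * Q) ^ 2 ^ k).trace ≤ (P ^ 2 ^ k * Q ^ 2 ^ k).trace) := by
  induction k with
  | zero => exact ⟨fun M => by simpa [pow_two] using abs_trace_mul_self_le M, fun P Q _ _ => by simp⟩
  | succ k ih =>
    obtain ⟨iha, ihb⟩ := ih
    constructor
    · intro M
      have hP : (Mᵀ * M).IsSymm := isSymm_transpose_mul_self M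
      have hQ : (M * Mᵀ).IsSymm := by simpa using isSymm_transpose_mul_self Mᵀ
      have e1 : M ^ 2 ^ (k + 1 + 1) = (M * M) ^ 2 ^ (k + 1) := by
        rw [← pow_two, ← pow_mul, ← pow_succ']
      have e2 : ((M * M * (M * M)ᵀ) ^ 2 ^ k).trace = ((Mᵀ * M * (M * Mᵀ)) ^ 2 ^ k).trace := by
        rw [transpose_mul, ← mul_assoc, trace_mul_pow_comm]
        simp only [mul_assoc]
      have e3 : (Mᵀ * M) ^ 2 ^ k * (Mᵀ * M) ^ 2 ^ k = (Mᵀ * M) ^ 2 ^ (k + 1) := by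
        rw [← pow_add]; congr 1; ring
      have e4 : (M * Mᵀ) ^ 2 ^ k * (M * Mᵀ) ^ 2 ^ k = (M * Mᵀ) ^ 2 ^ (k + 1) := by
        rw [← pow_add]; congr 1; ring
      rw [e1]
      refine (iha _).trans ?_
      rw [e2]
      refine (ihb _ _ hP hQ).trans ((trace_mul_le_half_add (hP.pow _) (hQ.pow _)).trans ?_)
      rw [e3, e4, trace_mul_pow_comm Mᵀ M]
      linarith
    · intro P Q hP hQ
      have e2 : ((P * Q * (P * Q)ᵀ) ^ 2 ^ k).trace = (((P ^ 2) * (Q ^ 2)) ^ 2 ^ k).trace := by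
        rw [transpose_mul, hP.eq, hQ.eq, ← mul_assoc, trace_mul_pow_comm]
        simp only [pow_two, mul_assoc]
      refine (le_abs_self _).trans ((iha _).trans ?_)
      rw [e2]
      refine (ihb _ _ (hP.pow 2) (hQ.pow 2)).trans ?_
      rw [← pow_mul, ← pow_mul, ← pow_succ']

theorem norm_pow_sub_pow_le {R : Type*} [NormedRing R] [NormOneClass R] (a b : R) {c : ℝ}
    (ha : ‖a‖ ≤ c) (hb : ‖b‖ ≤ c) (n : ℕ) :
    ‖a ^ (n + 1) - b ^ (n + 1)‖ ≤ (n + 1) * c ^ n * ‖a - b‖ := by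
  have hc : 0 ≤ c := (norm_nonneg a).trans ha
  induction n with
  | zero => simp
  | succ n ih =>
    have e : a ^ (n + 1 + 1) - b ^ (n + 1 + 1)
        = a * (a ^ (n + 1) - b ^ (n + 1)) + (a - b) * b ^ (n + 1) := by
      rw [pow_succ' a (n + 1), pow_succ' b (n + 1)]; noncomm_ring
    calc ‖a ^ (n + 1 + 1) - b ^ (n + 1 + 1)‖
        ≤ ‖a‖ * ‖a ^ (n + 1) - b ^ (n + 1)‖ + ‖a - b‖ * ‖b ^ (n + 1)‖ := by
          rw [e]; exact (norm_add_le _ _).trans (add_le_add (norm_mul_le _ _) (norm_mul_le _ _))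
      _ ≤ c * ((n + 1) * c ^ n * ‖a - b‖) + ‖a - b‖ * c ^ (n + 1) := by
          gcongr
          exact (norm_pow_le _ _).trans (pow_le_pow_left₀ (norm_nonneg _) hb _)
      _ = _ := by push_cast; ring

theorem exp_nsmul_real {R : Type*} [NormedRing R] [NormedAlgebra ℝ R] [CompleteSpace R]
    (n : ℕ) (x : R) : exp (n • x) = exp x ^ n := by
  let _ : NormedAlgebra ℚ R := NormedAlgebra.restrictScalars ℚ ℝ R
  exact NormedSpace.exp_nsmul n x

theorem norm_exp_le_exp_norm {R : Type*} [NormedRing R] [NormOneClass R] [NormedAlgebra ℝ R]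
    [CompleteSpace R] (x : R) : ‖exp x‖ ≤ Real.exp ‖x‖ := by
  have hs := Real.summable_pow_div_factorial ‖x‖
  rw [Real.exp_eq_exp_ℝ, exp_eq_tsum_div, exp_eq_tsum ℝ]
  refine tsum_of_norm_bounded hs.hasSum fun n => ?_
  rw [norm_smul, norm_inv, Real.norm_natCast, div_eq_inv_mul]
  gcongr
  exact norm_pow_le x n

/-- The Lie–Trotter product formula. The one-step error `exp (t x) exp (t y) - exp (t (x + y))` has
derivative zero at `t = 0`, so it is `o(1/n)`; telescoping the powers multiplies it by at most `n`
times the bounded factor `exp (‖x‖ + ‖y‖)`. -/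
theorem tendsto_trotter {R : Type*} [NormedRing R] [NormOneClass R] [NormedAlgebra ℝ R]
    [CompleteSpace R] (x y : R) :
    Tendsto (fun n : ℕ => (exp (((n : ℝ) + 1)⁻¹ • x) * exp (((n : ℝ) + 1)⁻¹ • y)) ^ (n + 1))
      atTop (𝓝 (exp (x + y))) := by
  have hd : HasDerivAt (fun t : ℝ => exp (t • x) * exp (t • y) - exp (t • (x + y))) 0 0 := by
    have h1 := hasDerivAt_exp_smul_const (𝕂 := ℝ) x 0
    have h2 := hasDerivAt_exp_smul_const (𝕂 := ℝ) y 0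
    have h3 := hasDerivAt_exp_smul_const (𝕂 := ℝ) (x + y) 0
    have h4 := (h1.mul h2).sub h3
    simpa [Pi.mul_def, Pi.sub_def, smul_add] using h4
  have ht : Tendsto (fun n : ℕ => ((n : ℝ) + 1)⁻¹) atTop (𝓝[≠] 0) := by
    refine tendsto_nhdsWithin_iff.2 ⟨?_, Eventually.of_forall fun n => ?_⟩
    · simpa using tendsto_one_div_add_atTop_nhds_zero_nat (𝕜 := ℝ)
    · simp only [Set.mem_compl_iff, Set.mem_singleton_iff]; positivity
  have hs := (hasDerivAt_iff_tendsto_slope.1 hd).comp ht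
  have hs' := hs.norm.const_mul (Real.exp (‖x‖ + ‖y‖))
  rw [norm_zero, mul_zero] at hs'
  rw [tendsto_iff_norm_sub_tendsto_zero]
  refine squeeze_zero (fun _ => norm_nonneg _) (fun n => ?_) hs'
  set t : ℝ := ((n : ℝ) + 1)⁻¹ with htdef
  have htp : 0 < t := by positivity
  have hb : exp (x + y) = exp (t • (x + y)) ^ (n + 1) := by
    rw [← exp_nsmul_real]
    congr 1
    rw [← Nat.cast_smul_eq_nsmul ℝ, smul_smul, htdef]
    push_cast
    rw [mul_inv_cancel₀ (by positivity), one_smul]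
  have hn : ∀ z : R, ‖exp (t • z)‖ ≤ Real.exp (t * ‖z‖) := fun z => by
    refine (norm_exp_le_exp_norm (t • z)).trans ?_
    rw [norm_smul, Real.norm_of_nonneg htp.le]
  have ha : ‖exp (t • x) * exp (t • y)‖ ≤ Real.exp (t * (‖x‖ + ‖y‖)) := by
    refine (norm_mul_le _ _).trans ?_
    rw [mul_add, Real.exp_add]
    exact mul_le_mul (hn x) (hn y) (norm_nonneg _) (Real.exp_nonneg _)
  have hb' : ‖exp (t • (x + y))‖ ≤ Real.exp (t * (‖x‖ + ‖y‖)) := by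
    refine (hn _).trans (Real.exp_le_exp.2 ?_)
    gcongr
    exact norm_add_le _ _
  rw [hb]
  refine (norm_pow_sub_pow_le _ _ ha hb' n).trans ?_
  have hc : Real.exp (t * (‖x‖ + ‖y‖)) ^ n ≤ Real.exp (‖x‖ + ‖y‖) := by
    rw [← Real.exp_nat_mul]
    apply Real.exp_le_exp.2
    have : (n : ℝ) * t ≤ 1 := by
      rw [htdef, ← div_eq_mul_inv, div_le_one (by positivity)]; linarith
    nlinarith [norm_nonneg x, norm_nonneg y]
  have e : ‖(slope (fun t : ℝ => exp (t • x) * exp (t • y) - exp (t • (x + y))) 0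
      ∘ fun n : ℕ => ((n : ℝ) + 1)⁻¹) n‖
      = ((n : ℝ) + 1) * ‖exp (t • x) * exp (t • y) - exp (t • (x + y))‖ := by
    simp only [Function.comp, slope, vsub_eq_sub, sub_zero, zero_smul, NormedSpace.exp_zero,
      mul_one, sub_self, norm_smul]
    rw [← htdef, norm_inv, Real.norm_of_nonneg htp.le, htdef, inv_inv]
  rw [e, mul_comm ((n : ℝ) + 1), mul_assoc]
  exact mul_le_mul_of_nonneg_right hc (by positivity)

/-- The Golden–Thompson inequality: take the Trotter formula along `n = 2^k` and separate the
factors by `trace_two_pow_le`. -/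
theorem trace_exp_add_le {X Y : Matrix ι ι ℝ} (hX : X.IsSymm) (hY : Y.IsSymm) :
    (exp (X + Y)).trace ≤ (exp X * exp Y).trace := by
  cases isEmpty_or_nonempty ι with
  | inl h => simp [trace]
  | inr h =>
  have ht := tendsto_trotter X Y
  have hsub : Tendsto (fun k : ℕ => 2 ^ k - 1) atTop atTop := by
    refine tendsto_atTop_mono (fun k => ?_) tendsto_id
    have := Nat.lt_two_pow_self (n := k)
    simp only [id]; omega
  have htr : Continuous (fun M : Matrix ι ι ℝ => M.trace) := continuous_id.matrix_trace
  have h2 := (htr.tendsto _).comp (ht.comp hsub)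
  refine le_of_tendsto h2 (Eventually.of_forall fun k => ?_)
  have hk : (2 ^ k - 1 + 1 : ℕ) = 2 ^ k := Nat.sub_add_cancel Nat.one_le_two_pow
  have hk' : (((2 ^ k - 1 : ℕ) : ℝ) + 1) = ((2 ^ k : ℕ) : ℝ) := by exact_mod_cast hk
  simp only [Function.comp]
  rw [hk, hk']
  have key : ∀ Z : Matrix ι ι ℝ, exp ((((2 ^ k : ℕ) : ℝ))⁻¹ • Z) ^ 2 ^ k = exp Z := fun Z => by
    rw [← exp_nsmul_real]
    congr 1
    rw [← Nat.cast_smul_eq_nsmul ℝ, smul_smul, mul_inv_cancel₀ (by positivity), one_smul]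
  refine ((trace_two_pow_le k).2 _ _ (hX.smul _).exp (hY.smul _).exp).trans ?_
  rw [key, key]

end GoldenThompson


end

/-! ### Spectral facts for real symmetric matrices -/

section Spectral

variable {ι : Type*} [Fintype ι] [DecidableEq ι]

theorem exists_spectral {A : Matrix ι ι ℝ} (hA : A.IsSymm) :
    ∃ (U : Matrix ι ι ℝ) (d : ι → ℝ), U * Uᵀ = 1 ∧ Uᵀ * U = 1 ∧ A = U * diagonal d * Uᵀ := by
  have hA' : A.IsHermitian := by rw [IsHermitian, conjTranspose_eq_transpose_of_trivial]; exact hA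
  refine ⟨hA'.eigenvectorUnitary, hA'.eigenvalues, ?_, ?_, ?_⟩
  · have := Unitary.coe_mul_star_self hA'.eigenvectorUnitary
    rwa [Unitary.coe_star, star_eq_conjTranspose, conjTranspose_eq_transpose_of_trivial] at this
  · have := Unitary.coe_star_mul_self hA'.eigenvectorUnitary
    rwa [star_eq_conjTranspose, conjTranspose_eq_transpose_of_trivial] at this
  · have := hA'.spectral_theorem
    rw [Unitary.conjStarAlgAut_apply, star_eq_conjTranspose,
      conjTranspose_eq_transpose_of_trivial] at this
    exact this

theorem exp_spectral {U : Matrix ι ι ℝ} (d : ι → ℝ) (h : U * Uᵀ = 1) (h' : Uᵀ * U = 1) :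
    NormedSpace.exp (U * diagonal d * Uᵀ) = U * diagonal (fun i => Real.exp (d i)) * Uᵀ := by
  have hU : IsUnit U := ⟨⟨U, Uᵀ, h, h'⟩, rfl⟩
  have hinv : U⁻¹ = Uᵀ := inv_eq_right_inv h
  have := Matrix.exp_conj U (diagonal d) hU
  rw [hinv, exp_diagonal] at this
  rw [this]
  congr 3
  ext i
  rw [Pi.coe_exp, Real.exp_eq_exp_ℝ]

theorem posSemidef_spectral {U : Matrix ι ι ℝ} {d : ι → ℝ} (hd : ∀ i, 0 ≤ d i) :
    (U * diagonal d * Uᵀ).PosSemidef := by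
  have := (PosSemidef.diagonal (n := ι) (R := ℝ) (d := d) hd).mul_mul_conjTranspose_same U
  rwa [conjTranspose_eq_transpose_of_trivial] at this

theorem _root_.Matrix.PosSemidef.isSymm {A : Matrix ι ι ℝ} (hA : A.PosSemidef) : A.IsSymm := by
  have := hA.isHermitian
  rwa [IsHermitian, conjTranspose_eq_transpose_of_trivial] at this

theorem _root_.Matrix.PosSemidef.dotProduct_nonneg {A : Matrix ι ι ℝ} (hA : A.PosSemidef)
    (v : ι → ℝ) : 0 ≤ v ⬝ᵥ A *ᵥ v := by
  simpa using hA.dotProduct_mulVec_nonneg v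

theorem spectral_eigenvalue {U : Matrix ι ι ℝ} {d : ι → ℝ} (h' : Uᵀ * U = 1) (i : ι) :
    (Uᵀ i) ⬝ᵥ (U * diagonal d * Uᵀ) *ᵥ (Uᵀ i) = d i := by
  have e : Uᵀ i = U *ᵥ Pi.single i 1 := by ext j; simp
  rw [e, mulVec_mulVec, mul_assoc, h', mul_one, dotProduct_mulVec, ← mulVec_transpose,
    mulVec_mulVec, transpose_mul, diagonal_transpose, mul_assoc, h', mul_one]
  simp

theorem trace_mul_spectral (A : Matrix ι ι ℝ) (U : Matrix ι ι ℝ) (d : ι → ℝ) :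
    ((U * diagonal d * Uᵀ) * A).trace = ∑ i, d i * ((Uᵀ i) ⬝ᵥ A *ᵥ (Uᵀ i)) := by
  rw [mul_assoc, trace_mul_comm, ← mul_assoc]
  simp only [trace, diag_apply, mul_diagonal]
  refine Finset.sum_congr rfl fun i _ => ?_
  rw [mul_comm, mul_assoc]
  simp only [mul_apply, dotProduct, mulVec, transpose_apply]

theorem trace_mul_nonneg_of_posSemidef {A B : Matrix ι ι ℝ} (hA : A.PosSemidef)
    (hB : B.PosSemidef) : 0 ≤ (A * B).trace := by
  obtain ⟨U, d, _, h', rfl⟩ := exists_spectral hA.isSymm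
  rw [trace_mul_spectral]
  refine Finset.sum_nonneg fun i _ => mul_nonneg ?_ (hB.dotProduct_nonneg _)
  rw [← spectral_eigenvalue (d := d) h' i]
  exact hA.dotProduct_nonneg _

theorem posSemidef_exp {A : Matrix ι ι ℝ} (hA : A.IsSymm) : (NormedSpace.exp A).PosSemidef := by
  obtain ⟨U, d, h, h', rfl⟩ := exists_spectral hA
  rw [exp_spectral d h h']
  exact posSemidef_spectral fun i => (Real.exp_pos _).le

/-- Since `(1 - x + x²/2)(1 + x + x²/2) = 1 + x⁴/4 ≥ 1`, the claim follows from the quadratic lower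
bound for `exp x`. -/
theorem _root_.Real.exp_neg_le_quadratic {x : ℝ} (hx : 0 ≤ x) :
    Real.exp (-x) ≤ 1 - x + x ^ 2 / 2 := by
  have h1 := Real.quadratic_le_exp_of_nonneg hx
  rw [Real.exp_neg, inv_le_iff_one_le_mul₀ (Real.exp_pos x)]
  have h2 : 0 ≤ 1 - x + x ^ 2 / 2 := by nlinarith [sq_nonneg (x - 1)]
  nlinarith [mul_le_mul_of_nonneg_left h1 h2, sq_nonneg x, sq_nonneg (x ^ 2)]

theorem posSemidef_quadratic_sub_exp_neg {W : Matrix ι ι ℝ} (hW : W.PosSemidef) {θ : ℝ}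
    (hθ : 0 ≤ θ) :
    ((1 : Matrix ι ι ℝ) - θ • W + (θ ^ 2 / 2) • (W * W)
      - NormedSpace.exp (-(θ • W))).PosSemidef := by
  obtain ⟨U, d, h, h', rfl⟩ := exists_spectral hW.isSymm
  have hd : ∀ i, 0 ≤ d i := fun i => by
    rw [← spectral_eigenvalue (d := d) h' i]
    exact hW.dotProduct_nonneg _
  have e1 : -(θ • (U * diagonal d * Uᵀ)) = U * diagonal (fun i => -(θ * d i)) * Uᵀ := by
    have : diagonal (fun i => -(θ * d i)) = -(θ • diagonal d) := by
      ext i j; by_cases hij : i = j <;> simp [diagonal, hij]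
    rw [this]; simp
  have e2 : (U * diagonal d * Uᵀ) * (U * diagonal d * Uᵀ)
      = U * diagonal (fun i => d i * d i) * Uᵀ := by
    rw [← diagonal_mul_diagonal]
    calc _ = U * diagonal d * (Uᵀ * U) * diagonal d * Uᵀ := by simp only [mul_assoc]
      _ = _ := by rw [h', mul_one]; simp only [mul_assoc]
  have e3 : (1 : Matrix ι ι ℝ) - θ • (U * diagonal d * Uᵀ)
      + (θ ^ 2 / 2) • ((U * diagonal d * Uᵀ) * (U * diagonal d * Uᵀ))
      - NormedSpace.exp (-(θ • (U * diagonal d * Uᵀ)))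
      = U * diagonal (fun i => 1 - θ * d i + (θ * d i) ^ 2 / 2 - Real.exp (-(θ * d i))) * Uᵀ := by
    rw [e1, exp_spectral _ h h', e2]
    have : diagonal (fun i => 1 - θ * d i + (θ * d i) ^ 2 / 2 - Real.exp (-(θ * d i)))
        = 1 - θ • diagonal d + (θ ^ 2 / 2) • diagonal (fun i => d i * d i)
          - diagonal (fun i => Real.exp (-(θ * d i))) := by
      ext i j
      by_cases hij : i = j
      · subst hij; simp; ring
      · simp [hij]
    rw [this]
    simp only [mul_sub, mul_add, sub_mul, add_mul, mul_one, h, Matrix.mul_smul, Matrix.smul_mul]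
  rw [e3]
  exact posSemidef_spectral fun i =>
    sub_nonneg.2 (Real.exp_neg_le_quadratic (mul_nonneg hθ (hd i)))

/-- The quadratic form at a unit vector is an average of the eigenvalues, so it is at most the
largest one, whose exponential is a summand of the trace. -/
theorem exp_dotProduct_le_trace_exp {A : Matrix ι ι ℝ} (hA : A.IsSymm) {v : ι → ℝ}
    (hv : normSq v = 1) : Real.exp (v ⬝ᵥ A *ᵥ v) ≤ (NormedSpace.exp A).trace := by
  obtain ⟨U, d, h, h', rfl⟩ := exists_spectral hA
  rw [exp_spectral d h h']
  set c := Uᵀ *ᵥ v with hc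
  have hc1 : ∑ i, c i ^ 2 = 1 := by
    have : c ⬝ᵥ c = v ⬝ᵥ v := by
      rw [hc, dotProduct_mulVec, ← mulVec_transpose, transpose_transpose, mulVec_mulVec, h,
        one_mulVec]
    simp only [dotProduct, ← pow_two] at this
    rw [this]; exact hv
  have hq : v ⬝ᵥ (U * diagonal d * Uᵀ) *ᵥ v = ∑ i, d i * c i ^ 2 := by
    rw [mul_assoc, ← mulVec_mulVec, ← mulVec_mulVec, dotProduct_mulVec, ← mulVec_transpose, ← hc]
    simp only [dotProduct, mulVec_diagonal]
    exact Finset.sum_congr rfl fun i _ => by ring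
  have htr : (U * diagonal (fun i => Real.exp (d i)) * Uᵀ).trace = ∑ i, Real.exp (d i) := by
    rw [trace_mul_comm, ← mul_assoc, h', one_mul, trace_diagonal]
  rw [hq, htr]
  by_contra! hcon
  have hlt : ∀ i, d i < ∑ i, d i * c i ^ 2 := fun i => by
    rw [← Real.exp_lt_exp]
    exact (Finset.single_le_sum (fun j _ => (Real.exp_pos (d j)).le) (Finset.mem_univ i)).trans_lt
      hcon
  have h1 : ∑ i, d i * c i ^ 2 ≤ ∑ i, (∑ i, d i * c i ^ 2) * c i ^ 2 :=
    Finset.sum_le_sum fun i _ => mul_le_mul_of_nonneg_right (hlt i).le (sq_nonneg _)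
  have h2 : ∃ i, c i ^ 2 ≠ 0 := by
    by_contra! h0
    rw [Finset.sum_eq_zero fun i _ => h0 i] at hc1
    exact zero_ne_one hc1
  obtain ⟨i, hi⟩ := h2
  have h3 : ∑ i, d i * c i ^ 2 < ∑ i, (∑ i, d i * c i ^ 2) * c i ^ 2 := by
    refine Finset.sum_lt_sum (fun i _ => mul_le_mul_of_nonneg_right (hlt i).le (sq_nonneg _))
      ⟨i, Finset.mem_univ i, mul_lt_mul_of_pos_right (hlt i) ?_⟩
    exact lt_of_le_of_ne (sq_nonneg _) (Ne.symm hi)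
  rw [← Finset.mul_sum, hc1, mul_one] at h3
  exact lt_irrefl _ h3

theorem trace_exp_neg_le_card {S : Matrix ι ι ℝ} (hS : S.PosSemidef) :
    (NormedSpace.exp (-S)).trace ≤ Fintype.card ι := by
  obtain ⟨U, d, h, h', rfl⟩ := exists_spectral hS.isSymm
  have hd : ∀ i, 0 ≤ d i := fun i => by
    rw [← spectral_eigenvalue (d := d) h' i]
    exact hS.dotProduct_nonneg _
  have e1 : -(U * diagonal d * Uᵀ) = U * diagonal (fun i => -d i) * Uᵀ := by
    have : diagonal (fun i => -d i) = -diagonal d := (diagonal_neg d).symm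
    rw [this, mul_neg, neg_mul]
  rw [e1, exp_spectral _ h h', trace_mul_comm, ← mul_assoc, h', one_mul, trace_diagonal]
  calc ∑ i, Real.exp (-d i) ≤ ∑ _i : ι, (1 : ℝ) :=
        Finset.sum_le_sum fun i _ => Real.exp_le_one_iff.2 (neg_nonpos.2 (hd i))
    _ = _ := by simp

/-- The sum of the logarithms of the eigenvalues is controlled by the trace. -/
theorem log_det_le {V : Matrix ι ι ℝ} (hV : V.PosDef) {c : ℝ} (hc : 0 < c)
    (htr : V.trace ≤ Fintype.card ι * c) :
    Real.log V.det ≤ Fintype.card ι * Real.log c := by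
  have hdet := hV.isHermitian.det_eq_prod_eigenvalues
  have htr' := hV.isHermitian.trace_eq_sum_eigenvalues
  simp only [RCLike.ofReal_real_eq_id, id] at hdet htr'
  rw [hdet, Real.log_prod fun i _ => (hV.eigenvalues_pos i).ne']
  -- The tangent to the logarithm at `c` lies above it; summing over the eigenvalues leaves only the
  -- trace.
  have h1 : ∀ i, Real.log (hV.isHermitian.eigenvalues i)
      ≤ Real.log c + (hV.isHermitian.eigenvalues i / c - 1) := fun i => by
    have hi := hV.eigenvalues_pos i
    have := Real.log_le_sub_one_of_pos (div_pos hi hc)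
    rw [Real.log_div hi.ne' hc.ne'] at this
    linarith
  refine (Finset.sum_le_sum fun i _ => h1 i).trans ?_
  rw [Finset.sum_add_distrib, Finset.sum_sub_distrib, ← Finset.sum_div, ← htr']
  have : V.trace / c ≤ Fintype.card ι := by rwa [div_le_iff₀ hc]
  simp only [Finset.sum_const, Finset.card_univ, nsmul_eq_mul, mul_one]
  linarith

end Spectral

/-! ### Matrix Chernoff bound for the lower tail -/

instance instMeasurableSpaceMatrix {ι κ : Type*} : MeasurableSpace (Matrix ι κ ℝ) :=
  inferInstanceAs (MeasurableSpace (ι → κ → ℝ))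

instance instBorelSpaceMatrix {ι κ : Type*} [Fintype ι] [Fintype κ] :
    BorelSpace (Matrix ι κ ℝ) :=
  inferInstanceAs (BorelSpace (ι → κ → ℝ))

instance instSecondCountableMatrix {ι κ : Type*} [Fintype ι] [Fintype κ] :
    SecondCountableTopology (Matrix ι κ ℝ) :=
  inferInstanceAs (SecondCountableTopology (ι → κ → ℝ))

theorem measurable_matrix_iff {α ι κ : Type*} [MeasurableSpace α] {f : α → Matrix ι κ ℝ} :
    Measurable f ↔ ∀ i j, Measurable fun a => f a i j := by
  constructor
  · intro h i j
    exact measurable_pi_iff.1 (measurable_pi_iff.1 h i) j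
  · intro h
    exact measurable_pi_iff.2 fun i => measurable_pi_iff.2 fun j => h i j

section Chernoff

variable {ι : Type*} [Fintype ι] [DecidableEq ι]

open scoped Matrix.Norms.L2Operator in
theorem continuous_trace_exp : Continuous fun M : Matrix ι ι ℝ => (NormedSpace.exp M).trace := by
  let _ : NormedAlgebra ℚ (Matrix ι ι ℝ) := NormedAlgebra.restrictScalars ℚ ℝ _
  exact Continuous.matrix_trace NormedSpace.exp_continuous

variable {Ω : Type*} [MeasurableSpace Ω] {P : Measure Ω} [IsProbabilityMeasure P]

/-- One step of the Chernoff recursion, with `S` frozen. Golden–Thompson splits off `exp (-θ W)`,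
which is below its second-order Taylor polynomial because `W` is positive semidefinite; this is why
the lower tail needs no bound on `W` beyond two moments. Taking means in an eigenbasis of `S`
finishes the step. -/
theorem integral_trace_exp_neg_add_le {S : Matrix ι ι ℝ} (hS : S.PosSemidef)
    {W : Ω → Matrix ι ι ℝ} (hWp : ∀ ω, (W ω).PosSemidef) {τ s θ : ℝ}
    (hθ : 0 ≤ θ)
    (hmean : ∀ i j, ∫ ω, W ω i j ∂P = if i = j then τ else 0)
    (hint : ∀ i j, MemLp (fun ω => W ω i j) 2 P)
    (hsq : ∀ v, ∫ ω, normSq (W ω *ᵥ v) ∂P ≤ s * normSq v) :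
    ∫ ω, (NormedSpace.exp (-(θ • (S + W ω)))).trace ∂P
      ≤ (1 - θ * τ + θ ^ 2 / 2 * s) * (NormedSpace.exp (-(θ • S))).trace := by
  have hSs : (-(θ • S)).IsSymm := (hS.isSymm.smul θ).neg
  obtain ⟨U, d, h, h', hd⟩ := exists_spectral hSs
  set E := NormedSpace.exp (-(θ • S)) with hE
  have hEp : E.PosSemidef := posSemidef_exp hSs
  have hEs : E = U * diagonal (fun i => Real.exp (d i)) * Uᵀ := by
    rw [hE, hd, exp_spectral _ h h']
  have hI1 : ∀ i j, Integrable (fun ω => W ω i j) P := fun i j => (hint i j).integrable one_le_two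
  have hu : ∀ k, normSq (Uᵀ k) = 1 := fun k => by
    have := congrFun (congrFun h' k) k
    simp only [mul_apply, one_apply_eq, transpose_apply] at this
    simp only [normSq, pow_two, transpose_apply]
    exact this
  have hI2 : ∀ v : ι → ℝ, Integrable (fun ω => normSq (W ω *ᵥ v)) P := fun v => by
    unfold normSq
    refine integrable_finsetSum _ fun i _ => ?_
    refine MemLp.integrable_sq ?_
    simp only [mulVec, dotProduct]
    exact memLp_finsetSum _ fun j _ => (hint i j).mul_const _
  have hWW : ∀ ω v, v ⬝ᵥ (W ω * W ω) *ᵥ v = normSq (W ω *ᵥ v) := fun ω v => by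
    rw [← mulVec_mulVec, dotProduct_mulVec, ← mulVec_transpose, (hWp ω).isSymm.eq]
    simp only [dotProduct, normSq, pow_two]
  have hpt : ∀ ω, (NormedSpace.exp (-(θ • (S + W ω)))).trace
      ≤ E.trace - θ * (∑ i, ∑ j, E i j * W ω j i)
        + θ ^ 2 / 2 * ∑ k, Real.exp (d k) * normSq (W ω *ᵥ Uᵀ k) := fun ω => by
    have g1 : (NormedSpace.exp (-(θ • (S + W ω)))).trace
        ≤ (E * NormedSpace.exp (-(θ • W ω))).trace := by
      rw [smul_add, neg_add]
      exact trace_exp_add_le hSs ((hWp ω).isSymm.smul θ).neg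
    have g2 := trace_mul_nonneg_of_posSemidef hEp (posSemidef_quadratic_sub_exp_neg (hWp ω) hθ)
    rw [mul_sub, mul_add, mul_sub, mul_one, trace_sub, trace_add, trace_sub, Matrix.mul_smul,
      Matrix.mul_smul, trace_smul, trace_smul, smul_eq_mul, smul_eq_mul] at g2
    have g3 : (E * (W ω * W ω)).trace = ∑ k, Real.exp (d k) * normSq (W ω *ᵥ Uᵀ k) := by
      rw [hEs, trace_mul_spectral]
      simp only [hWW]
    have g4 : (E * W ω).trace = ∑ i, ∑ j, E i j * W ω j i := by
      simp only [trace, diag_apply, mul_apply]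
    rw [g3, g4] at g2
    linarith
  have hJ1 : Integrable (fun ω => ∑ i, ∑ j, E i j * W ω j i) P :=
    integrable_finsetSum _ fun i _ => integrable_finsetSum _ fun j _ => (hI1 j i).const_mul _
  have hJ2 : Integrable (fun ω => ∑ k, Real.exp (d k) * normSq (W ω *ᵥ Uᵀ k)) P :=
    integrable_finsetSum _ fun k _ => (hI2 _).const_mul _
  have hR : Integrable (fun ω => E.trace - θ * (∑ i, ∑ j, E i j * W ω j i)
        + θ ^ 2 / 2 * ∑ k, Real.exp (d k) * normSq (W ω *ᵥ Uᵀ k)) P :=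
    ((integrable_const _).sub (hJ1.const_mul _)).add (hJ2.const_mul _)
  have hm1 : ∫ ω, ∑ i, ∑ j, E i j * W ω j i ∂P = τ * E.trace := by
    refine (integral_finsetSum _ fun i _ =>
      integrable_finsetSum _ fun j _ => (hI1 j i).const_mul _).trans ?_
    simp only [trace, diag_apply, Finset.mul_sum]
    refine Finset.sum_congr rfl fun i _ => ?_
    refine (integral_finsetSum _ fun j _ => (hI1 j i).const_mul _).trans ?_
    refine (Finset.sum_congr rfl fun j _ => (integral_const_mul _ _).trans
      (congrArg _ (hmean j i))).trans ?_
    simp [mul_comm]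
  have hm2 : ∫ ω, ∑ k, Real.exp (d k) * normSq (W ω *ᵥ Uᵀ k) ∂P ≤ s * E.trace := by
    refine (integral_finsetSum _ fun k _ => (hI2 _).const_mul _).trans_le ?_
    have : E.trace = ∑ k, Real.exp (d k) := by
      rw [hEs, trace_mul_comm, ← mul_assoc, h', one_mul, trace_diagonal]
    rw [this, Finset.mul_sum]
    refine Finset.sum_le_sum fun k _ => ?_
    refine (integral_const_mul _ _).trans_le ?_
    rw [mul_comm s]
    refine mul_le_mul_of_nonneg_left ?_ (Real.exp_pos _).le
    simpa [hu k] using hsq (Uᵀ k)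
  calc ∫ ω, (NormedSpace.exp (-(θ • (S + W ω)))).trace ∂P
      ≤ ∫ ω, (E.trace - θ * (∑ i, ∑ j, E i j * W ω j i)
        + θ ^ 2 / 2 * ∑ k, Real.exp (d k) * normSq (W ω *ᵥ Uᵀ k)) ∂P := by
        refine integral_mono_of_nonneg (Filter.Eventually.of_forall fun ω => ?_) hR
          (Filter.Eventually.of_forall hpt)
        exact (posSemidef_exp ((hS.isSymm.add (hWp ω).isSymm).smul θ).neg).trace_nonneg
    _ = E.trace - θ * (τ * E.trace)
        + θ ^ 2 / 2 * ∫ ω, ∑ k, Real.exp (d k) * normSq (W ω *ᵥ Uᵀ k) ∂P := by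
        refine (integral_add ((integrable_const _).sub (hJ1.const_mul _))
          (hJ2.const_mul _)).trans ?_
        refine congrArg₂ _ ((integral_sub (integrable_const _) (hJ1.const_mul _)).trans ?_)
          (integral_const_mul _ _)
        refine congrArg₂ _ (by simp) ((integral_const_mul _ _).trans (congrArg _ hm1))
    _ ≤ E.trace - θ * (τ * E.trace) + θ ^ 2 / 2 * (s * E.trace) := by
        gcongr
    _ = _ := by ring

/-- Independence permits freezing `S` by Fubini. The traces are bounded by the dimension, so
integrability is automatic. -/
theorem integral_trace_exp_neg_add_indep_le {S W : Ω → Matrix ι ι ℝ} (hS : Measurable S)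
    (hSp : ∀ ω, (S ω).PosSemidef) (hW : Measurable W) (hWp : ∀ ω, (W ω).PosSemidef)
    (hind : IndepFun S W P) {τ s θ : ℝ} (hθ : 0 ≤ θ)
    (hmean : ∀ i j, ∫ ω, W ω i j ∂P = if i = j then τ else 0)
    (hint : ∀ i j, MemLp (fun ω => W ω i j) 2 P)
    (hsq : ∀ v, ∫ ω, normSq (W ω *ᵥ v) ∂P ≤ s * normSq v) :
    ∫ ω, (NormedSpace.exp (-(θ • (S ω + W ω)))).trace ∂P
      ≤ (1 - θ * τ + θ ^ 2 / 2 * s) * ∫ ω, (NormedSpace.exp (-(θ • S ω))).trace ∂P := by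
  have hcont : Continuous fun q : Matrix ι ι ℝ × Matrix ι ι ℝ =>
      (NormedSpace.exp (-(θ • (q.1 + q.2)))).trace :=
    continuous_trace_exp.comp (by fun_prop)
  have hcont1 : Continuous fun q : Matrix ι ι ℝ => (NormedSpace.exp (-(θ • q))).trace :=
    continuous_trace_exp.comp (by fun_prop)
  have hb : ∀ M : Matrix ι ι ℝ, M.PosSemidef →
      ‖(NormedSpace.exp (-(θ • M))).trace‖ ≤ Fintype.card ι := fun M hM => by
    rw [Real.norm_of_nonneg (posSemidef_exp (hM.isSymm.smul θ).neg).trace_nonneg]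
    exact trace_exp_neg_le_card (hM.smul hθ)
  have hpair : Measurable fun ω => (S ω, W ω) := hS.prodMk hW
  have hF : Integrable (fun q : Matrix ι ι ℝ × Matrix ι ι ℝ =>
      (NormedSpace.exp (-(θ • (q.1 + q.2)))).trace) ((P.map S).prod (P.map W)) := by
    rw [← (indepFun_iff_map_prod_eq_prod_map_map hS.aemeasurable hW.aemeasurable).1 hind]
    rw [integrable_map_measure hcont.measurable.aestronglyMeasurable hpair.aemeasurable]
    exact Integrable.of_bound (hcont.measurable.comp hpair).aestronglyMeasurable
      (Fintype.card ι : ℝ) (Filter.Eventually.of_forall fun ω => hb _ ((hSp ω).add (hWp ω)))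
  have hG : Integrable (fun ω => (NormedSpace.exp (-(θ • S ω))).trace) P :=
    Integrable.of_bound (hcont1.measurable.comp hS).aestronglyMeasurable (Fintype.card ι : ℝ)
      (Filter.Eventually.of_forall fun ω => hb _ (hSp ω))
  have e1 : ∫ ω, (NormedSpace.exp (-(θ • (S ω + W ω)))).trace ∂P
      = ∫ ω, ∫ ω', (NormedSpace.exp (-(θ • (S ω + W ω')))).trace ∂P ∂P := by
    calc _ = ∫ q, (NormedSpace.exp (-(θ • (q.1 + q.2)))).trace
          ∂(P.map fun ω => (S ω, W ω)) :=
          (integral_map hpair.aemeasurable hcont.measurable.aestronglyMeasurable).symm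
      _ = ∫ M, ∫ M', (NormedSpace.exp (-(θ • (M + M')))).trace ∂(P.map W) ∂(P.map S) := by
          rw [(indepFun_iff_map_prod_eq_prod_map_map hS.aemeasurable hW.aemeasurable).1 hind,
            integral_prod _ hF]
      _ = ∫ ω, ∫ M', (NormedSpace.exp (-(θ • (S ω + M')))).trace ∂(P.map W) ∂P := by
          rw [integral_map hS.aemeasurable]
          exact hF.integral_prod_left.aestronglyMeasurable
      _ = _ := by
          refine integral_congr_ae (Filter.Eventually.of_forall fun ω => ?_)
          simp only
          rw [integral_map hW.aemeasurable]
          exact (continuous_trace_exp.comp (by fun_prop)).measurable.aestronglyMeasurable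
  rw [e1, ← integral_const_mul]
  refine integral_mono_of_nonneg (Filter.Eventually.of_forall fun ω => ?_) (hG.const_mul _)
    (Filter.Eventually.of_forall fun ω =>
      integral_trace_exp_neg_add_le (hSp ω) hWp hθ hmean hint hsq)
  exact integral_nonneg fun ω' =>
    (posSemidef_exp (((hSp ω).isSymm.add (hWp ω').isSymm).smul θ).neg).trace_nonneg

/-- Lower tail of a sum of independent positive semidefinite matrices with mean `τ I` and second
moments bounded by `s I`. -/
theorem measure_quadratic_le_half_le {W : ℕ → Ω → Matrix ι ι ℝ} {B : ℕ}
    (hW : ∀ b < B, Measurable (W b)) (hWp : ∀ b ω, (W b ω).PosSemidef)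
    (hind : ∀ b < B, IndepFun (fun ω => ∑ a ∈ Finset.range b, W a ω) (W b) P)
    {τ s : ℝ} (hτ : 0 ≤ τ) (hs : 0 < s)
    (hmean : ∀ b < B, ∀ i j, ∫ ω, W b ω i j ∂P = if i = j then τ else 0)
    (hint : ∀ b < B, ∀ i j, MemLp (fun ω => W b ω i j) 2 P)
    (hsq : ∀ b < B, ∀ v, ∫ ω, normSq (W b ω *ᵥ v) ∂P ≤ s * normSq v) :
    P {ω | ∃ v, normSq v = 1 ∧ v ⬝ᵥ (∑ b ∈ Finset.range B, W b ω) *ᵥ v ≤ B * τ / 2}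
      ≤ ENNReal.ofReal (Fintype.card ι * Real.exp (-(B * τ ^ 2 / (8 * s)))) := by
  -- Each summand contributes `1 - θτ + θ²s/2` to the recursion and `exp (θτ/2)` to Markov's
  -- inequality; this `θ` minimizes `-θτ/2 + θ²s/2`, with value `-τ²/(8s)`.
  set θ := τ / (2 * s) with hθd
  have hθ : 0 ≤ θ := by positivity
  have hSm : ∀ b ≤ B, Measurable fun ω => ∑ a ∈ Finset.range b, W a ω := fun b hb => by
    refine measurable_matrix_iff.2 fun i j => ?_
    simp only [Matrix.sum_apply]
    exact Finset.measurable_sum _ fun a ha =>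
      measurable_matrix_iff.1 (hW a ((Finset.mem_range.1 ha).trans_le hb)) i j
  have hSp : ∀ b ω, (∑ a ∈ Finset.range b, W a ω).PosSemidef := fun b ω =>
    posSemidef_sum _ fun a _ => hWp a ω
  have hr : 1 - θ * τ + θ ^ 2 / 2 * s ≤ Real.exp (-(3 * τ ^ 2 / (8 * s))) := by
    have : 1 - θ * τ + θ ^ 2 / 2 * s = -(3 * τ ^ 2 / (8 * s)) + 1 := by
      rw [hθd]; field_simp; ring
    rw [this]
    exact Real.add_one_le_exp _
  have hE : ∀ b ≤ B, ∫ ω, (NormedSpace.exp (-(θ • ∑ a ∈ Finset.range b, W a ω))).trace ∂P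
      ≤ Fintype.card ι * Real.exp (-(b * (3 * τ ^ 2 / (8 * s)))) := by
    intro b
    induction b with
    | zero => intro _; simp
    | succ b ih =>
      intro hb
      have hb' : b < B := hb
      have h1 := integral_trace_exp_neg_add_indep_le (hSm b hb'.le) (hSp b) (hW b hb') (hWp b)
        (hind b hb') hθ (hmean b hb') (hint b hb') (hsq b hb')
      have h0 : 0 ≤ ∫ ω, (NormedSpace.exp (-(θ • ∑ a ∈ Finset.range b, W a ω))).trace ∂P :=
        integral_nonneg fun ω => (posSemidef_exp ((hSp b ω).isSymm.smul θ).neg).trace_nonneg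
      simp only [Finset.sum_range_succ]
      refine h1.trans ((mul_le_mul_of_nonneg_right hr h0).trans
        ((mul_le_mul_of_nonneg_left (ih hb'.le) (Real.exp_pos _).le).trans_eq ?_))
      rw [mul_left_comm, ← Real.exp_add]
      push_cast
      congr 2
      ring
  have hmeas : Measurable fun ω =>
      (NormedSpace.exp (-(θ • ∑ a ∈ Finset.range B, W a ω))).trace :=
    (continuous_trace_exp.comp (by fun_prop : Continuous fun M : Matrix ι ι ℝ => -(θ • M))).measurable.comp
      (hSm B le_rfl)
  have hnn : ∀ ω, 0 ≤ (NormedSpace.exp (-(θ • ∑ a ∈ Finset.range B, W a ω))).trace := fun ω =>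
    (posSemidef_exp ((hSp B ω).isSymm.smul θ).neg).trace_nonneg
  have hintg : Integrable (fun ω =>
      (NormedSpace.exp (-(θ • ∑ a ∈ Finset.range B, W a ω))).trace) P := by
    refine Integrable.of_bound hmeas.aestronglyMeasurable (Fintype.card ι : ℝ)
      (Filter.Eventually.of_forall fun ω => ?_)
    rw [Real.norm_of_nonneg (hnn ω)]
    exact trace_exp_neg_le_card ((hSp B ω).smul hθ)
  have hsub : {ω | ∃ v, normSq v = 1 ∧ v ⬝ᵥ (∑ b ∈ Finset.range B, W b ω) *ᵥ v ≤ B * τ / 2}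
      ⊆ {ω | Real.exp (-(θ * (B * τ / 2)))
        ≤ (NormedSpace.exp (-(θ • ∑ a ∈ Finset.range B, W a ω))).trace} := by
    rintro ω ⟨v, hv, hle⟩
    refine le_trans ?_ (exp_dotProduct_le_trace_exp ((hSp B ω).isSymm.smul θ).neg hv)
    apply Real.exp_le_exp.2
    rw [neg_mulVec, dotProduct_neg, smul_mulVec, dotProduct_smul, smul_eq_mul]
    exact neg_le_neg (mul_le_mul_of_nonneg_left hle hθ)
  have hmk := mul_meas_ge_le_integral_of_nonneg (Filter.Eventually.of_forall hnn) hintg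
    (Real.exp (-(θ * (B * τ / 2))))
  refine (measure_mono hsub).trans ?_
  rw [← ENNReal.ofReal_toReal (measure_ne_top P _)]
  apply ENNReal.ofReal_le_ofReal
  have h2 := hmk.trans (hE B le_rfl)
  nth_rw 1 [Real.exp_neg] at h2
  rw [inv_mul_le_iff₀ (Real.exp_pos _), mul_left_comm, ← Real.exp_add] at h2
  refine h2.trans (le_of_eq ?_)
  congr 2
  rw [hθd]; field_simp; ring

end Chernoff

/-! ### Second moments of Gaussian quadratic forms -/

section Wick

/-- Read off from the fourth derivative at zero of the moment generating function `exp (t²/2)`. -/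
theorem integral_pow_four_gaussianReal : ∫ x, x ^ 4 ∂(gaussianReal 0 1) = 3 := by
  have hmgf : mgf (fun x : ℝ => x) (gaussianReal 0 1) = fun t => Real.exp (t ^ 2 / 2) := by
    rw [mgf_fun_id_gaussianReal]; ext t; simp
  have hset : integrableExpSet (fun x : ℝ => x) (gaussianReal 0 1) = Set.univ :=
    Set.eq_univ_of_forall fun t => by
      simp only [integrableExpSet, Set.mem_ofPred_eq]
      exact integrable_exp_mul_gaussianReal t
  have h := iteratedDeriv_mgf_zero (X := fun x : ℝ => x) (μ := gaussianReal 0 1)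
    (by rw [hset]; simp) 4
  have hE : ∀ t : ℝ, HasDerivAt (fun t : ℝ => Real.exp (t ^ 2 / 2)) (t * Real.exp (t ^ 2 / 2)) t :=
    fun t => by
      have := ((hasDerivAt_pow 2 t).div_const 2).exp
      convert this using 1
      simp; ring
  have d1 : deriv (fun t : ℝ => Real.exp (t ^ 2 / 2)) = fun t => t * Real.exp (t ^ 2 / 2) :=
    funext fun t => (hE t).deriv
  have d2 : deriv (fun t : ℝ => t * Real.exp (t ^ 2 / 2))
      = fun t => (1 + t ^ 2) * Real.exp (t ^ 2 / 2) := funext fun t => by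
    rw [((hasDerivAt_id' t).fun_mul (hE t)).deriv]; ring
  have d3 : deriv (fun t : ℝ => (1 + t ^ 2) * Real.exp (t ^ 2 / 2))
      = fun t => (3 * t + t ^ 3) * Real.exp (t ^ 2 / 2) := funext fun t => by
    have h1 : HasDerivAt (fun t : ℝ => 1 + t ^ 2) (2 * t) t := by
      simpa using (hasDerivAt_pow 2 t).const_add 1
    rw [(h1.fun_mul (hE t)).deriv]; ring
  have d4 : deriv (fun t : ℝ => (3 * t + t ^ 3) * Real.exp (t ^ 2 / 2))
      = fun t => (3 + 6 * t ^ 2 + t ^ 4) * Real.exp (t ^ 2 / 2) := funext fun t => by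
    have h1 : HasDerivAt (fun t : ℝ => 3 * t + t ^ 3) (3 + 3 * t ^ 2) t := by
      simpa using ((hasDerivAt_id' t).const_mul 3).fun_add (hasDerivAt_pow 3 t)
    rw [(h1.fun_mul (hE t)).deriv]; ring
  rw [hmgf] at h
  simp only [iteratedDeriv_succ, iteratedDeriv_zero, d1, d2, d3, d4] at h
  simp only [Pi.pow_apply] at h
  rw [← h]
  simp

theorem integral_sq_gaussianReal : ∫ x, x ^ 2 ∂(gaussianReal 0 1) = 1 := by
  have h := variance_id_gaussianReal (μ := 0) (v := 1)
  rw [variance_of_integral_eq_zero aemeasurable_id (by simp [integral_id_gaussianReal])] at h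
  simpa using h

variable {Ω : Type*} [MeasurableSpace Ω] {P : Measure Ω} [IsProbabilityMeasure P]
  {κ : Type*} [Fintype κ] [DecidableEq κ] {g : κ → Ω → ℝ}

theorem integral_gaussian_pow (hg : ∀ x, Measurable (g x))
    (hlaw : ∀ x, P.map (g x) = gaussianReal 0 1) (x : κ) (n : ℕ) :
    ∫ ω, g x ω ^ n ∂P = ∫ y, y ^ n ∂(gaussianReal 0 1) := by
  rw [← hlaw x, integral_map (hg x).aemeasurable (by fun_prop)]

theorem memLp_gaussian (hg : ∀ x, Measurable (g x))
    (hlaw : ∀ x, P.map (g x) = gaussianReal 0 1) (x : κ) (q : NNReal) : MemLp (g x) q P := by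
  have h := memLp_id_gaussianReal (μ := 0) (v := 1) q
  rw [← hlaw x, memLp_map_measure_iff (by fun_prop) (hg x).aemeasurable] at h
  exact h

theorem memLp_gaussian_mul (hg : ∀ x, Measurable (g x))
    (hlaw : ∀ x, P.map (g x) = gaussianReal 0 1) (x y : κ) :
    MemLp (fun ω => g x ω * g y ω) 2 P := by
  have : ENNReal.HolderTriple ((4 : NNReal) : ENNReal) ((4 : NNReal) : ENNReal) 2 := ⟨by
    rw [← ENNReal.toReal_eq_toReal_iff' (by simp) (by simp)]
    rw [ENNReal.toReal_add (by simp) (by simp)]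
    norm_num⟩
  exact (memLp_gaussian hg hlaw y 4).mul (memLp_gaussian hg hlaw x 4)

/-- Wick's formula for four factors. By independence the mean is a product of moments, indexed by
the multiplicity `n x` of each coordinate: a coordinate of multiplicity one makes it vanish, two
pairs give `1`, and a fourfold coincidence gives `3`, which is also the number of pairings. -/
theorem integral_gaussian_mul_mul_mul (hg : ∀ x, Measurable (g x))
    (hlaw : ∀ x, P.map (g x) = gaussianReal 0 1) (hind : iIndepFun g P) (α β γ δ : κ) :
    ∫ ω, g α ω * g β ω * (g γ ω * g δ ω) ∂P
      = (if α = β ∧ γ = δ then 1 else 0) + (if α = γ ∧ β = δ then 1 else 0)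
        + (if α = δ ∧ β = γ then 1 else 0) := by
  set n : κ → ℕ := fun x => (if x = α then 1 else 0) + (if x = β then 1 else 0)
    + ((if x = γ then 1 else 0) + (if x = δ then 1 else 0)) with hn
  have hprod : ∀ ω, g α ω * g β ω * (g γ ω * g δ ω) = ∏ x, g x ω ^ n x := fun ω => by
    simp only [hn, pow_add, Finset.prod_mul_distrib, pow_ite, pow_one, pow_zero]
    simp
  have hE : ∫ ω, g α ω * g β ω * (g γ ω * g δ ω) ∂P
      = ∏ x, ∫ y, y ^ n x ∂(gaussianReal 0 1) := by
    simp_rw [hprod]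
    rw [hind.integral_fun_prod_comp (f := fun x y => y ^ n x) (fun x => (hg x).aemeasurable)
      (fun x => by fun_prop)]
    exact Finset.prod_congr rfl fun x _ => integral_gaussian_pow hg hlaw x _
  have m0 : ∫ y : ℝ, y ^ 0 ∂(gaussianReal 0 1) = 1 := by simp
  have m1 : ∫ y : ℝ, y ^ 1 ∂(gaussianReal 0 1) = 0 := by simp [integral_id_gaussianReal]
  have hzero : ∀ x, n x = 1 → ∏ x, ∫ y, y ^ n x ∂(gaussianReal 0 1) = 0 := fun x hx =>
    Finset.prod_eq_zero (Finset.mem_univ x) (by rw [hx, m1])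
  have hone : (∀ x, n x = 0 ∨ n x = 2) → ∏ x, ∫ y, y ^ n x ∂(gaussianReal 0 1) = 1 := fun h =>
    Finset.prod_eq_one fun x _ => by
      rcases h x with h | h
      · rw [h, m0]
      · rw [h, integral_sq_gaussianReal]
  rw [hE]
  by_cases hab : α = β
  · subst hab
    by_cases hgd : γ = δ
    · subst hgd
      by_cases hag : α = γ
      · subst hag
        rw [Finset.prod_eq_single α]
        · have : n α = 4 := by simp [hn]
          rw [this, integral_pow_four_gaussianReal]; simp; norm_num
        · intro x _ hx
          have : n x = 0 := by simp [hn, hx]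
          rw [this, m0]
        · simp
      · rw [hone fun x => ?_]
        · simp [hag]
        · by_cases h1 : x = α
          · subst h1; right; simp [hn, hag]
          · by_cases h2 : x = γ
            · subst h2; right; simp [hn, h1]
            · left; simp [hn, h1, h2]
    · by_cases hga : γ = α
      · subst hga
        rw [hzero δ (by simp [hn, Ne.symm hgd])]
        simp [hgd]
      · rw [hzero γ (by simp [hn, hga, hgd])]
        simp [hgd, Ne.symm hga]
  · by_cases hag : α = γ
    · subst hag
      by_cases hbd : β = δ
      · subst hbd
        rw [hone fun x => ?_]
        · simp [hab]
        · by_cases h1 : x = α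
          · subst h1; right; simp [hn, hab]
          · by_cases h2 : x = β
            · subst h2; right; simp [hn, h1]
            · left; simp [hn, h1, h2]
      · rw [hzero β (by simp [hn, Ne.symm hab, hbd])]
        simp [hab, hbd, Ne.symm hab]
    · by_cases had : α = δ
      · subst had
        by_cases hbg : β = γ
        · subst hbg
          rw [hone fun x => ?_]
          · simp [hab]
          · by_cases h1 : x = α
            · subst h1; right; simp [hn, hab]
            · by_cases h2 : x = β
              · subst h2; right; simp [hn, h1]
              · left; simp [hn, h1, h2]
        · rw [hzero β (by simp [hn, Ne.symm hab, hbg])]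
          simp [hab, hag, hbg]
      · rw [hzero α (by simp [hn, hab, hag, had])]
        simp [hab, hag, had]

theorem integral_gaussian_mul (hg : ∀ x, Measurable (g x))
    (hlaw : ∀ x, P.map (g x) = gaussianReal 0 1) (hind : iIndepFun g P) (α β : κ) :
    ∫ ω, g α ω * g β ω ∂P = if α = β then 1 else 0 := by
  by_cases h : α = β
  · subst h
    simp only [if_true, ← pow_two]
    rw [integral_gaussian_pow hg hlaw, integral_sq_gaussianReal]
  · rw [if_neg h, (hind.indepFun h).integral_fun_mul_eq_mul_integral
      (hg α).aestronglyMeasurable (hg β).aestronglyMeasurable]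
    have := integral_gaussian_pow hg hlaw α 1
    simp only [pow_one, integral_id_gaussianReal] at this
    rw [this, zero_mul]

/-- Of the three Wick pairings of the square, the first is the squared mean. Injectivity of `e ↦ (a
e, b e)` makes the second diagonal and makes the third at most an involution-like matching, so each
contributes at most `∑ v e ^ 2`. -/
theorem integral_gaussian_quadratic_sq_le (hg : ∀ x, Measurable (g x))
    (hlaw : ∀ x, P.map (g x) = gaussianReal 0 1) (hind : iIndepFun g P)
    {ε : Type*} [Fintype ε] [DecidableEq ε] (v : ε → ℝ) (a b : ε → κ)
    (hinj : Function.Injective fun e => (a e, b e)) :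
    ∫ ω, (∑ e, v e * (g (a e) ω * g (b e) ω)) ^ 2 ∂P
      ≤ (∑ e, if a e = b e then v e else 0) ^ 2 + 2 * ∑ e, v e ^ 2 := by
  have hint : ∀ e f, Integrable (fun ω => v e * v f *
      (g (a e) ω * g (b e) ω * (g (a f) ω * g (b f) ω))) P := fun e f =>
    ((memLp_gaussian_mul hg hlaw (a e) (b e)).integrable_mul
      (memLp_gaussian_mul hg hlaw (a f) (b f))).const_mul _
  have hexp : ∀ ω, (∑ e, v e * (g (a e) ω * g (b e) ω)) ^ 2
      = ∑ e, ∑ f, v e * v f * (g (a e) ω * g (b e) ω * (g (a f) ω * g (b f) ω)) := fun ω => by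
    rw [pow_two, Finset.sum_mul_sum]
    exact Finset.sum_congr rfl fun e _ => Finset.sum_congr rfl fun f _ => by ring
  simp_rw [hexp]
  rw [integral_finsetSum _ fun e _ => integrable_finsetSum _ fun f _ => hint e f]
  simp_rw [integral_finsetSum _ fun f _ => hint _ f, integral_const_mul,
    integral_gaussian_mul_mul_mul hg hlaw hind, mul_add, Finset.sum_add_distrib]
  have t1 : ∑ e, ∑ f, v e * v f * (if a e = b e ∧ a f = b f then (1 : ℝ) else 0)
      = (∑ e, if a e = b e then v e else 0) ^ 2 := by
    rw [pow_two, Finset.sum_mul_sum]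
    refine Finset.sum_congr rfl fun e _ => Finset.sum_congr rfl fun f _ => ?_
    by_cases h1 : a e = b e <;> by_cases h2 : a f = b f <;> simp [h1, h2]
  have t2 : ∑ e, ∑ f, v e * v f * (if a e = a f ∧ b e = b f then (1 : ℝ) else 0)
      = ∑ e, v e ^ 2 := by
    refine Finset.sum_congr rfl fun e _ => ?_
    rw [Finset.sum_eq_single e]
    · simp [pow_two]
    · intro f _ hf
      rw [if_neg, mul_zero]
      rintro ⟨h1, h2⟩
      exact hf (hinj (Prod.ext h1.symm h2.symm))
    · simp
  -- For each `e` at most one `f` satisfies `(a f, b f) = (b e, a e)`; AM-GM on `v e * v f` then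
  -- reduces the double sum to two single sums.
  have t3 : ∑ e, ∑ f, v e * v f * (if a e = b f ∧ b e = a f then (1 : ℝ) else 0)
      ≤ ∑ e, v e ^ 2 := by
    have hle : ∀ e f, v e * v f * (if a e = b f ∧ b e = a f then (1 : ℝ) else 0)
        ≤ (if a e = b f ∧ b e = a f then v e ^ 2 / 2 else 0)
          + (if a e = b f ∧ b e = a f then v f ^ 2 / 2 else 0) := fun e f => by
      split_ifs
      · nlinarith [sq_nonneg (v e - v f)]
      · simp
    have hone : ∀ e, ∑ f, (if a e = b f ∧ b e = a f then v e ^ 2 / 2 else 0) ≤ v e ^ 2 / 2 :=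
      fun e => by
        rw [← Finset.sum_filter, Finset.sum_const, nsmul_eq_mul]
        have hc : (Finset.univ.filter fun f => a e = b f ∧ b e = a f).card ≤ 1 := by
          refine Finset.card_le_one.2 fun f hf f' hf' => hinj ?_
          simp only [Finset.mem_filter, Finset.mem_univ, true_and] at hf hf'
          exact Prod.ext (hf.2.symm.trans hf'.2) (hf.1.symm.trans hf'.1)
        have hc' : ((Finset.univ.filter fun f => a e = b f ∧ b e = a f).card : ℝ) ≤ 1 := by
          exact_mod_cast hc
        nlinarith [sq_nonneg (v e)]
    calc _ ≤ ∑ e, ∑ f, ((if a e = b f ∧ b e = a f then v e ^ 2 / 2 else 0)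
          + (if a e = b f ∧ b e = a f then v f ^ 2 / 2 else 0)) :=
          Finset.sum_le_sum fun e _ => Finset.sum_le_sum fun f _ => hle e f
      _ = ∑ e, ∑ f, (if a e = b f ∧ b e = a f then v e ^ 2 / 2 else 0)
          + ∑ f, ∑ e, (if a f = b e ∧ b f = a e then v f ^ 2 / 2 else 0) := by
          simp only [Finset.sum_add_distrib]
          congr 1
          rw [Finset.sum_comm]
          refine Finset.sum_congr rfl fun e _ => Finset.sum_congr rfl fun f _ => ?_
          congr 1
          exact propext ⟨fun h => ⟨h.2.symm, h.1.symm⟩, fun h => ⟨h.2.symm, h.1.symm⟩⟩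
      _ ≤ ∑ e, v e ^ 2 / 2 + ∑ e, v e ^ 2 / 2 :=
          add_le_add (Finset.sum_le_sum fun e _ => hone e) (Finset.sum_le_sum fun e _ => hone e)
      _ = _ := by rw [← Finset.sum_add_distrib]; exact Finset.sum_congr rfl fun e _ => by ring
  rw [t1, t2]
  linarith

end Wick

/-! ### Conditioning of the input -/

section Inputs

variable {Ω : Type*} [mΩ : MeasurableSpace Ω] {P : Measure Ω} [IsProbabilityMeasure P]

/-- Peel off the latest time: its variable is independent of the past, and the events of all earlier
times belong to that past. -/
theorem iIndepFun_of_filtration {E : Type*} [MeasurableSpace E] {𝓕 : Filtration ℤ mΩ} {N : ℕ}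
    {X : ℕ → Ω → E} (hX : ∀ t : ℕ, 1 ≤ t → t ≤ N → Measurable[𝓕 (t : ℤ)] (X t))
    (hind : ∀ t : ℕ, 1 ≤ t → t ≤ N →
      Indep (MeasurableSpace.comap (X t) inferInstance) (𝓕 ((t : ℤ) - 1)) P) :
    iIndepFun (fun t : Finset.Icc 1 N => X t) P := by
  rw [iIndepFun_iff_measure_inter_preimage_eq_mul]
  intro S
  induction S using Finset.induction_on_max with
  | empty => intro sets _; simp
  | insert a s hlt ih =>
    intro sets hsets
    have ha := Finset.mem_Icc.1 a.2
    have hnot : a ∉ s := fun h => lt_irrefl _ (hlt a h)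
    rw [Finset.set_biInter_insert, Finset.prod_insert hnot,
      ← ih fun i hi => hsets i (Finset.mem_insert_of_mem hi)]
    refine (Indep_iff _ _ _).1 (hind a ha.1 ha.2) _ _
      ⟨sets a, hsets a (Finset.mem_insert_self _ _), rfl⟩ ?_
    refine Finset.measurableSet_biInter s fun i hi => ?_
    have hi' := Finset.mem_Icc.1 i.2
    have hia : (i : ℕ) < (a : ℕ) := hlt i hi
    exact 𝓕.mono (by omega : ((i : ℕ) : ℤ) ≤ ((a : ℕ) : ℤ) - 1) _
      (hX i hi'.1 hi'.2 (hsets i (Finset.mem_insert_of_mem hi)))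

variable {p dw dz : ℕ} {𝓕 : Filtration ℤ mΩ} {T N : ℕ} {u : ℕ → Ω → Fin p → ℝ}
  {w : ℕ → Ω → Fin dw → ℝ} {z : ℕ → Ω → Fin dz → ℝ}

theorem SemiAdversarial.measurable_input (h : SemiAdversarial P 𝓕 T N u w z) {t : ℕ} (h1 : 1 ≤ t)
    (h2 : t ≤ N) : Measurable (u t) :=
  (h.input_adapted t h1 h2).mono (𝓕.le _) le_rfl

theorem SemiAdversarial.map_coord (h : SemiAdversarial P 𝓕 T N u w z) {t : ℕ} (h1 : 1 ≤ t)
    (h2 : t ≤ N) (i : Fin p) : P.map (fun ω => u t ω i) = gaussianReal 0 1 := by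
  have := h.measurable_input h1 h2
  have e : (fun ω => u t ω i) = (fun x : Fin p → ℝ => x i) ∘ u t := rfl
  rw [e, ← Measure.map_map (by fun_prop) this, h.input_law t h1 h2]
  exact (measurePreserving_eval (fun _ : Fin p => gaussianReal 0 1) i).map_eq

theorem SemiAdversarial.iIndepFun_coord (h : SemiAdversarial P 𝓕 T N u w z) :
    iIndepFun (fun (q : Finset.Icc 1 N × Fin p) ω => u q.1 ω q.2) P := by
  have hm : ∀ t : Finset.Icc 1 N, Measurable (u t) := fun t =>
    h.measurable_input (Finset.mem_Icc.1 t.2).1 (Finset.mem_Icc.1 t.2).2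
  refine iIndepFun_uncurry' (X := fun (t : Finset.Icc 1 N) i ω => u t ω i)
    (fun t i => (measurable_pi_apply i).comp (hm t)) ?_ fun t => ?_
  · exact iIndepFun_of_filtration h.input_adapted h.input_indep
  · have ht := Finset.mem_Icc.1 t.2
    refine (iIndepFun_iff_map_fun_eq_pi_map (f := fun (i : Fin p) ω => u t ω i)
      fun i => ((measurable_pi_apply i).comp (hm t)).aemeasurable).2 ?_
    simp_rw [h.map_coord ht.1 ht.2]
    exact h.input_law t ht.1 ht.2

/-- The Gram matrix of the stacked inputs over a window of length `T`. -/
def blockGram (T : ℕ) (u : ℕ → Fin p → ℝ) (τ : ℕ) :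
    Matrix (Fin T × Fin p) (Fin T × Fin p) ℝ :=
  ∑ a ∈ Finset.range T, vecMulVec (stackedInput T u (τ + a)) (stackedInput T u (τ + a))

theorem blockGram_apply (T : ℕ) (u : ℕ → Fin p → ℝ) (τ : ℕ) (c c' : Fin T × Fin p) :
    blockGram T u τ c c'
      = ∑ a ∈ Finset.range T, u (τ + a - c.1) c.2 * u (τ + a - c'.1) c'.2 := by
  simp only [blockGram, Matrix.sum_apply, vecMulVec_apply, stackedInput]

theorem dotProduct_blockGram (T : ℕ) (u : ℕ → Fin p → ℝ) (τ : ℕ) (v : Fin T × Fin p → ℝ) :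
    v ⬝ᵥ blockGram T u τ *ᵥ v
      = ∑ a ∈ Finset.range T, (stackedInput T u (τ + a) ⬝ᵥ v) ^ 2 := by
  rw [blockGram, sum_mulVec, dotProduct_sum]
  refine Finset.sum_congr rfl fun a _ => ?_
  rw [vecMulVec_mulVec, dotProduct_comm v, op_smul_eq_smul, smul_dotProduct, smul_eq_mul, pow_two]

theorem posSemidef_blockGram (T : ℕ) (u : ℕ → Fin p → ℝ) (τ : ℕ) :
    (blockGram T u τ).PosSemidef := by
  refine posSemidef_sum _ fun a _ => ?_
  simpa using posSemidef_vecMulVec_self_star (stackedInput T u (τ + a))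

/-- The coordinates of the inputs during the experiment. -/
def inputCoord (N : ℕ) (u : ℕ → Ω → Fin p → ℝ) (q : Finset.Icc 1 N × Fin p) (ω : Ω) : ℝ :=
  u q.1 ω q.2

theorem SemiAdversarial.measurable_inputCoord (h : SemiAdversarial P 𝓕 T N u w z)
    (q : Finset.Icc 1 N × Fin p) :
    Measurable (inputCoord N u q) :=
  (measurable_pi_apply q.2).comp
    (h.measurable_input (Finset.mem_Icc.1 q.1.2).1 (Finset.mem_Icc.1 q.1.2).2)

theorem SemiAdversarial.map_inputCoord (h : SemiAdversarial P 𝓕 T N u w z)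
    (q : Finset.Icc 1 N × Fin p) :
    P.map (inputCoord N u q) = gaussianReal 0 1 :=
  h.map_coord (Finset.mem_Icc.1 q.1.2).1 (Finset.mem_Icc.1 q.1.2).2 q.2

theorem SemiAdversarial.blockGram_memLp (h : SemiAdversarial P 𝓕 T N u w z)
    {τ : ℕ} (h1 : T ≤ τ) (h2 : τ + T ≤ N + 1)
    (c c' : Fin T × Fin p) : MemLp (fun ω => blockGram T (fun t => u t ω) τ c c') 2 P := by
  simp only [blockGram_apply]
  refine memLp_finsetSum _ fun a ha => ?_
  have ha := Finset.mem_range.1 ha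
  have hc := c.1.2
  have hc' := c'.1.2
  exact memLp_gaussian_mul h.measurable_inputCoord h.map_inputCoord
    (⟨τ + a - c.1, Finset.mem_Icc.2 ⟨by omega, by omega⟩⟩, c.2)
    (⟨τ + a - c'.1, Finset.mem_Icc.2 ⟨by omega, by omega⟩⟩, c'.2)

theorem SemiAdversarial.integral_blockGram (h : SemiAdversarial P 𝓕 T N u w z)
    {τ : ℕ} (h1 : T ≤ τ) (h2 : τ + T ≤ N + 1)
    (c c' : Fin T × Fin p) :
    ∫ ω, blockGram T (fun t => u t ω) τ c c' ∂P = if c = c' then (T : ℝ) else 0 := by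
  have hmem : ∀ a ∈ Finset.range T, ∀ c : Fin T × Fin p, τ + a - c.1 ∈ Finset.Icc 1 N :=
    fun a ha c => by
      have ha := Finset.mem_range.1 ha
      have hc := c.1.2
      exact Finset.mem_Icc.2 ⟨by omega, by omega⟩
  simp only [blockGram_apply]
  rw [integral_finsetSum]
  · have : ∀ a ∈ Finset.range T, ∫ ω, u (τ + a - c.1) ω c.2 * u (τ + a - c'.1) ω c'.2 ∂P
        = if c = c' then (1 : ℝ) else 0 := fun a ha => by
      have e := integral_gaussian_mul h.measurable_inputCoord h.map_inputCoord h.iIndepFun_coord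
        (⟨τ + a - c.1, hmem a ha c⟩, c.2) (⟨τ + a - c'.1, hmem a ha c'⟩, c'.2)
      refine e.trans (if_congr ?_ rfl rfl)
      have hc := c.1.2
      have hc' := c'.1.2
      simp only [Prod.ext_iff, Subtype.mk.injEq, Fin.ext_iff]
      constructor
      · rintro ⟨e1, e2⟩; exact ⟨by omega, e2⟩
      · rintro ⟨e1, e2⟩; exact ⟨by omega, e2⟩
    rw [Finset.sum_congr rfl this]
    simp
  · intro a ha
    exact (memLp_gaussian_mul h.measurable_inputCoord h.map_inputCoord
      (⟨τ + a - c.1, hmem a ha c⟩, c.2) (⟨τ + a - c'.1, hmem a ha c'⟩, c'.2)).integrable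
      one_le_two

/-- Each coordinate of `W v` is a quadratic form in the inputs with mean `T v_c` and variance at
most `2 T ‖v‖²`. Summing over the `T p` coordinates gives `T² + 2 T² p ≤ 3 T² p` times `‖v‖²`. -/
theorem SemiAdversarial.integral_normSq_blockGram_le (h : SemiAdversarial P 𝓕 T N u w z)
    (hp : 1 ≤ p) {τ : ℕ} (h1 : T ≤ τ)
    (h2 : τ + T ≤ N + 1) (v : Fin T × Fin p → ℝ) :
    ∫ ω, normSq (blockGram T (fun t => u t ω) τ *ᵥ v) ∂P ≤ 3 * T ^ 2 * p * normSq v := by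
  have hmem : ∀ (a : Fin T) (c : Fin T × Fin p), τ + a - c.1 ∈ Finset.Icc 1 N := fun a c => by
    have ha := a.2
    have hc := c.1.2
    exact Finset.mem_Icc.2 ⟨by omega, by omega⟩
  have hrow : ∀ ω c, (blockGram T (fun t => u t ω) τ *ᵥ v) c
      = ∑ e : Fin T × (Fin T × Fin p), v e.2 *
        (inputCoord N u (⟨τ + e.1 - c.1, hmem e.1 c⟩, c.2) ω *
          inputCoord N u (⟨τ + e.1 - e.2.1, hmem e.1 e.2⟩, e.2.2) ω) := fun ω c => by
    simp only [mulVec, dotProduct, blockGram_apply, inputCoord]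
    refine Eq.trans (Finset.sum_congr rfl fun c' _ => ?_)
      (Finset.sum_comm.trans (Fintype.sum_prod_type _).symm)
    rw [Finset.sum_mul, Finset.sum_range]
    exact Finset.sum_congr rfl fun a _ => by ring
  have hcoord : ∀ c, ∫ ω, ((blockGram T (fun t => u t ω) τ *ᵥ v) c) ^ 2 ∂P
      ≤ (T * v c) ^ 2 + 2 * (T * normSq v) := fun c => by
    simp_rw [hrow]
    refine (integral_gaussian_quadratic_sq_le h.measurable_inputCoord h.map_inputCoord
      h.iIndepFun_coord (fun e : Fin T × (Fin T × Fin p) => v e.2)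
      (fun e => (⟨τ + e.1 - c.1, hmem e.1 c⟩, c.2))
      (fun e => (⟨τ + e.1 - e.2.1, hmem e.1 e.2⟩, e.2.2)) ?_).trans (le_of_eq ?_)
    -- With `c` fixed, the time of the first factor determines `a`, and then the second factor
    -- determines the column index.
    · rintro ⟨a, c1⟩ ⟨a', c1'⟩ heq
      have hc := c.1.2
      have hc1 := c1.1.2
      have hc1' := c1'.1.2
      simp only [Prod.ext_iff, Subtype.mk.injEq, and_true] at heq
      obtain ⟨e1, e2, e3⟩ := heq
      have ea : a = a' := Fin.ext (by omega)
      subst ea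
      exact Prod.ext rfl (Prod.ext (Fin.ext (by simp only; omega)) e3)
    · congr 2
      · rw [Fintype.sum_prod_type]
        have : ∀ a : Fin T, ∑ c' : Fin T × Fin p,
            (if ((⟨τ + a - c.1, hmem a c⟩, c.2) : Finset.Icc 1 N × Fin p)
              = (⟨τ + a - c'.1, hmem a c'⟩, c'.2) then v c' else 0) = v c := fun a => by
          rw [Finset.sum_eq_single c]
          · simp
          · intro c' _ hne
            rw [if_neg]
            intro heq
            simp only [Prod.ext_iff, Subtype.mk.injEq] at heq
            have hc := c.1.2
            have hc' := c'.1.2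
            exact hne (Prod.ext (Fin.ext (by omega)) heq.2.symm)
          · simp
        simp only [this]
        simp
      · rw [Fintype.sum_prod_type]
        simp [normSq]
  have hI : ∀ c, Integrable (fun ω => ((blockGram T (fun t => u t ω) τ *ᵥ v) c) ^ 2) P :=
    fun c => by
      refine MemLp.integrable_sq ?_
      simp only [mulVec, dotProduct]
      exact memLp_finsetSum _ fun c' _ => (h.blockGram_memLp h1 h2 c c').mul_const _
  have hv : 0 ≤ normSq v := Finset.sum_nonneg fun i _ => sq_nonneg _
  have hp' : (1 : ℝ) ≤ p := by exact_mod_cast hp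
  calc ∫ ω, normSq (blockGram T (fun t => u t ω) τ *ᵥ v) ∂P
      = ∑ c, ∫ ω, ((blockGram T (fun t => u t ω) τ *ᵥ v) c) ^ 2 ∂P :=
        integral_finsetSum _ fun c _ => hI c
    _ ≤ ∑ c, ((T * v c) ^ 2 + 2 * (T * normSq v)) := Finset.sum_le_sum fun c _ => hcoord c
    _ = T ^ 2 * normSq v + (T * p) * (2 * (T * normSq v)) := by
        rw [Finset.sum_add_distrib, Finset.sum_const, Finset.card_univ]
        simp only [mul_pow, ← Finset.mul_sum, normSq]
        simp
    _ ≤ _ := by nlinarith [mul_nonneg (sq_nonneg (T : ℝ)) hv,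
        mul_le_mul_of_nonneg_right hp' (mul_nonneg (sq_nonneg (T : ℝ)) hv)]

/-- The window at `τ` involves exactly the inputs at times strictly between `τ - T` and `τ + T`, so
windows whose starts differ by at least `2T - 1` share no input. -/
theorem SemiAdversarial.indepFun_blockGram_sum (h : SemiAdversarial P 𝓕 T N u w z)
    {τ : ℕ → ℕ} {b : ℕ}
    (h1 : ∀ a ≤ b, T ≤ τ a) (h2 : ∀ a ≤ b, τ a + T ≤ N + 1)
    (hsep : ∀ a < b, τ a + 2 * T ≤ τ b + 1) :
    IndepFun (fun ω => ∑ a ∈ Finset.range b, blockGram T (fun t => u t ω) (τ a))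
      (fun ω => blockGram T (fun t => u t ω) (τ b)) P := by
  set m : Finset.Icc 1 N → MeasurableSpace Ω := fun t => MeasurableSpace.comap (u t) inferInstance
    with hm
  have hle : ∀ t, m t ≤ mΩ := fun t =>
    (h.measurable_input (Finset.mem_Icc.1 t.2).1 (Finset.mem_Icc.1 t.2).2).comap_le
  have hind : iIndep m P := iIndepFun_of_filtration h.input_adapted h.input_indep
  -- Cut the time axis at `τ b - T`: the earlier windows lie in `S`, the last one in its complement.
  set S : Set (Finset.Icc 1 N) := {t | (t : ℕ) + T ≤ τ b} with hS
  have hdis : Disjoint S Sᶜ := disjoint_compl_right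
  have hI := indep_iSup_of_disjoint hle hind hdis
  have key : ∀ (R : Set (Finset.Icc 1 N)) (x : ℕ), T ≤ x → x + T ≤ N + 1 →
      (∀ t : Finset.Icc 1 N, x < t + T → t < x + T → t ∈ R) →
      ∀ c c', Measurable[⨆ t ∈ R, m t] fun ω => blockGram T (fun t => u t ω) x c c' := by
    intro R x hx1 hx2 hR c c'
    simp only [blockGram_apply]
    have hu : ∀ a ∈ Finset.range T, ∀ c : Fin T × Fin p,
        Measurable[⨆ t ∈ R, m t] fun ω => u (x + a - c.1) ω c.2 := fun a ha c => by
      have ha := Finset.mem_range.1 ha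
      have hc := c.1.2
      have hmem : x + a - c.1 ∈ Finset.Icc 1 N := Finset.mem_Icc.2 ⟨by omega, by omega⟩
      have hRm : (⟨x + a - c.1, hmem⟩ : Finset.Icc 1 N) ∈ R :=
        hR _ (by simp only; omega) (by simp only; omega)
      refine Measurable.mono (ma := m ⟨x + a - c.1, hmem⟩) ?_
        (le_iSup₂_of_le (⟨x + a - c.1, hmem⟩ : Finset.Icc 1 N) hRm le_rfl) le_rfl
      exact (measurable_pi_apply c.2).comp (comap_measurable _)
    exact Finset.measurable_fun_sum _ fun a ha => (hu a ha c).mul (hu a ha c')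
  refine indep_of_indep_of_le_left (indep_of_indep_of_le_right hI ?_) ?_
  · refine Measurable.comap_le ((@measurable_matrix_iff _ _ _ (⨆ t ∈ Sᶜ, m t) _).2 fun c c' => ?_)
    refine key _ _ (h1 b le_rfl) (h2 b le_rfl) (fun t ht _ => ?_) c c'
    simp only [hS, Set.mem_compl_iff, Set.mem_ofPred_eq]
    omega
  · refine Measurable.comap_le ((@measurable_matrix_iff _ _ _ (⨆ t ∈ S, m t) _).2 fun c c' => ?_)
    simp only [Matrix.sum_apply]
    refine Finset.measurable_fun_sum _ fun a ha => ?_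
    have ha := Finset.mem_range.1 ha
    refine key _ _ (h1 a ha.le) (h2 a ha.le) (fun t _ ht => ?_) c c'
    have := hsep a ha
    simp only [hS, Set.mem_ofPred_eq]
    omega

/-- The stacked inputs of a long experiment are well conditioned with high probability. -/
theorem SemiAdversarial.measure_illConditioned_le (h : SemiAdversarial P 𝓕 T N u w z)
    (hT : 1 ≤ T) (hp : 1 ≤ p) {L : ℕ} (hL : 1 ≤ L)
    (hN : 10 * (T * L) ≤ N) :
    P {ω | ∃ v, normSq v = 1 ∧ ∑ t ∈ Finset.Icc (T * L) N,
        (stackedInput T (fun t => u t ω) t ⬝ᵥ v) ^ 2 ≤ (N : ℝ) / 8}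
      ≤ ENNReal.ofReal (T * p * Real.exp (-(N / (96 * T * p)))) := by
  have hTL : T ≤ T * L := Nat.le_mul_of_pos_right T hL
  -- The number of complete blocks of length `2T`. Only the first `T` times of each block enter the
  -- estimate; the others serve as separation.
  set B := (N - T * L + 1) / (2 * T) with hB
  have hB1 : 2 * T * B ≤ N - T * L + 1 := Nat.mul_div_le _ _
  have hB2 : N - T * L + 1 < 2 * T * (B + 1) := Nat.lt_mul_div_succ _ (by omega)
  have hbb : ∀ b < B, 2 * T * b + 2 * T ≤ 2 * T * B := fun b hb => by
    calc 2 * T * b + 2 * T = 2 * T * (b + 1) := by ring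
      _ ≤ _ := Nat.mul_le_mul_left _ hb
  -- Discarding the first `T L` times and an incomplete last block costs less than `3N/10`, so at
  -- least `N/2` times remain in complete blocks.
  have hBr : (N : ℝ) ≤ 4 * T * B := by
    have : N ≤ 2 * (2 * T * B) := by
      have e : 2 * T * (B + 1) = 2 * T * B + 2 * T := by ring
      omega
    calc (N : ℝ) ≤ ((2 * (2 * T * B) : ℕ) : ℝ) := by exact_mod_cast this
      _ = _ := by push_cast; ring
  set τ : ℕ → ℕ := fun b => T * L + 2 * T * b with hτ
  have hτ1 : ∀ b, T ≤ τ b := fun b => by simp only [hτ]; omega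
  have hτ2 : ∀ b < B, τ b + T ≤ N + 1 := fun b hb => by
    have := hbb b hb; simp only [hτ]; omega
  have hTr : (1 : ℝ) ≤ T := by exact_mod_cast hT
  have hpr : (1 : ℝ) ≤ p := by exact_mod_cast hp
  have hmain := measure_quadratic_le_half_le (P := P)
    (W := fun b ω => blockGram T (fun t => u t ω) (τ b)) (B := B) (τ := T) (s := 3 * T ^ 2 * p)
    (fun b hb => measurable_matrix_iff.2 fun c c' => by
      simp only [blockGram_apply]
      refine Finset.measurable_fun_sum _ fun a ha => ?_
      have ha := Finset.mem_range.1 ha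
      have hc := c.1.2
      have hc' := c'.1.2
      have := hτ1 b
      have := hτ2 b hb
      exact ((measurable_pi_apply c.2).comp (h.measurable_input (by omega) (by omega))).mul
        ((measurable_pi_apply c'.2).comp (h.measurable_input (by omega) (by omega))))
    (fun b ω => posSemidef_blockGram T _ _)
    (fun b hb => h.indepFun_blockGram_sum (fun a _ => hτ1 a)
      (fun a ha => hτ2 a (ha.trans_lt hb)) fun a ha => by
        have : 2 * T * a + 2 * T ≤ 2 * T * b := by
          calc 2 * T * a + 2 * T = 2 * T * (a + 1) := by ring
            _ ≤ _ := Nat.mul_le_mul_left _ ha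
        simp only [hτ]; omega)
    (by positivity) (by positivity)
    (fun b hb c c' => h.integral_blockGram (hτ1 b) (hτ2 b hb) c c')
    (fun b hb c c' => h.blockGram_memLp (hτ1 b) (hτ2 b hb) c c')
    (fun b hb v => h.integral_normSq_blockGram_le hp (hτ1 b) (hτ2 b hb) v)
  refine (measure_mono ?_).trans (hmain.trans (ENNReal.ofReal_le_ofReal ?_))
  · rintro ω ⟨v, hv, hle⟩
    refine ⟨v, hv, ?_⟩
    rw [sum_mulVec, dotProduct_sum]
    simp only [dotProduct_blockGram]
    set f : ℕ → ℝ := fun t => (stackedInput T (fun t => u t ω) t ⬝ᵥ v) ^ 2 with hf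
    have hsum : ∀ k, ∑ b ∈ Finset.range k, ∑ a ∈ Finset.range T, f (τ b + a)
        ≤ ∑ t ∈ Finset.Ico (T * L) (T * L + 2 * T * k), f t := by
      intro k
      induction k with
      | zero => simp
      | succ k ih =>
        rw [Finset.sum_range_succ, ← Finset.sum_Ico_consecutive f
          (by omega : T * L ≤ T * L + 2 * T * k)
          (by rw [mul_add]; omega : T * L + 2 * T * k ≤ T * L + 2 * T * (k + 1))]
        refine add_le_add ih ?_
        have e : ∑ a ∈ Finset.range T, f (τ k + a) = ∑ t ∈ Finset.Ico (τ k) (τ k + T), f t := by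
          rw [Finset.sum_Ico_eq_sum_range]; simp
        rw [e]
        refine Finset.sum_le_sum_of_subset_of_nonneg (Finset.Ico_subset_Ico le_rfl ?_)
          fun _ _ _ => sq_nonneg _
        simp only [hτ, mul_add]; omega
    have hsub : Finset.Ico (T * L) (T * L + 2 * T * B) ⊆ Finset.Icc (T * L) N := fun t ht => by
      have := Finset.mem_Ico.1 ht
      exact Finset.mem_Icc.2 ⟨this.1, by omega⟩
    calc _ ≤ _ := hsum B
      _ ≤ ∑ t ∈ Finset.Icc (T * L) N, f t :=
          Finset.sum_le_sum_of_subset_of_nonneg hsub fun _ _ _ => sq_nonneg _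
      _ ≤ (N : ℝ) / 8 := hle
      _ ≤ _ := by linarith
  · simp only [Fintype.card_prod, Fintype.card_fin, Nat.cast_mul]
    -- With `τ = T` and `s = 3T²p` the Chernoff exponent is `B / (24 p)`, and `B ≥ N / (4T)`.
    refine mul_le_mul_of_nonneg_left (Real.exp_le_exp.2 (neg_le_neg ?_)) (by positivity)
    rw [div_le_div_iff₀ (by positivity) (by positivity)]
    have h3 : (0 : ℝ) ≤ (T : ℝ) ^ 2 * p := by positivity
    nlinarith [mul_le_mul_of_nonneg_right hBr h3]

end Inputs

/-! ### Gaussian integrals -/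

section GaussianIntegrals

/-- Completing the square turns the integrand times the density into a multiple of the Gaussian
density with mean `a / (1 - b)` and variance `1 / (1 - b)`. -/
theorem lintegral_exp_quadratic_gaussianReal (a : ℝ) {b : ℝ} (hb : b < 1) :
    ∫⁻ x, ENNReal.ofReal (Real.exp (a * x + b * x ^ 2 / 2)) ∂(gaussianReal 0 1)
      = ENNReal.ofReal (Real.exp (a ^ 2 / (2 * (1 - b))) / √(1 - b)) := by
  set c := 1 - b with hc
  have hc0 : 0 < c := by rw [hc]; linarith
  set v : NNReal := ⟨1 / c, by positivity⟩ with hv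
  have hv0 : v ≠ 0 := by
    intro h
    have : (1 / c : ℝ) = 0 := congrArg NNReal.toReal h
    exact (one_div_pos.2 hc0).ne' this
  have hvc : (v : ℝ) = 1 / c := rfl
  rw [gaussianReal_of_var_ne_zero 0 one_ne_zero,
    lintegral_withDensity_eq_lintegral_mul _ (measurable_gaussianPDF 0 1) (by fun_prop)]
  have hpt : ∀ x, (gaussianPDF 0 1 * fun x => ENNReal.ofReal (Real.exp (a * x + b * x ^ 2 / 2))) x
      = ENNReal.ofReal (Real.exp (a ^ 2 / (2 * c)) / √c) * gaussianPDF (a / c) v x := fun x => by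
    simp only [Pi.mul_apply, gaussianPDF]
    rw [← ENNReal.ofReal_mul (gaussianPDFReal_nonneg _ _ _), ← ENNReal.ofReal_mul (by positivity)]
    congr 1
    simp only [gaussianPDFReal, hvc, NNReal.coe_one]
    have e1 : √(2 * Real.pi * (1 / c)) = √(2 * Real.pi * 1) / √c := by
      rw [mul_one, mul_one_div, Real.sqrt_div (by positivity)]
    rw [e1, mul_assoc, ← Real.exp_add]
    have e2 : -(x - 0) ^ 2 / (2 * 1) + (a * x + b * x ^ 2 / 2)
        = a ^ 2 / (2 * c) + -(x - a / c) ^ 2 / (2 * (1 / c)) := by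
      have : b = 1 - c := by rw [hc]; ring
      rw [this]; field_simp; ring
    rw [e2, Real.exp_add]
    have : √c ≠ 0 := (Real.sqrt_pos.2 hc0).ne'
    have : √(2 * Real.pi * 1) ≠ 0 := (Real.sqrt_pos.2 (by positivity)).ne'
    field_simp
  simp_rw [hpt]
  rw [lintegral_const_mul _ (measurable_gaussianPDF _ _), lintegral_gaussianPDF_eq_one _ hv0,
    mul_one]

theorem map_dotProduct_pi_gaussianReal {p : ℕ} (q : Fin p → ℝ) :
    (Measure.pi fun _ : Fin p => gaussianReal 0 1).map (fun x => q ⬝ᵥ x)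
      = gaussianReal 0 (Real.toNNReal (normSq q)) := by
  apply Measure.ext_of_charFun
  ext t
  have hm : Measurable fun x : Fin p → ℝ => q ⬝ᵥ x := by
    simp only [dotProduct]
    fun_prop
  rw [charFun_apply_real, integral_map hm.aemeasurable (by fun_prop),
    charFun_gaussianReal]
  have e : ∀ x : Fin p → ℝ, Complex.exp (t * ((q ⬝ᵥ x : ℝ) : ℂ) * Complex.I)
      = ∏ i, Complex.exp (((t * q i : ℝ) : ℂ) * (x i : ℂ) * Complex.I) := fun x => by
    rw [← Complex.exp_sum]
    congr 1
    simp only [dotProduct]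
    push_cast
    rw [Finset.mul_sum, Finset.sum_mul]
    exact Finset.sum_congr rfl fun i _ => by ring
  simp_rw [e]
  rw [integral_fintype_prod_eq_prod
    (f := fun i (x : ℝ) => Complex.exp (((t * q i : ℝ) : ℂ) * (x : ℂ) * Complex.I))]
  simp_rw [← charFun_apply_real, charFun_gaussianReal]
  rw [← Complex.exp_sum]
  congr 1
  have hn : 0 ≤ normSq q := Finset.sum_nonneg fun i _ => sq_nonneg _
  rw [Real.coe_toNNReal _ hn]
  simp only [normSq]
  push_cast
  simp only [mul_zero, zero_mul, zero_sub, one_mul]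
  rw [Finset.sum_mul, Finset.sum_div, ← Finset.sum_neg_distrib]
  exact Finset.sum_congr rfl fun i _ => by ring

/-- Freezing: a variable known to `𝓖` may be held fixed while averaging over one independent of `𝓖`.
-/
theorem lintegral_prod_of_indep {Ω E F : Type*} [MeasurableSpace E] [MeasurableSpace F]
    {𝓖 mΩ : MeasurableSpace Ω} {P : Measure Ω} [IsProbabilityMeasure P] (h𝓖 : 𝓖 ≤ mΩ)
    {X : Ω → E} (hX : Measurable[𝓖] X) {Y : Ω → F}
    (hY : Measurable Y) (hind : Indep (MeasurableSpace.comap Y inferInstance) 𝓖 P)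
    {f : E × F → ENNReal} (hf : Measurable f) :
    ∫⁻ ω, f (X ω, Y ω) ∂P = ∫⁻ ω, ∫⁻ y, f (X ω, y) ∂(P.map Y) ∂P := by
  have hX' : Measurable X := hX.mono h𝓖 le_rfl
  have hXY : IndepFun X Y P := by
    refine Indep.symm ?_
    exact indep_of_indep_of_le_right hind hX.comap_le
  calc _ = ∫⁻ q, f q ∂(P.map fun ω => (X ω, Y ω)) := (lintegral_map hf (hX'.prodMk hY)).symm
    _ = _ := by
      rw [(indepFun_iff_map_prod_eq_prod_map_map hX'.aemeasurable hY.aemeasurable).1 hXY,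
        lintegral_prod _ hf.aemeasurable, lintegral_map hf.lintegral_prod_right' hX']

end GaussianIntegrals

/-! ### Self-normalized martingale bound -/

section SelfNormalized

variable {ι : Type*} [Fintype ι] [DecidableEq ι]

/-- `exp (⟨S, V⁻¹ S⟩ / 2) / √(det V)`. -/
def potential (V : Matrix ι ι ℝ) (S : ι → ℝ) : ENNReal :=
  ENNReal.ofReal (Real.exp (S ⬝ᵥ V⁻¹ *ᵥ S / 2) / √V.det)

theorem measurable_matrix_inv : Measurable fun V : Matrix ι ι ℝ => V⁻¹ := by
  have : (fun V : Matrix ι ι ℝ => V⁻¹) = fun V => (V.det)⁻¹ • V.adjugate := by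
    ext V : 1
    rw [inv_def, Ring.inverse_eq_inv']
  rw [this]
  have h1 : Measurable fun V : Matrix ι ι ℝ => V.det := (continuous_id.matrix_det).measurable
  have h2 : Measurable fun V : Matrix ι ι ℝ => V.adjugate :=
    (continuous_id.matrix_adjugate).measurable
  refine measurable_matrix_iff.2 fun i j => ?_
  exact h1.inv.mul (measurable_matrix_iff.1 h2 i j)

theorem measurable_potential :
    Measurable fun q : Matrix ι ι ℝ × (ι → ℝ) => potential q.1 q.2 := by
  unfold potential
  have h1 : Measurable fun q : Matrix ι ι ℝ × (ι → ℝ) => q.1.det :=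
    (continuous_id.matrix_det).measurable.comp measurable_fst
  have h2 : Measurable fun q : Matrix ι ι ℝ × (ι → ℝ) => q.2 ⬝ᵥ q.1⁻¹ *ᵥ q.2 := by
    simp only [dotProduct, mulVec]
    refine Finset.measurable_fun_sum _ fun i _ => ?_
    refine ((measurable_pi_apply i).comp measurable_snd).mul ?_
    refine Finset.measurable_fun_sum _ fun j _ => ?_
    exact (measurable_matrix_iff.1 (measurable_matrix_inv.comp measurable_fst) i j).mul
      ((measurable_pi_apply j).comp measurable_snd)
  exact ((h2.div_const 2).exp.div h1.sqrt).ennreal_ofReal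

theorem measurable_potential_add :
    Measurable fun q : (Matrix ι ι ℝ × ((ι → ℝ) × (ι → ℝ))) × ℝ =>
      potential (q.1.1 + vecMulVec q.1.2.2 q.1.2.2) (q.1.2.1 + q.2 • q.1.2.2) := by
  have h0 : Measurable fun q : (Matrix ι ι ℝ × ((ι → ℝ) × (ι → ℝ))) × ℝ => q.1.2.2 :=
    measurable_snd.comp (measurable_snd.comp measurable_fst)
  have h1 : Measurable fun q : (Matrix ι ι ℝ × ((ι → ℝ) × (ι → ℝ))) × ℝ =>
      q.1.1 + vecMulVec q.1.2.2 q.1.2.2 := by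
    refine measurable_matrix_iff.2 fun a b => ?_
    simp only [Matrix.add_apply, vecMulVec_apply]
    exact (measurable_matrix_iff.1 (measurable_fst.comp measurable_fst) a b).add
      (((measurable_pi_apply a).comp h0).mul ((measurable_pi_apply b).comp h0))
  have h2 : Measurable fun q : (Matrix ι ι ℝ × ((ι → ℝ) × (ι → ℝ))) × ℝ =>
      q.1.2.1 + q.2 • q.1.2.2 :=
    (measurable_fst.comp (measurable_snd.comp measurable_fst)).add (measurable_snd.smul h0)
  have h3 := measurable_potential.comp (h1.prodMk h2)
  exact h3

theorem _root_.Matrix.PosDef.isSymm {A : Matrix ι ι ℝ} (hA : A.PosDef) : A.IsSymm :=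
  hA.posSemidef.isSymm

theorem dotProduct_mulVec_comm {A : Matrix ι ι ℝ} (hA : A.IsSymm) (x y : ι → ℝ) :
    x ⬝ᵥ A *ᵥ y = y ⬝ᵥ A *ᵥ x := by
  rw [dotProduct_mulVec, ← mulVec_transpose, hA.eq, dotProduct_comm]

theorem inv_nonneg_quadratic {V : Matrix ι ι ℝ} (hV : V.PosDef) (x : ι → ℝ) :
    0 ≤ x ⬝ᵥ V⁻¹ *ᵥ x := hV.inv.posSemidef.dotProduct_nonneg x

/-- The Sherman–Morrison formula. -/
theorem inv_add_vecMulVec {V : Matrix ι ι ℝ} (hV : V.PosDef) (ζ : ι → ℝ) :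
    (V + vecMulVec ζ ζ)⁻¹
      = V⁻¹ - (1 + ζ ⬝ᵥ V⁻¹ *ᵥ ζ)⁻¹ • vecMulVec (V⁻¹ *ᵥ ζ) (V⁻¹ *ᵥ ζ) := by
  have hr := inv_nonneg_quadratic hV ζ
  set r := ζ ⬝ᵥ V⁻¹ *ᵥ ζ with hrd
  have hdet : IsUnit V.det := hV.det_pos.ne'.isUnit
  have hVV : V * V⁻¹ = 1 := mul_nonsing_inv V hdet
  refine inv_eq_right_inv ?_
  have hs : V⁻¹ᵀ = V⁻¹ := hV.inv.isSymm.eq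
  have e1 : vecMulVec ζ ζ * V⁻¹ = vecMulVec ζ (V⁻¹ *ᵥ ζ) := by
    rw [vecMulVec_mul, ← mulVec_transpose, hs]
  have e2 : V * vecMulVec (V⁻¹ *ᵥ ζ) (V⁻¹ *ᵥ ζ) = vecMulVec ζ (V⁻¹ *ᵥ ζ) := by
    rw [mul_vecMulVec, mulVec_mulVec, hVV, one_mulVec]
  have e3 : vecMulVec ζ ζ * vecMulVec (V⁻¹ *ᵥ ζ) (V⁻¹ *ᵥ ζ) = r • vecMulVec ζ (V⁻¹ *ᵥ ζ) := by
    ext i j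
    simp only [mul_apply, vecMulVec_apply, Matrix.smul_apply, smul_eq_mul, hrd, dotProduct,
      Finset.sum_mul]
    exact Finset.sum_congr rfl fun k _ => by ring
  rw [add_mul, mul_sub, mul_sub, Matrix.mul_smul, Matrix.mul_smul, hVV, e1, e2, e3, smul_smul]
  have : (1 + r)⁻¹ + (1 + r)⁻¹ * r = 1 := by field_simp
  have e4 : vecMulVec ζ (V⁻¹ *ᵥ ζ)
      = (1 + r)⁻¹ • vecMulVec ζ (V⁻¹ *ᵥ ζ) + ((1 + r)⁻¹ * r) • vecMulVec ζ (V⁻¹ *ᵥ ζ) := by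
    rw [← add_smul, this, one_smul]
  nth_rw 2 [e4]
  abel

theorem det_add_vecMulVec {V : Matrix ι ι ℝ} (hV : V.PosDef) (ζ : ι → ℝ) :
    (V + vecMulVec ζ ζ).det = V.det * (1 + ζ ⬝ᵥ V⁻¹ *ᵥ ζ) := by
  have hdet : IsUnit V.det := hV.det_pos.ne'.isUnit
  have h := det_add_replicateCol_mul_replicateRow (ι := Unit) hdet ζ ζ
  rw [← vecMulVec_eq] at h
  rw [h]
  congr 1
  rw [det_unique]
  simp only [Matrix.add_apply, one_apply_eq, Matrix.mul_assoc]
  congr 1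

/-- The martingale property of the potential. By Sherman–Morrison the exponent is quadratic in `y`;
its Gaussian integral restores `⟨S, V⁻¹ S⟩` and produces `√(1 + r)`, which cancels the growth of the
determinant exactly. -/
theorem lintegral_potential_add {V : Matrix ι ι ℝ} (hV : V.PosDef) (S ζ : ι → ℝ) :
    ∫⁻ y, potential (V + vecMulVec ζ ζ) (S + y • ζ) ∂(gaussianReal 0 1) = potential V S := by
  have hr := inv_nonneg_quadratic hV ζ
  set r := ζ ⬝ᵥ V⁻¹ *ᵥ ζ with hrd
  set s := ζ ⬝ᵥ V⁻¹ *ᵥ S with hsd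
  set A := S ⬝ᵥ V⁻¹ *ᵥ S with hA
  have h1r : 0 < 1 + r := by linarith
  have hsS : S ⬝ᵥ V⁻¹ *ᵥ ζ = s := dotProduct_mulVec_comm hV.inv.isSymm S ζ
  have hd := hV.det_pos
  have hquad : ∀ y : ℝ, (S + y • ζ) ⬝ᵥ (V + vecMulVec ζ ζ)⁻¹ *ᵥ (S + y • ζ)
      = A - s ^ 2 / (1 + r) + 2 * (s / (1 + r) * y + r / (1 + r) * y ^ 2 / 2) := fun y => by
    rw [inv_add_vecMulVec hV, sub_mulVec, dotProduct_sub, smul_mulVec, dotProduct_smul,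
      vecMulVec_mulVec, op_smul_eq_smul, dotProduct_smul]
    have g1 : (S + y • ζ) ⬝ᵥ V⁻¹ *ᵥ (S + y • ζ) = A + 2 * y * s + y ^ 2 * r := by
      simp only [mulVec_add, mulVec_smul, dotProduct_add, add_dotProduct, dotProduct_smul,
        smul_dotProduct, smul_eq_mul, hsS, ← hA, ← hsd, ← hrd]
      ring
    have g2 : (S + y • ζ) ⬝ᵥ V⁻¹ *ᵥ ζ = s + y * r := by
      simp only [add_dotProduct, smul_dotProduct, smul_eq_mul, hsS, ← hrd]
    have g3 : V⁻¹ *ᵥ ζ ⬝ᵥ (S + y • ζ) = s + y * r := by rw [dotProduct_comm, g2]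
    rw [g1, g2, g3, ← hrd]
    simp only [smul_eq_mul]
    field_simp
    ring
  have hpt : ∀ y : ℝ, potential (V + vecMulVec ζ ζ) (S + y • ζ)
      = ENNReal.ofReal (Real.exp ((A - s ^ 2 / (1 + r)) / 2) / √(V.det * (1 + r)))
        * ENNReal.ofReal (Real.exp (s / (1 + r) * y + r / (1 + r) * y ^ 2 / 2)) := fun y => by
    rw [potential, hquad, det_add_vecMulVec hV, ← hrd, ← ENNReal.ofReal_mul (by positivity)]
    congr 1
    rw [div_mul_eq_mul_div (Real.exp ((A - s ^ 2 / (1 + r)) / 2)), ← Real.exp_add]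
    congr 2
    ring
  simp_rw [hpt]
  have hb : r / (1 + r) < 1 := by rw [div_lt_one h1r]; linarith
  rw [lintegral_const_mul _ (by fun_prop), lintegral_exp_quadratic_gaussianReal _ hb,
    ← ENNReal.ofReal_mul (by positivity), potential, ← hA]
  congr 1
  have hb' : 1 - r / (1 + r) = (1 + r)⁻¹ := by field_simp; ring
  rw [hb', Real.sqrt_inv, Real.sqrt_mul hd.le, div_mul_div_comm, ← Real.exp_add]
  have e1 : (A - s ^ 2 / (1 + r)) / 2 + (s / (1 + r)) ^ 2 / (2 * (1 + r)⁻¹) = A / 2 := by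
    field_simp; ring
  have : √(1 + r) ≠ 0 := (Real.sqrt_pos.2 h1r).ne'
  rw [e1, mul_assoc, mul_inv_cancel₀ this, mul_one]

/-- Cauchy–Schwarz for the inner product of `V`, applied to `V⁻¹ S` and `x`. -/
theorem sq_dotProduct_le {V : Matrix ι ι ℝ} (hV : V.PosDef) (S x : ι → ℝ) :
    (S ⬝ᵥ x) ^ 2 ≤ (S ⬝ᵥ V⁻¹ *ᵥ S) * (x ⬝ᵥ V *ᵥ x) := by
  have hdet : IsUnit V.det := hV.det_pos.ne'.isUnit
  set y := V⁻¹ *ᵥ S with hy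
  have hS : S = V *ᵥ y := by rw [hy, mulVec_mulVec, mul_nonsing_inv V hdet, one_mulVec]
  have hSx : S ⬝ᵥ x = y ⬝ᵥ V *ᵥ x := by
    rw [dotProduct_mulVec_comm hV.isSymm y x, ← hS, dotProduct_comm]
  have hSy : S ⬝ᵥ y = y ⬝ᵥ V *ᵥ y := by rw [← hS, dotProduct_comm]
  rw [hSx, hSy]
  have key : ∀ t : ℝ, 0 ≤ (x ⬝ᵥ V *ᵥ x) * (t * t) + 2 * (y ⬝ᵥ V *ᵥ x) * t + y ⬝ᵥ V *ᵥ y :=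
    fun t => by
      have := hV.posSemidef.dotProduct_nonneg (t • x + y)
      simp only [mulVec_add, mulVec_smul, dotProduct_add, add_dotProduct, dotProduct_smul,
        smul_dotProduct, smul_eq_mul, dotProduct_mulVec_comm hV.isSymm x y] at this
      linarith
  have := discrim_le_zero key
  rw [discrim] at this
  linarith

variable {Ω : Type*} [mΩ : MeasurableSpace Ω] {P : Measure Ω} [IsProbabilityMeasure P]

/-- The regularized Gram matrix `I + ∑_{i < k} ζ_i ζ_iᵀ`. -/
def regGram (ζ : ℕ → ι → ℝ) (k : ℕ) : Matrix ι ι ℝ :=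
  1 + ∑ i ∈ Finset.range k, vecMulVec (ζ i) (ζ i)

theorem posDef_regGram (ζ : ℕ → ι → ℝ) (k : ℕ) : (regGram ζ k).PosDef := by
  refine PosDef.one.add_posSemidef (posSemidef_sum _ fun i _ => ?_)
  simpa using posSemidef_vecMulVec_self_star (ζ i)

theorem dotProduct_regGram (ζ : ℕ → ι → ℝ) (k : ℕ) (x : ι → ℝ) :
    x ⬝ᵥ regGram ζ k *ᵥ x = normSq x + ∑ i ∈ Finset.range k, (ζ i ⬝ᵥ x) ^ 2 := by
  rw [regGram, add_mulVec, dotProduct_add, one_mulVec, sum_mulVec, dotProduct_sum]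
  congr 1
  · simp only [dotProduct, normSq, pow_two]
  · refine Finset.sum_congr rfl fun a _ => ?_
    rw [vecMulVec_mulVec, dotProduct_comm x, op_smul_eq_smul, smul_dotProduct, smul_eq_mul, pow_two]

theorem trace_regGram (ζ : ℕ → ι → ℝ) (k : ℕ) :
    (regGram ζ k).trace = Fintype.card ι + ∑ i ∈ Finset.range k, normSq (ζ i) := by
  rw [regGram, trace_add, trace_one, trace_sum]
  congr 1
  refine Finset.sum_congr rfl fun a _ => ?_
  simp only [trace, diag_apply, vecMulVec_apply, normSq, pow_two]

/-- The potential starts at `1`, since `V = I` and `S = 0`. At each step `ζ k` and the past are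
frozen and the fresh Gaussian `η k` is integrated out. -/
theorem lintegral_potential_le_one {𝓖 : ℕ → MeasurableSpace Ω} (h𝓖 : ∀ k, 𝓖 k ≤ mΩ)
    (hmono : Monotone 𝓖) {ζ : ℕ → Ω → ι → ℝ} {η : ℕ → Ω → ℝ} {K : ℕ}
    (hζ : ∀ k < K, Measurable[𝓖 k] (ζ k)) (hη : ∀ k < K, Measurable[𝓖 (k + 1)] (η k))
    (hlaw : ∀ k < K, P.map (η k) = gaussianReal 0 1)
    (hind : ∀ k < K, Indep (MeasurableSpace.comap (η k) inferInstance) (𝓖 k) P) :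
    ∫⁻ ω, potential (regGram (fun i => ζ i ω) K) (∑ i ∈ Finset.range K, η i ω • ζ i ω) ∂P ≤ 1 := by
  have main : ∀ k ≤ K, ∫⁻ ω, potential (regGram (fun i => ζ i ω) k)
      (∑ i ∈ Finset.range k, η i ω • ζ i ω) ∂P ≤ 1 := by
    intro k
    induction k with
    | zero => intro _; simp [regGram, potential]
    | succ k ih =>
      intro hk
      have hk' : k < K := hk
      refine le_trans (le_of_eq ?_) (ih hk'.le)
      have hζm : ∀ i ≤ k, Measurable[𝓖 k] (ζ i) := fun i hi =>
        (hζ i (hi.trans_lt hk')).mono (hmono hi) le_rfl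
      have hηm : ∀ i < k, Measurable[𝓖 k] (η i) := fun i hi =>
        (hη i (hi.trans hk')).mono (hmono hi) le_rfl
      have hVm : Measurable[𝓖 k] fun ω => regGram (fun i => ζ i ω) k := by
        refine (@measurable_matrix_iff _ _ _ (𝓖 k) _).2 fun a b => ?_
        simp only [regGram, Matrix.add_apply, Matrix.sum_apply, vecMulVec_apply]
        refine Measurable.const_add (Finset.measurable_fun_sum _ fun i hi => ?_) _
        have := hζm i (Finset.mem_range.1 hi).le
        exact ((measurable_pi_apply a).comp this).mul ((measurable_pi_apply b).comp this)
      have hSm : Measurable[𝓖 k] fun ω => ∑ i ∈ Finset.range k, η i ω • ζ i ω :=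
        Finset.measurable_fun_sum _ fun i hi =>
          (hηm i (Finset.mem_range.1 hi)).smul (hζm i (Finset.mem_range.1 hi).le)
      have hX : Measurable[𝓖 k] fun ω => (regGram (fun i => ζ i ω) k,
          (∑ i ∈ Finset.range k, η i ω • ζ i ω, ζ k ω)) := hVm.prodMk (hSm.prodMk (hζm k le_rfl))
      have h := lintegral_prod_of_indep (h𝓖 k) hX ((hη k hk').mono (h𝓖 _) le_rfl) (hind k hk')
        measurable_potential_add
      rw [hlaw k hk'] at h
      simp only [lintegral_potential_add (posDef_regGram _ _)] at h
      rw [← h]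
      refine lintegral_congr fun ω => ?_
      rw [Finset.sum_range_succ, regGram, regGram, Finset.sum_range_succ, add_assoc]
  exact main K le_rfl

/-- Markov's inequality for the potential at level `1/δ`, after taking logarithms. -/
theorem measure_log_det_add_le {𝓖 : ℕ → MeasurableSpace Ω} (h𝓖 : ∀ k, 𝓖 k ≤ mΩ)
    (hmono : Monotone 𝓖) {ζ : ℕ → Ω → ι → ℝ} {η : ℕ → Ω → ℝ} {K : ℕ}
    (hζ : ∀ k < K, Measurable[𝓖 k] (ζ k)) (hη : ∀ k < K, Measurable[𝓖 (k + 1)] (η k))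
    (hlaw : ∀ k < K, P.map (η k) = gaussianReal 0 1)
    (hind : ∀ k < K, Indep (MeasurableSpace.comap (η k) inferInstance) (𝓖 k) P)
    {δ : ℝ} (hδ : 0 < δ) :
    P {ω | Real.log (regGram (fun i => ζ i ω) K).det + 2 * Real.log (1 / δ)
        ≤ (∑ i ∈ Finset.range K, η i ω • ζ i ω) ⬝ᵥ (regGram (fun i => ζ i ω) K)⁻¹ *ᵥ
          (∑ i ∈ Finset.range K, η i ω • ζ i ω)} ≤ ENNReal.ofReal δ := by
  have h1 := lintegral_potential_le_one (P := P) h𝓖 hmono hζ hη hlaw hind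
  have h2 : Measurable fun ω => regGram (fun i => ζ i ω) K := by
    refine measurable_matrix_iff.2 fun a b => ?_
    simp only [regGram, Matrix.add_apply, Matrix.sum_apply, vecMulVec_apply]
    refine Measurable.const_add (Finset.measurable_fun_sum _ fun i hi => ?_) _
    have := (hζ i (Finset.mem_range.1 hi)).mono (h𝓖 _) le_rfl
    exact ((measurable_pi_apply a).comp this).mul ((measurable_pi_apply b).comp this)
  have h3 : Measurable fun ω => ∑ i ∈ Finset.range K, η i ω • ζ i ω :=
    Finset.measurable_fun_sum _ fun i hi =>
      ((hη i (Finset.mem_range.1 hi)).mono (h𝓖 _) le_rfl).smul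
        ((hζ i (Finset.mem_range.1 hi)).mono (h𝓖 _) le_rfl)
  have hm : AEMeasurable (fun ω => potential (regGram (fun i => ζ i ω) K)
      (∑ i ∈ Finset.range K, η i ω • ζ i ω)) P :=
    (measurable_potential.comp (h2.prodMk h3)).aemeasurable
  have hmk := meas_ge_le_lintegral_div hm (ε := ENNReal.ofReal (1 / δ))
    (by simpa using hδ) ENNReal.ofReal_ne_top
  refine (measure_mono ?_).trans (hmk.trans ?_)
  · intro ω hω
    simp only [Set.mem_ofPred_eq] at hω ⊢
    refine ENNReal.ofReal_le_ofReal ?_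
    set V := regGram (fun i => ζ i ω) K
    have hd : 0 < V.det := (posDef_regGram _ _).det_pos
    rw [le_div_iff₀ (Real.sqrt_pos.2 hd), ← Real.log_le_iff_le_exp (by positivity),
      Real.log_mul (by positivity) (by positivity), Real.log_sqrt hd.le]
    linarith
  · refine (ENNReal.div_le_div_right h1 _).trans (le_of_eq ?_)
    rw [one_div, one_div, ENNReal.ofReal_inv_of_pos hδ, inv_inv]

end SelfNormalized

/-! ### Nets of the sphere -/

/-- A `1/2`-separated set of largest size is a net. Doubling it gives a `1`-separated set in the
ball of radius `2`, whose size is at most `5^p` by volume. -/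
theorem exists_sphere_net (p : ℕ) : ∃ 𝒩 : Finset (EuclideanSpace ℝ (Fin p)),
    (∀ q ∈ 𝒩, ‖q‖ = 1) ∧ 𝒩.card ≤ 5 ^ p ∧ ∀ x : EuclideanSpace ℝ (Fin p), ‖x‖ = 1 →
      ∃ q ∈ 𝒩, ‖x - q‖ ≤ 1 / 2 := by
  classical
  set good : Finset (EuclideanSpace ℝ (Fin p)) → Prop := fun s =>
    (∀ q ∈ s, ‖q‖ = 1) ∧ ∀ q ∈ s, ∀ q' ∈ s, q ≠ q' → 1 / 2 ≤ ‖q - q'‖ with hgood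
  have hcard : ∀ s, good s → s.card ≤ 5 ^ p := fun s hs => by
    have h2 : Function.Injective fun q : EuclideanSpace ℝ (Fin p) => (2 : ℝ) • q :=
      smul_right_injective _ two_ne_zero
    have := Besicovitch.card_le_of_separated (s.image fun q => (2 : ℝ) • q) (by
      intro c hc
      obtain ⟨q, hq, rfl⟩ := Finset.mem_image.1 hc
      rw [norm_smul, hs.1 q hq]; simp) (by
      intro c hc d hd hne
      obtain ⟨q, hq, rfl⟩ := Finset.mem_image.1 hc
      obtain ⟨q', hq', rfl⟩ := Finset.mem_image.1 hd
      have := hs.2 q hq q' hq' fun h => hne (by rw [h])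
      rw [← smul_sub, norm_smul, Real.norm_ofNat]
      linarith)
    rwa [Finset.card_image_of_injective _ h2, finrank_euclideanSpace_fin] at this
  obtain ⟨s, hs, hmax⟩ : ∃ s, good s ∧ ∀ s', good s' → s'.card ≤ s.card := by
    by_contra! hcon
    have : ∀ k : ℕ, ∃ s, good s ∧ k ≤ s.card := by
      intro k
      induction k with
      | zero => exact ⟨∅, by simp [hgood], by simp⟩
      | succ k ih =>
        obtain ⟨s, hs, hk⟩ := ih
        obtain ⟨s', hs', hlt⟩ := hcon s hs
        exact ⟨s', hs', by omega⟩
    obtain ⟨s, hs, hk⟩ := this (5 ^ p + 1)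
    have := hcard s hs
    omega
  refine ⟨s, hs.1, hcard s hs, fun x hx => ?_⟩
  by_contra! hcon
  have hx' : x ∉ s := fun h => by
    have := hcon x h
    rw [sub_self, norm_zero] at this
    linarith
  have : good (insert x s) := by
    refine ⟨fun q hq => ?_, fun q hq q' hq' hne => ?_⟩
    · rcases Finset.mem_insert.1 hq with rfl | hq
      · exact hx
      · exact hs.1 q hq
    · rcases Finset.mem_insert.1 hq with rfl | hq <;> rcases Finset.mem_insert.1 hq' with rfl | hq'
      · exact absurd rfl hne
      · exact (hcon q' hq').le
      · rw [norm_sub_rev]; exact (hcon q ‹_›).le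
      · exact hs.2 q hq q' hq' hne
  have := hmax _ this
  rw [Finset.card_insert_of_notMem hx'] at this
  omega

/-- Replacing the direction of `y` by a net point at distance `1/2` loses at most half of `‖y‖`,
hence the factor `4` on squares. -/
theorem norm_sq_le_of_net {p : ℕ} {𝒩 : Finset (EuclideanSpace ℝ (Fin p))}
    (hnet : ∀ x : EuclideanSpace ℝ (Fin p), ‖x‖ = 1 → ∃ q ∈ 𝒩, ‖x - q‖ ≤ 1 / 2)
    (y : EuclideanSpace ℝ (Fin p)) {ρ : ℝ} (hρ : 0 ≤ ρ) (h : ∀ q ∈ 𝒩, (inner ℝ q y) ^ 2 ≤ ρ) :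
    ‖y‖ ^ 2 ≤ 4 * ρ := by
  rcases eq_or_ne y 0 with rfl | hy
  · simp; linarith
  have hy' : 0 < ‖y‖ := norm_pos_iff.2 hy
  obtain ⟨q, hq, hxq⟩ := hnet (‖y‖⁻¹ • y) (by
    rw [norm_smul, norm_inv, norm_norm, inv_mul_cancel₀ hy'.ne'])
  have h1 : inner ℝ (‖y‖⁻¹ • y) y = ‖y‖ := by
    rw [real_inner_smul_left, real_inner_self_eq_norm_sq]; field_simp
  have h2 : inner ℝ (‖y‖⁻¹ • y - q) y ≤ 1 / 2 * ‖y‖ :=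
    (real_inner_le_norm _ _).trans (mul_le_mul_of_nonneg_right hxq hy'.le)
  rw [inner_sub_left, h1] at h2
  have h3 : ‖y‖ ≤ 2 * inner ℝ q y := by linarith
  nlinarith [h q hq]

theorem normSq_nonneg {ι : Type*} [Fintype ι] (v : ι → ℝ) : 0 ≤ normSq v :=
  Finset.sum_nonneg fun _ _ => sq_nonneg _

theorem normSq_eq_norm_sq {ι : Type*} [Fintype ι] (v : ι → ℝ) :
    normSq v = ‖WithLp.toLp 2 v‖ ^ 2 := by
  rw [EuclideanSpace.real_norm_sq_eq]; rfl

theorem exists_normSq_net {p : ℕ} (hp : 1 ≤ p) : ∃ 𝒩 : Finset (Fin p → ℝ), 𝒩.Nonempty ∧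
    (∀ q ∈ 𝒩, normSq q = 1) ∧ 𝒩.card ≤ 5 ^ p ∧
    ∀ (y : Fin p → ℝ) (ρ : ℝ), 0 ≤ ρ → (∀ q ∈ 𝒩, (q ⬝ᵥ y) ^ 2 ≤ ρ) → normSq y ≤ 4 * ρ := by
  classical
  obtain ⟨𝒩, h1, h2, h3⟩ := exists_sphere_net p
  refine ⟨𝒩.image WithLp.ofLp, ?_, ?_, Finset.card_image_le.trans h2, ?_⟩
  · obtain ⟨q, hq, _⟩ := h3 (EuclideanSpace.single ⟨0, hp⟩ 1) (by simp)
    exact ⟨_, Finset.mem_image_of_mem _ hq⟩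
  · intro q hq
    obtain ⟨q, hq', rfl⟩ := Finset.mem_image.1 hq
    rw [normSq_eq_norm_sq, WithLp.toLp_ofLp, h1 q hq', one_pow]
  · intro y ρ hρ hy
    rw [normSq_eq_norm_sq]
    refine norm_sq_le_of_net h3 _ hρ fun q hq => ?_
    rw [EuclideanSpace.inner_eq_star_dotProduct, star_trivial, dotProduct_comm]
    exact hy _ (Finset.mem_image_of_mem _ hq)

/-! ### The response of the system -/

section System

variable {n p m dw dz : ℕ} (sys : LTI n p m dw dz)

theorem LTI.state_eq_sum (u : ℕ → Fin p → ℝ) (w : ℕ → Fin dw → ℝ) (t : ℕ) :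
    sys.state u w (t + 1) = ∑ s ∈ Finset.Icc 1 t,
      ((sys.A ^ (t - s) * sys.B) *ᵥ u s + (sys.A ^ (t - s) * sys.Bw) *ᵥ w s) := by
  induction t with
  | zero => simp [LTI.state]
  | succ t ih =>
    rw [LTI.state, ih, mulVec_sum, Finset.sum_Icc_succ_top (by omega)]
    have e : ∀ s ∈ Finset.Icc 1 t,
        sys.A *ᵥ ((sys.A ^ (t - s) * sys.B) *ᵥ u s + (sys.A ^ (t - s) * sys.Bw) *ᵥ w s)
        = (sys.A ^ (t + 1 - s) * sys.B) *ᵥ u s + (sys.A ^ (t + 1 - s) * sys.Bw) *ᵥ w s :=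
      fun s hs => by
        have := Finset.mem_Icc.1 hs
        have hts : t + 1 - s = (t - s) + 1 := by omega
        rw [hts, pow_succ', mulVec_add, mulVec_mulVec, mulVec_mulVec, Matrix.mul_assoc, Matrix.mul_assoc]
    rw [Finset.sum_congr rfl e]
    simp [add_assoc]

/-- The contribution to `y_t` of the inputs up to time `r` and of the noise. -/
def LTI.partialOutput (u : ℕ → Fin p → ℝ) (w : ℕ → Fin dw → ℝ) (z : ℕ → Fin dz → ℝ)
    (t r : ℕ) : Fin m → ℝ :=
  ∑ s ∈ Finset.Icc 1 r, (sys.C * sys.A ^ (t - 1 - s) * sys.B) *ᵥ u s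
    + ∑ s ∈ Finset.Icc 1 (t - 1), (sys.C * sys.A ^ (t - 1 - s) * sys.Bw) *ᵥ w s + sys.Dz *ᵥ z t

theorem LTI.output_eq (u : ℕ → Fin p → ℝ) (w : ℕ → Fin dw → ℝ) (z : ℕ → Fin dz → ℝ) {t : ℕ}
    (ht : 1 ≤ t) :
    sys.output u w z t = sys.partialOutput u w z t (t - 1) + sys.D *ᵥ u t := by
  obtain ⟨t, rfl⟩ := Nat.exists_eq_add_of_le' ht
  rw [LTI.output, if_neg (by omega), sys.state_eq_sum, LTI.partialOutput, mulVec_sum]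
  simp only [Nat.add_sub_cancel, mulVec_add, mulVec_mulVec, Finset.sum_add_distrib, Matrix.mul_assoc]
  abel

theorem LTI.response_mulVec (u : ℕ → Fin p → ℝ) {T t : ℕ} (hT : 1 ≤ T) (ht : T ≤ t) :
    sys.response T *ᵥ stackedInput T u t = sys.D *ᵥ u t
      + ∑ s ∈ Finset.Icc (t - T + 1) (t - 1), (sys.C * sys.A ^ (t - 1 - s) * sys.B) *ᵥ u s := by
  obtain ⟨T, rfl⟩ := Nat.exists_eq_add_of_le' hT
  have h1 : sys.response (T + 1) *ᵥ stackedInput (T + 1) u t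
      = ∑ j ∈ Finset.range (T + 1),
        (if j = 0 then sys.D else sys.C * sys.A ^ (j - 1) * sys.B) *ᵥ u (t - j) := by
    ext i
    rw [Finset.sum_range, Finset.sum_apply]
    simp only [mulVec, dotProduct, LTI.response, stackedInput]
    rw [Fintype.sum_prod_type]
  rw [h1, Finset.sum_range_succ']
  simp only [Nat.add_eq_zero_iff, one_ne_zero, and_false, if_false, if_true, Nat.sub_zero,
    Nat.add_sub_cancel]
  rw [add_comm]
  congr 1
  refine Finset.sum_bij (fun j _ => t - (j + 1)) ?_ ?_ ?_ ?_
  · intro j hj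
    have := Finset.mem_range.1 hj
    exact Finset.mem_Icc.2 ⟨by omega, by omega⟩
  · intro a ha b hb hab
    have := Finset.mem_range.1 ha
    have := Finset.mem_range.1 hb
    omega
  · intro s hs
    have := Finset.mem_Icc.1 hs
    exact ⟨t - s - 1, Finset.mem_range.2 (by omega), by omega⟩
  · intro j hj
    have := Finset.mem_range.1 hj
    have : t - 1 - (t - (j + 1)) = j := by omega
    rw [this]

/-- The response `G⋆ ū_t` accounts for precisely the inputs at times `t - T + 1, …, t`, so the error
`δ_t` contains no input after `t - T`. -/
theorem LTI.output_sub_response (u : ℕ → Fin p → ℝ) (w : ℕ → Fin dw → ℝ) (z : ℕ → Fin dz → ℝ)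
    {T t : ℕ} (hT : 1 ≤ T) (ht : T ≤ t) :
    sys.output u w z t - sys.response T *ᵥ stackedInput T u t
      = sys.partialOutput u w z t (t - T) := by
  have h1 : (Finset.Icc 1 (t - 1) : Finset ℕ) = Finset.Ioc 0 (t - 1) := by
    ext; simp only [Finset.mem_Icc, Finset.mem_Ioc]; omega
  have h2 : (Finset.Icc 1 (t - T) : Finset ℕ) = Finset.Ioc 0 (t - T) := by
    ext; simp only [Finset.mem_Icc, Finset.mem_Ioc]; omega
  have h3 : (Finset.Icc (t - T + 1) (t - 1) : Finset ℕ) = Finset.Ioc (t - T) (t - 1) := by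
    ext; simp only [Finset.mem_Icc, Finset.mem_Ioc]; omega
  rw [sys.output_eq u w z (hT.trans ht), sys.response_mulVec u hT ht, LTI.partialOutput,
    LTI.partialOutput, h1, h2, h3, ← Finset.sum_Ioc_consecutive _ (Nat.zero_le (t - T))
      (by omega : t - T ≤ t - 1)]
  abel

variable {Ω : Type*} [mΩ : MeasurableSpace Ω] {P : Measure Ω} [IsProbabilityMeasure P]
  {𝓕 : Filtration ℤ mΩ} {T N : ℕ} {u : ℕ → Ω → Fin p → ℝ}
  {w : ℕ → Ω → Fin dw → ℝ} {z : ℕ → Ω → Fin dz → ℝ}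

theorem measurable_mulVec {α ι κ : Type*} [Fintype κ] {_ : MeasurableSpace α} (M : Matrix ι κ ℝ)
    {f : α → κ → ℝ} (hf : Measurable f) : Measurable fun a => M *ᵥ f a := by
  refine measurable_pi_iff.2 fun i => ?_
  simp only [mulVec, dotProduct]
  exact Finset.measurable_fun_sum _ fun j _ => ((measurable_pi_apply j).comp hf).const_mul _

theorem LTI.measurable_partialOutput (h : SemiAdversarial P 𝓕 T N u w z) {t r x : ℕ}
    (ht1 : 1 ≤ t) (htN : t ≤ N) (hr : r ≤ x) (hxN : x ≤ N) (hx : t ≤ x + T) :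
    Measurable[𝓕 (x : ℤ)] fun ω =>
      sys.partialOutput (fun s => u s ω) (fun s => w s ω) (fun s => z s ω) t r := by
  unfold LTI.partialOutput
  refine Measurable.add (Measurable.add ?_ ?_) ?_
  · refine Finset.measurable_fun_sum _ fun s hs => ?_
    have hs := Finset.mem_Icc.1 hs
    exact measurable_mulVec _ ((h.input_adapted s hs.1 (by omega)).mono
      (𝓕.mono (by omega)) le_rfl)
  · refine Finset.measurable_fun_sum _ fun s hs => ?_
    have hs := Finset.mem_Icc.1 hs
    exact measurable_mulVec _ ((h.process_delayed s hs.1 (by omega)).mono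
      (𝓕.mono (by omega)) le_rfl)
  · exact measurable_mulVec _ ((h.sensor_delayed t ht1 htN).mono (𝓕.mono (by omega)) le_rfl)

theorem LTI.measurable_output (h : SemiAdversarial P 𝓕 T N u w z) {t x : ℕ} (htN : x ≤ N)
    (htx : t ≤ x) :
    Measurable[𝓕 (x : ℤ)] fun ω =>
      sys.output (fun s => u s ω) (fun s => w s ω) (fun s => z s ω) t := by
  rcases Nat.eq_zero_or_pos t with rfl | ht
  · simp only [LTI.output, if_true]
    exact measurable_const
  · simp only [sys.output_eq _ _ _ ht]
    refine Measurable.add (sys.measurable_partialOutput h ht (by omega) (by omega) htN (by omega)) ?_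
    exact measurable_mulVec _ ((h.input_adapted t ht (by omega)).mono
      (𝓕.mono (by omega)) le_rfl)

/-- The regressor `(δ_t, k_t)`. -/
def LTI.regressor (T L : ℕ) (u : ℕ → Fin p → ℝ) (w : ℕ → Fin dw → ℝ) (z : ℕ → Fin dz → ℝ)
    (t : ℕ) : Fin m ⊕ (Fin L × Fin m) → ℝ :=
  Sum.elim (sys.output u w z t - sys.response T *ᵥ stackedInput T u t)
    (feature T L (sys.output u w z) t)

/-- The delay of the noise enters here: the noise in `δ_t` is `w_s` with `s < t` and `z_t`, all
known at time `t - T`. The features are outputs at times at most `t - T`, with truncated subtraction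
leading to `y_0 = 0`. -/
theorem LTI.measurable_regressor (h : SemiAdversarial P 𝓕 T N u w z) {L t : ℕ} (hT : 1 ≤ T)
    (hTt : T ≤ t) (htN : t ≤ N) :
    Measurable[𝓕 ((t - T : ℕ) : ℤ)] fun ω =>
      sys.regressor T L (fun s => u s ω) (fun s => w s ω) (fun s => z s ω) t := by
  refine (@measurable_pi_iff _ _ _ (𝓕 ((t - T : ℕ) : ℤ)) _ _).2 fun i => ?_
  rcases i with i | c
  · simp only [LTI.regressor, Sum.elim_inl, sys.output_sub_response _ _ _ hT hTt]
    exact (measurable_pi_apply i).comp (sys.measurable_partialOutput h (by omega) htN le_rfl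
      (by omega) (by omega))
  · simp only [LTI.regressor, Sum.elim_inr, feature]
    have : T ≤ ((c.1 : ℕ) + 1) * T := Nat.le_mul_of_pos_left T (by omega)
    exact (measurable_pi_apply c.2).comp (sys.measurable_output h (by omega) (by omega))

theorem SemiAdversarial.map_dotProduct (h : SemiAdversarial P 𝓕 T N u w z) {t : ℕ} (h1 : 1 ≤ t)
    (h2 : t ≤ N) {q : Fin p → ℝ} : P.map (fun ω => q ⬝ᵥ u t ω)
      = gaussianReal 0 (Real.toNNReal (normSq q)) := by
  have hm : Measurable fun x : Fin p → ℝ => q ⬝ᵥ x := by simp only [dotProduct]; fun_prop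
  have e : (fun ω => q ⬝ᵥ u t ω) = (fun x : Fin p → ℝ => q ⬝ᵥ x) ∘ u t := rfl
  rw [e, ← Measure.map_map hm (h.measurable_input h1 h2), h.input_law t h1 h2,
    map_dotProduct_pi_gaussianReal]

/-- The squared self-normalized radius. -/
def radiusSq (T p : ℕ) (δ logdet : ℝ) : ℝ := 4 * (logdet + 2 * Real.log (T * 5 ^ p / δ))

/-- For fixed lag `j` and unit direction `q`, the scalars `⟨q, u_{t-j}⟩` are fresh standard
Gaussians relative to a past containing the regressors, so the self-normalized bound applies. Once
`⟨S, V⁻¹ S⟩` is controlled, Cauchy–Schwarz covers all `x` simultaneously; only `j` and `q` require a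
union bound. -/
theorem LTI.measure_selfNormalized_le (h : SemiAdversarial P 𝓕 T N u w z) (hT : 1 ≤ T)
    (hp : 1 ≤ p) {L : ℕ} (hL : 1 ≤ L) (hN : T * L ≤ N) {μ δ : ℝ} (hμ : 0 < μ) (hδ : 0 < δ) :
    P {ω | ¬ ∀ j < T, ∀ x : Fin m ⊕ (Fin L × Fin m) → ℝ,
      normSq (∑ i ∈ Finset.range (N - T * L + 1),
        (sys.regressor T L (fun s => u s ω) (fun s => w s ω) (fun s => z s ω) (T * L + i) ⬝ᵥ x)
          • u (T * L + i - j) ω)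
      ≤ radiusSq T p δ (Real.log (regGram (fun i => μ⁻¹ • sys.regressor T L (fun s => u s ω)
          (fun s => w s ω) (fun s => z s ω) (T * L + i)) (N - T * L + 1)).det)
        * (μ ^ 2 * normSq x + ∑ i ∈ Finset.range (N - T * L + 1),
          (sys.regressor T L (fun s => u s ω) (fun s => w s ω) (fun s => z s ω) (T * L + i)
            ⬝ᵥ x) ^ 2)} ≤ ENNReal.ofReal δ := by
  have hTL : T ≤ T * L := Nat.le_mul_of_pos_right T hL
  obtain ⟨𝒩, hne, hq1, hcard, hnet⟩ := exists_normSq_net hp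
  set K := N - T * L + 1 with hK
  set ζ : ℕ → Ω → Fin m ⊕ (Fin L × Fin m) → ℝ := fun i ω =>
    sys.regressor T L (fun s => u s ω) (fun s => w s ω) (fun s => z s ω) (T * L + i) with hζ
  -- The share of each of the `T` lags and at most `5^p` net points in the union bound.
  set δ' : ℝ := δ / (T * 5 ^ p) with hδ'
  have hTr : (1 : ℝ) ≤ T := by exact_mod_cast hT
  have hδ'0 : 0 < δ' := by positivity
  set bad : ℕ → (Fin p → ℝ) → Set Ω := fun j q =>
    {ω | Real.log (regGram (fun i => μ⁻¹ • ζ i ω) K).det + 2 * Real.log (1 / δ')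
      ≤ (∑ i ∈ Finset.range K, (q ⬝ᵥ u (T * L + i - j) ω) • (μ⁻¹ • ζ i ω)) ⬝ᵥ
        (regGram (fun i => μ⁻¹ • ζ i ω) K)⁻¹ *ᵥ
        (∑ i ∈ Finset.range K, (q ⬝ᵥ u (T * L + i - j) ω) • (μ⁻¹ • ζ i ω))} with hbad
  have hbadle : ∀ j < T, ∀ q ∈ 𝒩, P (bad j q) ≤ ENNReal.ofReal δ' := by
    intro j hj q hq
    -- The past of `u_{TL+k-j}` ends at time `TL + k - j - 1`. Since `j ≤ T - 1`, it includes time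
    -- `TL + k - T`, at which the regressor is known.
    refine measure_log_det_add_le (𝓖 := fun k => 𝓕 ((T * L + k - j : ℕ) - 1 : ℤ))
      (ζ := fun i ω => μ⁻¹ • ζ i ω) (η := fun i ω => q ⬝ᵥ u (T * L + i - j) ω)
      (fun k => 𝓕.le _) (fun a b hab => 𝓕.mono (by omega)) ?_ ?_ ?_ ?_ hδ'0
    · intro k hk
      have hm := (sys.measurable_regressor h (L := L) (t := T * L + k) hT (by omega)
        (by omega)).mono (𝓕.mono (by omega : ((T * L + k - T : ℕ) : ℤ)
          ≤ ((T * L + k - j : ℕ) : ℤ) - 1)) le_rfl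
      exact hm.const_smul (μ⁻¹ : ℝ)
    · intro k hk
      have hm := (h.input_adapted (T * L + k - j) (by omega) (by omega)).mono
        (𝓕.mono (by omega : ((T * L + k - j : ℕ) : ℤ) ≤ ((T * L + (k + 1) - j : ℕ) : ℤ) - 1)) le_rfl
      simp only [dotProduct]
      exact Finset.measurable_fun_sum _ fun i _ => ((measurable_pi_apply i).comp hm).const_mul _
    · intro k hk
      rw [h.map_dotProduct (by omega) (by omega), hq1 q hq, Real.toNNReal_one]
    · intro k hk
      have hind := h.input_indep (T * L + k - j) (by omega) (by omega)
      refine indep_of_indep_of_le_left hind ?_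
      rintro _ ⟨s, hs, rfl⟩
      refine ⟨(fun x : Fin p → ℝ => q ⬝ᵥ x) ⁻¹' s, ?_, rfl⟩
      have hm : Measurable fun x : Fin p → ℝ => q ⬝ᵥ x := by simp only [dotProduct]; fun_prop
      exact hm hs
  have hsub : {ω | ¬ ∀ j < T, ∀ x : Fin m ⊕ (Fin L × Fin m) → ℝ,
      normSq (∑ i ∈ Finset.range K, (ζ i ω ⬝ᵥ x) • u (T * L + i - j) ω)
      ≤ radiusSq T p δ (Real.log (regGram (fun i => μ⁻¹ • ζ i ω) K).det)
        * (μ ^ 2 * normSq x + ∑ i ∈ Finset.range K, (ζ i ω ⬝ᵥ x) ^ 2)}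
      ⊆ ⋃ j ∈ Finset.range T, ⋃ q ∈ 𝒩, bad j q := by
    intro ω hω
    by_contra hcon
    simp only [Set.mem_iUnion, not_exists, Finset.mem_range] at hcon
    refine hω fun j hj x => ?_
    set V := regGram (fun i => μ⁻¹ • ζ i ω) K with hV
    set ρ := Real.log V.det + 2 * Real.log (1 / δ') with hρ
    have hgood : ∀ q ∈ 𝒩, (∑ i ∈ Finset.range K, (q ⬝ᵥ u (T * L + i - j) ω) • (μ⁻¹ • ζ i ω)) ⬝ᵥ
        V⁻¹ *ᵥ (∑ i ∈ Finset.range K, (q ⬝ᵥ u (T * L + i - j) ω) • (μ⁻¹ • ζ i ω)) ≤ ρ :=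
      fun q hq => (not_le.1 (hcon j hj q hq)).le
    have hVp : V.PosDef := posDef_regGram _ _
    have hρ0 : 0 ≤ ρ := by
      obtain ⟨q, hq⟩ := hne
      exact (inv_nonneg_quadratic hVp _).trans (hgood q hq)
    set Q := μ ^ 2 * normSq x + ∑ i ∈ Finset.range K, (ζ i ω ⬝ᵥ x) ^ 2 with hQ
    have hQ0 : 0 ≤ Q := add_nonneg (mul_nonneg (sq_nonneg _) (normSq_nonneg _))
      (Finset.sum_nonneg fun _ _ => sq_nonneg _)
    -- Scaling the regressors by `μ⁻¹` turns the regularizer `μ² I` into the identity in `regGram`.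
    have hQV : μ ^ 2 * (x ⬝ᵥ V *ᵥ x) = Q := by
      rw [hV, dotProduct_regGram, hQ, mul_add, Finset.mul_sum]
      congr 1
      refine Finset.sum_congr rfl fun i _ => ?_
      rw [smul_dotProduct, smul_eq_mul, mul_pow, ← mul_assoc, ← mul_pow, mul_inv_cancel₀ hμ.ne',
        one_pow, one_mul]
    have hle : radiusSq T p δ (Real.log V.det) * Q = 4 * (ρ * Q) := by
      have : 1 / δ' = T * 5 ^ p / δ := by rw [hδ', one_div_div]
      rw [radiusSq, hρ, this]; ring
    rw [hle]
    refine hnet _ _ (mul_nonneg hρ0 hQ0) fun q hq => ?_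
    set S := ∑ i ∈ Finset.range K, (q ⬝ᵥ u (T * L + i - j) ω) • (μ⁻¹ • ζ i ω) with hS
    have e : q ⬝ᵥ ∑ i ∈ Finset.range K, (ζ i ω ⬝ᵥ x) • u (T * L + i - j) ω = μ * (S ⬝ᵥ x) := by
      rw [hS, dotProduct_sum, sum_dotProduct, Finset.mul_sum]
      refine Finset.sum_congr rfl fun i _ => ?_
      simp only [dotProduct_smul, smul_dotProduct, smul_eq_mul]
      field_simp
    rw [e, mul_pow, ← hQV, mul_left_comm]
    refine mul_le_mul_of_nonneg_left ?_ (sq_nonneg _)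
    exact (sq_dotProduct_le hVp S x).trans
      (mul_le_mul_of_nonneg_right (hgood q hq) (hVp.posSemidef.dotProduct_nonneg _))
  refine (measure_mono hsub).trans ?_
  refine (measure_biUnion_finset_le _ _).trans ?_
  have h1 : ∀ j ∈ Finset.range T, P (⋃ q ∈ 𝒩, bad j q) ≤ 5 ^ p * ENNReal.ofReal δ' := by
    intro j hj
    refine (measure_biUnion_finset_le _ _).trans ?_
    refine (Finset.sum_le_sum fun q hq => hbadle j (Finset.mem_range.1 hj) q hq).trans ?_
    rw [Finset.sum_const, nsmul_eq_mul]
    gcongr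
    exact_mod_cast hcard
  refine (Finset.sum_le_sum h1).trans ?_
  rw [Finset.sum_const, Finset.card_range, nsmul_eq_mul]
  have e5 : (5 : ENNReal) ^ p = ENNReal.ofReal (5 ^ p) := by
    rw [ENNReal.ofReal_pow (by norm_num)]; norm_num
  rw [e5, ← ENNReal.ofReal_natCast T, ← ENNReal.ofReal_mul (by positivity),
    ← ENNReal.ofReal_mul (by positivity)]
  refine ENNReal.ofReal_le_ofReal (le_of_eq ?_)
  rw [hδ']; field_simp

end System

/-! ### Euclidean and spectral norms -/

section Norms

variable {ι κ : Type*} [Fintype ι] [Fintype κ]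

/-- The Euclidean norm of a real vector. -/
def euclNorm (v : ι → ℝ) : ℝ := ‖WithLp.toLp 2 v‖

theorem euclNorm_nonneg (v : ι → ℝ) : 0 ≤ euclNorm v := norm_nonneg _

theorem euclNorm_sq (v : ι → ℝ) : euclNorm v ^ 2 = normSq v := (normSq_eq_norm_sq v).symm

theorem euclNorm_sub_le (v w : ι → ℝ) : euclNorm (v - w) ≤ euclNorm v + euclNorm w := by
  simpa [euclNorm] using norm_sub_le (WithLp.toLp 2 v) (WithLp.toLp 2 w)

theorem euclNorm_smul (c : ℝ) (v : ι → ℝ) : euclNorm (c • v) = |c| * euclNorm v := by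
  simp [euclNorm, norm_smul]

theorem euclNorm_neg (v : ι → ℝ) : euclNorm (-v) = euclNorm v := by simp [euclNorm]

theorem dotProduct_le_euclNorm (v w : ι → ℝ) : v ⬝ᵥ w ≤ euclNorm v * euclNorm w := by
  have := real_inner_le_norm (WithLp.toLp 2 w) (WithLp.toLp 2 v)
  rw [EuclideanSpace.inner_eq_star_dotProduct, star_trivial] at this
  rw [mul_comm]
  exact this

theorem dotProduct_self_eq_normSq (v : ι → ℝ) : v ⬝ᵥ v = normSq v := by
  simp only [dotProduct, normSq, pow_two]

theorem normSq_sum_elim (v : ι → ℝ) (w : κ → ℝ) :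
    normSq (Sum.elim v w) = normSq v + normSq w := by
  simp [normSq, Fintype.sum_sum_type]

theorem normSq_smul (c : ℝ) (v : ι → ℝ) : normSq (c • v) = c ^ 2 * normSq v := by
  simp [normSq, mul_pow, Finset.mul_sum]

theorem euclNorm_sum_elim_le (v : ι → ℝ) (w : κ → ℝ) :
    euclNorm (Sum.elim v w) ≤ euclNorm v + euclNorm w := by
  refine abs_le_of_sq_le_sq' ?_ (add_nonneg (euclNorm_nonneg _) (euclNorm_nonneg _)) |>.2
  rw [euclNorm_sq, normSq_sum_elim, ← euclNorm_sq, ← euclNorm_sq]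
  nlinarith [mul_nonneg (euclNorm_nonneg v) (euclNorm_nonneg w)]

open scoped Matrix.Norms.L2Operator in
theorem opNorm_eq_norm {𝕜 : Type*} [RCLike 𝕜] [DecidableEq κ] (A : Matrix ι κ 𝕜) :
    opNorm A = ‖A‖ := (l2_opNorm_def A).symm

theorem opNorm_nonneg {𝕜 : Type*} [RCLike 𝕜] [DecidableEq κ] (A : Matrix ι κ 𝕜) :
    0 ≤ opNorm A := norm_nonneg _

variable [DecidableEq ι] [DecidableEq κ]

theorem euclNorm_mulVec_le (A : Matrix ι κ ℝ) (v : κ → ℝ) :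
    euclNorm (A *ᵥ v) ≤ opNorm A * euclNorm v := by
  rw [opNorm_eq_norm]
  exact l2_opNorm_mulVec A (WithLp.toLp 2 v)

theorem opNorm_transpose (A : Matrix ι κ ℝ) : opNorm Aᵀ = opNorm A := by
  rw [opNorm_eq_norm, opNorm_eq_norm, ← conjTranspose_eq_transpose_of_trivial,
    l2_opNorm_conjTranspose]

theorem opNorm_le_of_transpose_mulVec (A : Matrix ι κ ℝ) {c : ℝ} (hc : 0 ≤ c)
    (h : ∀ v, euclNorm v = 1 → euclNorm (Aᵀ *ᵥ v) ≤ c) : opNorm A ≤ c := by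
  rw [← opNorm_transpose]
  refine ContinuousLinearMap.opNorm_le_of_unit_norm hc fun x hx => ?_
  exact h (WithLp.ofLp x) (by simpa [euclNorm] using hx)

end Norms

/-! ### Deterministic analysis of prefiltered least squares -/

section Deterministic

theorem eq_zero_of_forall_quadratic_nonneg {a b : ℝ} (h : ∀ x : ℝ, 0 ≤ a * x ^ 2 + b * x) :
    b = 0 := by
  have key : ∀ x : ℝ, 0 ≤ a * (x * x) + b * x + 0 := fun x => by nlinarith [h x]
  have := discrim_le_zero key
  rw [discrim] at this
  nlinarith [sq_nonneg b]

theorem normSq_sub_smul {ι : Type*} [Fintype ι] (r e : ι → ℝ) (c : ℝ) :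
    normSq (r - c • e) = normSq r - 2 * c * (r ⬝ᵥ e) + c ^ 2 * normSq e := by
  simp only [← dotProduct_self_eq_normSq, sub_dotProduct, dotProduct_sub, smul_dotProduct,
    dotProduct_smul, smul_eq_mul, dotProduct_comm e r]
  ring

variable {m p T L N₁ N : ℕ} {μ : ℝ} {y : ℕ → Fin m → ℝ} {u : ℕ → Fin p → ℝ}

/-- Along the rank-one perturbation `φ + x e bᵀ` the loss is a quadratic polynomial in `x` with
minimum at `0`, so its linear coefficient vanishes. -/
theorem ridge_normal_equation {φ : Matrix (Fin m) (Fin L × Fin m) ℝ}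
    (hφ : ∀ φ', ridgeLoss T L N₁ N μ y φ ≤ ridgeLoss T L N₁ N μ y φ') (e : Fin m → ℝ)
    (b : Fin L × Fin m → ℝ) :
    ∑ t ∈ Finset.Icc N₁ N, (feature T L y t ⬝ᵥ b) * ((y t - φ *ᵥ feature T L y t) ⬝ᵥ e)
      = μ ^ 2 * (e ⬝ᵥ φ *ᵥ b) := by
  have hfrob : ∀ x : ℝ, frobSq (φ + x • vecMulVec e b)
      = frobSq φ + 2 * x * (e ⬝ᵥ φ *ᵥ b) + x ^ 2 * ∑ i, ∑ j, (e i * b j) ^ 2 := fun x => by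
    simp only [frobSq, Matrix.add_apply, Matrix.smul_apply, vecMulVec_apply, smul_eq_mul,
      dotProduct, mulVec, Finset.mul_sum, ← Finset.sum_add_distrib]
    exact Finset.sum_congr rfl fun i _ => Finset.sum_congr rfl fun j _ => by ring
  have hfit : ∀ (x : ℝ) t, normSq (y t - (φ + x • vecMulVec e b) *ᵥ feature T L y t)
      = normSq (y t - φ *ᵥ feature T L y t)
        - 2 * x * ((feature T L y t ⬝ᵥ b) * ((y t - φ *ᵥ feature T L y t) ⬝ᵥ e))
        + x ^ 2 * ((feature T L y t ⬝ᵥ b) ^ 2 * normSq e) := fun x t => by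
    rw [add_mulVec, smul_mulVec, vecMulVec_mulVec, op_smul_eq_smul, ← sub_sub, smul_smul,
      normSq_sub_smul, dotProduct_comm b]
    ring
  have hq : ∀ x : ℝ, 0 ≤ (∑ t ∈ Finset.Icc N₁ N, (feature T L y t ⬝ᵥ b) ^ 2 * normSq e
        + μ ^ 2 * ∑ i, ∑ j, (e i * b j) ^ 2) * x ^ 2
      + (2 * (μ ^ 2 * (e ⬝ᵥ φ *ᵥ b)) - 2 * ∑ t ∈ Finset.Icc N₁ N,
        (feature T L y t ⬝ᵥ b) * ((y t - φ *ᵥ feature T L y t) ⬝ᵥ e)) * x := fun x => by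
    have := hφ (φ + x • vecMulVec e b)
    simp only [ridgeLoss, hfrob, hfit, Finset.sum_add_distrib, Finset.sum_sub_distrib,
      ← Finset.mul_sum] at this
    linarith
  have := eq_zero_of_forall_quadratic_nonneg hq
  linarith

theorem leastSquares_normal_equation {φ : Matrix (Fin m) (Fin L × Fin m) ℝ}
    {G : Matrix (Fin m) (Fin T × Fin p) ℝ}
    (hG : ∀ G', filteredLoss T L N₁ N y u φ G ≤ filteredLoss T L N₁ N y u φ G') (e : Fin m → ℝ)
    (b : Fin T × Fin p → ℝ) :
    ∑ t ∈ Finset.Icc N₁ N, (stackedInput T u t ⬝ᵥ b)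
      * ((y t - φ *ᵥ feature T L y t - G *ᵥ stackedInput T u t) ⬝ᵥ e) = 0 := by
  have hfit : ∀ (x : ℝ) t, normSq (y t - φ *ᵥ feature T L y t
        - (G + x • vecMulVec e b) *ᵥ stackedInput T u t)
      = normSq (y t - φ *ᵥ feature T L y t - G *ᵥ stackedInput T u t)
        - 2 * x * ((stackedInput T u t ⬝ᵥ b)
          * ((y t - φ *ᵥ feature T L y t - G *ᵥ stackedInput T u t) ⬝ᵥ e))
        + x ^ 2 * ((stackedInput T u t ⬝ᵥ b) ^ 2 * normSq e) := fun x t => by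
    rw [add_mulVec, smul_mulVec, vecMulVec_mulVec, op_smul_eq_smul, ← sub_sub, smul_smul,
      normSq_sub_smul, dotProduct_comm b]
    ring
  have hq : ∀ x : ℝ, 0 ≤ (∑ t ∈ Finset.Icc N₁ N, (stackedInput T u t ⬝ᵥ b) ^ 2 * normSq e) * x ^ 2
      + (-(2 * ∑ t ∈ Finset.Icc N₁ N, (stackedInput T u t ⬝ᵥ b)
        * ((y t - φ *ᵥ feature T L y t - G *ᵥ stackedInput T u t) ⬝ᵥ e))) * x := fun x => by
    have := hG (G + x • vecMulVec e b)
    simp only [filteredLoss, hfit, Finset.sum_add_distrib, Finset.sum_sub_distrib,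
      ← Finset.mul_sum] at this
    linarith
  have := eq_zero_of_forall_quadratic_nonneg hq
  linarith

theorem sum_Icc_eq_sum_fin (hN : N₁ ≤ N) (f : ℕ → ℝ) :
    ∑ t ∈ Finset.Icc N₁ N, f t = ∑ i : Fin (N - N₁ + 1), f (N₁ + i) := by
  have : Finset.Icc N₁ N = Finset.Ico N₁ (N + 1) := by
    ext; simp only [Finset.mem_Icc, Finset.mem_Ico]; omega
  rw [this, Finset.sum_Ico_eq_sum_range, Finset.sum_range]
  have : N + 1 - N₁ = N - N₁ + 1 := by omega
  rw [this]

theorem normSq_sum_smul_stackedInput_le {s : Finset ℕ} {c : ℕ → ℝ} {B : ℝ}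
    (h : ∀ j < T, normSq (∑ t ∈ s, c t • u (t - j)) ≤ B) :
    normSq (∑ t ∈ s, c t • stackedInput T u t) ≤ T * B := by
  have e : normSq (∑ t ∈ s, c t • stackedInput T u t)
      = ∑ j : Fin T, normSq (∑ t ∈ s, c t • u (t - j)) := by
    simp only [normSq]
    rw [Fintype.sum_prod_type]
    refine Finset.sum_congr rfl fun j _ => Finset.sum_congr rfl fun i _ => ?_
    simp only [Finset.sum_apply, Pi.smul_apply, stackedInput]
  rw [e]
  refine (Finset.sum_le_sum (g := fun _ => B) fun (j : Fin T) _ => h (j : ℕ) j.2).trans ?_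
  simp

theorem le_of_mul_self_le_mul {a b : ℝ} (ha : 0 ≤ a) (hb : 0 ≤ b) (h : a * a ≤ a * b) :
    a ≤ b := by
  rcases ha.eq_or_lt with rfl | ha
  · exact hb
  · exact le_of_mul_le_mul_left h ha

/-- The regressors applied to `x`, together with the regularization `μ x`. -/
def ridgeVector {ι : Type*} [Fintype ι] (μ : ℝ) (N₁ M : ℕ) (ζ : ℕ → ι → ℝ) (x : ι → ℝ) :
    Fin M ⊕ ι → ℝ :=
  Sum.elim (fun i => ζ (N₁ + i) ⬝ᵥ x) (μ • x)

theorem ridgeVector_sub {ι : Type*} [Fintype ι] (M : ℕ) (ζ : ℕ → ι → ℝ) (x x' : ι → ℝ) :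
    ridgeVector μ N₁ M ζ (x - x') = ridgeVector μ N₁ M ζ x - ridgeVector μ N₁ M ζ x' := by
  ext (i | i)
  · simp [ridgeVector, dotProduct_sub]
  · simp [ridgeVector, mul_sub]

theorem ridgeVector_dotProduct {ι : Type*} [Fintype ι] (hN : N₁ ≤ N) (ζ : ℕ → ι → ℝ)
    (x x' : ι → ℝ) :
    ridgeVector μ N₁ (N - N₁ + 1) ζ x ⬝ᵥ ridgeVector μ N₁ (N - N₁ + 1) ζ x'
      = ∑ t ∈ Finset.Icc N₁ N, (ζ t ⬝ᵥ x) * (ζ t ⬝ᵥ x') + μ ^ 2 * (x ⬝ᵥ x') := by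
  rw [sum_Icc_eq_sum_fin hN]
  simp only [ridgeVector, sumElim_dotProduct_sumElim, smul_dotProduct, dotProduct_smul,
    smul_eq_mul, ← mul_assoc, pow_two]
  rfl

theorem opt_objective_nonneg (hμ : 0 ≤ μ) (G₀ : Matrix (Fin m) (Fin T × Fin p) ℝ)
    (ψ : Matrix (Fin m) (Fin L × Fin m) ℝ) :
    0 ≤ opNorm (errorMatrix T N₁ N y u G₀ - featureMatrix T L N₁ N y * ψᵀ) + μ * opNorm ψ :=
  add_nonneg (opNorm_nonneg _) (mul_nonneg hμ (opNorm_nonneg _))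

theorem opt_nonneg (hμ : 0 ≤ μ) (G₀ : Matrix (Fin m) (Fin T × Fin p) ℝ) :
    0 ≤ opt T L N₁ N μ y u G₀ :=
  Real.iInf_nonneg fun ψ => opt_objective_nonneg hμ G₀ ψ

theorem euclNorm_ridgeVector_le (hμ : 0 ≤ μ) (G₀ : Matrix (Fin m) (Fin T × Fin p) ℝ)
    (ψ : Matrix (Fin m) (Fin L × Fin m) ℝ) {v : Fin m → ℝ} (hv : euclNorm v = 1) :
    euclNorm (ridgeVector μ N₁ (N - N₁ + 1) (fun t => Sum.elim (y t - G₀ *ᵥ stackedInput T u t)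
        (feature T L y t)) (Sum.elim v (-(ψᵀ *ᵥ v))))
      ≤ opNorm (errorMatrix T N₁ N y u G₀ - featureMatrix T L N₁ N y * ψᵀ) + μ * opNorm ψ + μ := by
  have e : (fun i : Fin (N - N₁ + 1) => Sum.elim (y (N₁ + i) - G₀ *ᵥ stackedInput T u (N₁ + i))
        (feature T L y (N₁ + i)) ⬝ᵥ Sum.elim v (-(ψᵀ *ᵥ v)))
      = (errorMatrix T N₁ N y u G₀ - featureMatrix T L N₁ N y * ψᵀ) *ᵥ v := by
    rw [sub_mulVec, ← mulVec_mulVec]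
    ext i
    rw [sumElim_dotProduct_sumElim, dotProduct_neg, ← sub_eq_add_neg]
    rfl
  refine (euclNorm_sum_elim_le _ _).trans ?_
  rw [e, euclNorm_smul, abs_of_nonneg hμ]
  have h1 := euclNorm_mulVec_le (errorMatrix T N₁ N y u G₀ - featureMatrix T L N₁ N y * ψᵀ) v
  have h2 := euclNorm_sum_elim_le v (-(ψᵀ *ᵥ v))
  have h3 := euclNorm_mulVec_le ψᵀ v
  rw [euclNorm_neg] at h2
  rw [opNorm_transpose] at h3
  rw [hv, mul_one] at h1 h3
  nlinarith [mul_le_mul_of_nonneg_left (h2.trans (add_le_add hv.le h3)) hμ]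

/-- On a well conditioned input with a self-normalized bound for the cross terms, prefiltered
least squares is accurate. -/
theorem opNorm_sub_le_of_isPFLS (hN : N₁ ≤ N) (hμ : 0 ≤ μ) {G₀ G : Matrix (Fin m) (Fin T × Fin p) ℝ}
    {κ ρ : ℝ} (hκ : 0 < κ) (hρ : 0 ≤ ρ)
    (hU : ∀ v, normSq v = 1 → κ ≤ ∑ t ∈ Finset.Icc N₁ N, (stackedInput T u t ⬝ᵥ v) ^ 2)
    (hR : ∀ j < T, ∀ x : Fin m ⊕ (Fin L × Fin m) → ℝ,
      normSq (∑ t ∈ Finset.Icc N₁ N, (Sum.elim (y t - G₀ *ᵥ stackedInput T u t)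
          (feature T L y t) ⬝ᵥ x) • u (t - j))
        ≤ ρ * (μ ^ 2 * normSq x + ∑ t ∈ Finset.Icc N₁ N,
          (Sum.elim (y t - G₀ *ᵥ stackedInput T u t) (feature T L y t) ⬝ᵥ x) ^ 2))
    (hG : IsPFLS T L N₁ N μ y u G) :
    opNorm (G - G₀) ≤ κ⁻¹ * (√(T * ρ)
      * (2 * opt T L N₁ N μ y u G₀ + 2 * μ + opNorm G₀ * √(T * ρ))) := by
  obtain ⟨φ, hφ, hG⟩ := hG
  set R := √(T * ρ) with hRd
  have hR0 : 0 ≤ R := Real.sqrt_nonneg _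
  have hR2 : R ^ 2 = T * ρ := Real.sq_sqrt (by positivity)
  have hκi : 0 < κ⁻¹ := inv_pos.2 hκ
  have hopt := opt_nonneg (L := L) (N₁ := N₁) (N := N) (y := y) (u := u) hμ G₀
  have hG₀ := opNorm_nonneg G₀
  set ζ : ℕ → Fin m ⊕ (Fin L × Fin m) → ℝ :=
    fun t => Sum.elim (y t - G₀ *ᵥ stackedInput T u t) (feature T L y t) with hζ
  set X := ridgeVector μ N₁ (N - N₁ + 1) ζ with hX
  -- The `T` lag bounds add up to one bound for the stacked input, which is the source of the factor
  -- `T` in `R² = T ρ`.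
  have cross : ∀ x, euclNorm (∑ t ∈ Finset.Icc N₁ N, (ζ t ⬝ᵥ x) • stackedInput T u t)
      ≤ R * euclNorm (X x) := fun x => by
    have h1 := normSq_sum_smul_stackedInput_le fun j hj => hR j hj x
    refine abs_le_of_sq_le_sq' ?_ (mul_nonneg hR0 (euclNorm_nonneg _)) |>.2
    rw [euclNorm_sq, mul_pow, euclNorm_sq, hR2, ← dotProduct_self_eq_normSq (X x), hX,
      ridgeVector_dotProduct hN, dotProduct_self_eq_normSq]
    refine h1.trans (le_of_eq ?_)
    simp only [pow_two]
    ring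
  refine opNorm_le_of_transpose_mulVec _ (by positivity) fun v hv => ?_
  set h := (G - G₀)ᵀ *ᵥ v with hh
  set xφ : Fin m ⊕ (Fin L × Fin m) → ℝ := Sum.elim v (-(φᵀ *ᵥ v)) with hxφ
  have fit : ∀ t, (y t - φ *ᵥ feature T L y t - G₀ *ᵥ stackedInput T u t) ⬝ᵥ v = ζ t ⬝ᵥ xφ := by
    intro t
    rw [hζ, hxφ, sumElim_dotProduct_sumElim, dotProduct_neg, sub_right_comm, sub_dotProduct _ _ v,
      mulVec_transpose, ← sub_eq_add_neg, dotProduct_comm (φ *ᵥ _), dotProduct_mulVec,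
      dotProduct_comm (v ᵥ* φ)]
  -- the error in terms of the filtered residual
  have error_le : euclNorm h ≤ κ⁻¹ * (R * euclNorm (X xφ)) := by
    have hU' : κ * (euclNorm h * euclNorm h)
        ≤ ∑ t ∈ Finset.Icc N₁ N, (stackedInput T u t ⬝ᵥ h) ^ 2 := by
      rcases (euclNorm_nonneg h).eq_or_lt with h0 | h0
      · rw [← h0]; simp only [mul_zero]; positivity
      · have := hU ((euclNorm h)⁻¹ • h) (by
          rw [normSq_smul, ← euclNorm_sq, ← mul_pow, inv_mul_cancel₀ h0.ne', one_pow])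
        simp only [dotProduct_smul, smul_eq_mul, mul_pow, ← Finset.mul_sum] at this
        rw [inv_pow, ← div_eq_inv_mul, le_div_iff₀ (by positivity)] at this
        rwa [← pow_two]
    -- The least squares normal equation tested in the direction of the error `h` itself.
    have hne : ∑ t ∈ Finset.Icc N₁ N, (stackedInput T u t ⬝ᵥ h) ^ 2
        = h ⬝ᵥ ∑ t ∈ Finset.Icc N₁ N, (ζ t ⬝ᵥ xφ) • stackedInput T u t := by
      have h0 := leastSquares_normal_equation hG v h
      rw [dotProduct_sum]
      rw [← sub_eq_zero, ← Finset.sum_sub_distrib, ← neg_eq_zero, ← Finset.sum_neg_distrib, ← h0]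
      refine Finset.sum_congr rfl fun t _ => ?_
      have e1 : (G *ᵥ stackedInput T u t) ⬝ᵥ v - (G₀ *ᵥ stackedInput T u t) ⬝ᵥ v
          = stackedInput T u t ⬝ᵥ h := by
        rw [← sub_dotProduct, ← sub_mulVec, hh, mulVec_transpose, dotProduct_comm,
          dotProduct_mulVec, dotProduct_comm]
      have e2 := fit t
      rw [sub_dotProduct] at e2 ⊢
      rw [dotProduct_smul, smul_eq_mul, dotProduct_comm h, ← e2]
      linear_combination (stackedInput T u t ⬝ᵥ h) * e1
    have h1 : κ * (euclNorm h * euclNorm h) ≤ euclNorm h * (R * euclNorm (X xφ)) :=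
      (hU'.trans hne.le).trans ((dotProduct_le_euclNorm _ _).trans
        (mul_le_mul_of_nonneg_left (cross xφ) (euclNorm_nonneg _)))
    refine le_of_mul_self_le_mul (euclNorm_nonneg _)
      (mul_nonneg hκi.le (mul_nonneg hR0 (euclNorm_nonneg _))) ?_
    calc euclNorm h * euclNorm h = κ⁻¹ * (κ * (euclNorm h * euclNorm h)) := by
          rw [inv_mul_cancel_left₀ hκ.ne']
      _ ≤ κ⁻¹ * (euclNorm h * (R * euclNorm (X xφ))) := mul_le_mul_of_nonneg_left h1 hκi.le
      _ = _ := by ring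
  -- the filtered residual in terms of the objective
  have residual_le : ∀ ψ : Matrix (Fin m) (Fin L × Fin m) ℝ, euclNorm (X xφ)
      ≤ 2 * (opNorm (errorMatrix T N₁ N y u G₀ - featureMatrix T L N₁ N y * ψᵀ) + μ * opNorm ψ)
        + 2 * μ + opNorm G₀ * R := fun ψ => by
    set d := (φ - ψ)ᵀ *ᵥ v with hd
    set xψ : Fin m ⊕ (Fin L × Fin m) → ℝ := Sum.elim v (-(ψᵀ *ᵥ v)) with hxψ
    set xd : Fin m ⊕ (Fin L × Fin m) → ℝ := Sum.elim 0 d with hxd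
    have split : X xφ = X xψ - X xd := by
      rw [hX, ← ridgeVector_sub]
      congr 1
      ext (i | i)
      · simp [xφ, xψ, xd]
      · simp only [xφ, xψ, xd, hd, transpose_sub, sub_mulVec, Sum.elim_inr, Pi.sub_apply,
          Pi.neg_apply]
        ring
    have zd : ∀ t, ζ t ⬝ᵥ xd = feature T L y t ⬝ᵥ d := fun t => by
      rw [hζ, hxd, sumElim_dotProduct_sumElim, dotProduct_zero, zero_add]
    -- The ridge normal equation: the exact orthogonality would hold for the target `δ_t`; fitting
    -- `y_t` adds the cross term with `G₀ ū_t`.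
    have hne : X xd ⬝ᵥ X xφ
        = -((G₀ᵀ *ᵥ v) ⬝ᵥ ∑ t ∈ Finset.Icc N₁ N, (ζ t ⬝ᵥ xd) • stackedInput T u t) := by
      have h0 := ridge_normal_equation hφ v d
      have e3 : v ⬝ᵥ φ *ᵥ d = -(xd ⬝ᵥ xφ) := by
        rw [hxd, hxφ, sumElim_dotProduct_sumElim, zero_dotProduct, zero_add, dotProduct_neg,
          neg_neg, mulVec_transpose, dotProduct_mulVec, dotProduct_comm]
      rw [hX, ridgeVector_dotProduct hN, dotProduct_sum, ← Finset.sum_neg_distrib]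
      rw [e3, mul_neg, ← add_eq_zero_iff_eq_neg] at h0
      rw [← sub_eq_zero, ← h0, add_sub_right_comm, ← Finset.sum_sub_distrib]
      congr 1
      refine Finset.sum_congr rfl fun t _ => ?_
      have e2 := fit t
      rw [sub_dotProduct] at e2
      rw [zd, dotProduct_smul, smul_eq_mul, mulVec_transpose, ← dotProduct_mulVec, ← e2,
        dotProduct_comm v]
      ring
    have hψ := euclNorm_ridgeVector_le (N₁ := N₁) (N := N) (y := y) (u := u) hμ G₀ ψ hv
    have hg : euclNorm (G₀ᵀ *ᵥ v) ≤ opNorm G₀ := by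
      have := euclNorm_mulVec_le G₀ᵀ v
      rwa [opNorm_transpose, hv, mul_one] at this
    have hE : euclNorm (X xd) ≤ euclNorm (X xψ) + opNorm G₀ * R := by
      refine le_of_mul_self_le_mul (euclNorm_nonneg _)
        (add_nonneg (euclNorm_nonneg _) (by positivity)) ?_
      have e4 : euclNorm (X xd) * euclNorm (X xd) = X xd ⬝ᵥ X xψ
          + (G₀ᵀ *ᵥ v) ⬝ᵥ ∑ t ∈ Finset.Icc N₁ N, (ζ t ⬝ᵥ xd) • stackedInput T u t := by
        rw [split, dotProduct_sub, dotProduct_self_eq_normSq, ← euclNorm_sq, pow_two] at hne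
        linarith
      rw [e4, mul_add]
      refine add_le_add (dotProduct_le_euclNorm _ _) ((dotProduct_le_euclNorm _ _).trans ?_)
      calc _ ≤ opNorm G₀ * (R * euclNorm (X xd)) :=
            mul_le_mul hg (cross xd) (euclNorm_nonneg _) hG₀
        _ = _ := by ring
    have h2 := euclNorm_sub_le (X xψ) (X xd)
    rw [← split] at h2
    have hψ' : euclNorm (X xψ) ≤ _ := hψ
    linarith
  -- The bound holds for every competitor `ψ`, so it passes to the infimum; no minimizer is needed.
  have hinf : (euclNorm (X xφ) - 2 * μ - opNorm G₀ * R) / 2 ≤ opt T L N₁ N μ y u G₀ :=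
    le_ciInf fun ψ => by linarith [residual_le ψ]
  refine error_le.trans (mul_le_mul_of_nonneg_left (mul_le_mul_of_nonneg_left ?_ hR0) hκi.le)
  linarith

end Deterministic

/-! ### Powers of matrices in Jordan normal form -/

section Jordan

open scoped Matrix.Norms.L2Operator

theorem norm_toLp_ofReal {ι : Type*} [Fintype ι] (v : ι → ℝ) :
    ‖WithLp.toLp 2 (fun i => (v i : ℂ))‖ = ‖WithLp.toLp 2 v‖ := by
  simp [EuclideanSpace.norm_eq]

/-- Real vectors are admissible test vectors for the complex matrix. -/
theorem opNorm_le_opNorm_cplx {ι κ : Type*} [Fintype ι] [Fintype κ] [DecidableEq κ]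
    (A : Matrix ι κ ℝ) : opNorm A ≤ opNorm (cplx A) := by
  refine ContinuousLinearMap.opNorm_le_bound _ (opNorm_nonneg _) fun x => ?_
  have hmul : cplx A *ᵥ (fun i => (x i : ℂ)) = fun i => ((A *ᵥ x.ofLp) i : ℂ) := by
    ext i
    simp [mulVec, dotProduct, cplx]
  have h := l2_opNorm_mulVec (cplx A) (WithLp.toLp 2 (fun i => (x i : ℂ)))
  rw [← opNorm_eq_norm] at h
  have h1 := norm_toLp_ofReal (A *ᵥ x.ofLp)
  have h2 := norm_toLp_ofReal x.ofLp
  rw [← hmul] at h1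
  exact (h1.symm.le.trans h).trans_eq (by rw [h2])

theorem cplx_mul {ι κ σ : Type*} [Fintype κ] (A : Matrix ι κ ℝ) (B : Matrix κ σ ℝ) :
    cplx (A * B) = cplx A * cplx B :=
  Matrix.map_mul (f := Complex.ofRealHom)

theorem cplx_pow {ι : Type*} [Fintype ι] [DecidableEq ι] (A : Matrix ι ι ℝ) (s : ℕ) :
    cplx (A ^ s) = cplx A ^ s := by
  induction s with
  | zero => ext i j; simp [cplx, Matrix.one_apply, apply_ite]
  | succ s ih => rw [pow_succ, pow_succ, cplx_mul, ih]

variable {q : ℕ} {size : Fin q → ℕ}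

/-- The nilpotent part of a matrix in Jordan normal form. -/
def jordanNilpotent (size : Fin q → ℕ) : Matrix (Σ i, Fin (size i)) (Σ i, Fin (size i)) ℂ :=
  fun a b => if a.1 = b.1 ∧ (a.2 : ℕ) + 1 = b.2 then 1 else 0

theorem blockDiagonal_jordanBlock (eig : Fin q → ℂ) :
    Matrix.blockDiagonal' (fun i => jordanBlock (size i) (eig i))
      = jordanNilpotent size + Matrix.diagonal (fun a => eig a.1) := by
  ext ⟨a, i⟩ ⟨b, j⟩
  by_cases hab : a = b
  · subst hab
    rw [Matrix.blockDiagonal'_apply_eq, Matrix.add_apply, jordanNilpotent, Matrix.diagonal_apply,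
      jordanBlock]
    by_cases hij : i = j
    · subst hij; simp
    · have : ¬ (⟨a, i⟩ : Σ i, Fin (size i)) = ⟨a, j⟩ := fun h => hij (by simpa using h)
      simp [hij]
  · rw [Matrix.blockDiagonal'_apply_ne _ _ _ hab, Matrix.add_apply, jordanNilpotent,
      Matrix.diagonal_apply_ne]
    · simp [hab]
    · exact fun h => hab (congrArg Sigma.fst h)

theorem commute_jordanNilpotent (eig : Fin q → ℂ) :
    Commute (jordanNilpotent size) (Matrix.diagonal (fun a => eig a.1)) := by
  ext a b
  rw [Matrix.mul_diagonal, Matrix.diagonal_mul, jordanNilpotent]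
  split_ifs with h
  · rw [h.1, mul_comm]
  · simp

theorem jordanNilpotent_pow_ne_zero (r : ℕ) (a b : Σ i, Fin (size i))
    (h : (jordanNilpotent size ^ r) a b ≠ 0) : a.1 = b.1 ∧ (a.2 : ℕ) + r = b.2 := by
  induction r generalizing b with
  | zero =>
    rw [pow_zero, Matrix.one_apply] at h
    have : a = b := by by_contra hab; simp [hab] at h
    subst this; simp
  | succ r ih =>
    rw [pow_succ, Matrix.mul_apply] at h
    obtain ⟨c, -, hc⟩ := Finset.exists_ne_zero_of_sum_ne_zero h
    obtain ⟨h1, h2⟩ := ih c (left_ne_zero_of_mul hc)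
    have h3 := right_ne_zero_of_mul hc
    rw [jordanNilpotent] at h3
    have h4 : c.1 = b.1 ∧ (c.2 : ℕ) + 1 = b.2 := by by_contra hcb; simp [hcb] at h3
    exact ⟨h1.trans h4.1, by omega⟩

theorem jordanNilpotent_pow_eq_zero {k r : ℕ} (hk : ∀ i, size i ≤ k) (hr : k ≤ r) :
    jordanNilpotent size ^ r = 0 := by
  ext a b
  by_contra h
  have h1 := (jordanNilpotent_pow_ne_zero r a b h).2
  have h2 := b.2.2
  have h3 := hk b.1
  omega

/-- The matrix is a partial isometry between coordinate vectors: its Gram matrix is diagonal with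
entries `0` or `1`. -/
theorem norm_jordanNilpotent_le : ‖jordanNilpotent size‖ ≤ 1 := by
  have e : (jordanNilpotent size)ᴴ * jordanNilpotent size
      = Matrix.diagonal (fun a : Σ i, Fin (size i) => ((Finset.univ.filter fun c : Σ i, Fin (size i) =>
          c.1 = a.1 ∧ (c.2 : ℕ) + 1 = a.2).card : ℂ)) := by
    ext a b
    rw [Matrix.mul_apply]
    by_cases hab : a = b
    · subst hab
      rw [Matrix.diagonal_apply_eq, Finset.card_filter]
      push_cast
      refine Finset.sum_congr rfl fun c _ => ?_
      simp only [conjTranspose_apply, jordanNilpotent]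
      split_ifs <;> simp
    · rw [Matrix.diagonal_apply_ne _ hab]
      refine Finset.sum_eq_zero fun c _ => ?_
      simp only [conjTranspose_apply, jordanNilpotent]
      split_ifs with h1 h2
      · refine absurd ?_ hab
        obtain ⟨a1, a2⟩ := a
        obtain ⟨b1, b2⟩ := b
        obtain ⟨h1, h1'⟩ := h1
        obtain ⟨h2, h2'⟩ := h2
        dsimp only at h1 h1' h2 h2'
        have : a1 = b1 := h1.symm.trans h2
        subst this
        have : a2 = b2 := Fin.ext (h1'.symm.trans h2')
        rw [this]
      all_goals simp
  have h := l2_opNorm_conjTranspose_mul_self (jordanNilpotent size)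
  rw [e, l2_opNorm_diagonal] at h
  have h1 : ‖(fun a : Σ i, Fin (size i) => ((Finset.univ.filter fun c : Σ i, Fin (size i) =>
          c.1 = a.1 ∧ (c.2 : ℕ) + 1 = a.2).card : ℂ))‖ ≤ 1 := by
    refine (pi_norm_le_iff_of_nonneg zero_le_one).2 fun a => ?_
    rw [Complex.norm_natCast]
    norm_cast
    refine Finset.card_le_one.2 fun c hc d hd => ?_
    simp only [Finset.mem_filter, Finset.mem_univ, true_and] at hc hd
    obtain ⟨c1, c2⟩ := c
    obtain ⟨d1, d2⟩ := d
    obtain ⟨h1, h1'⟩ := hc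
    obtain ⟨h2, h2'⟩ := hd
    dsimp only at h1 h1' h2 h2'
    have : c1 = d1 := h1.trans h2.symm
    subst this
    have : c2 = d2 := Fin.ext (by omega)
    rw [this]
  rw [h] at h1
  nlinarith [norm_nonneg (jordanNilpotent size)]

theorem norm_matrix_pow_le_one {ι : Type*} [Fintype ι] [DecidableEq ι] {M : Matrix ι ι ℂ}
    (hM : ‖M‖ ≤ 1) (r : ℕ) : ‖M ^ r‖ ≤ 1 := by
  induction r with
  | zero =>
    rw [pow_zero, ← Matrix.diagonal_one, l2_opNorm_diagonal]
    exact (pi_norm_le_iff_of_nonneg zero_le_one).2 fun a => by simp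
  | succ r ih =>
    rw [pow_succ]
    exact (l2_opNorm_mul _ _).trans (mul_le_one₀ ih (norm_nonneg _) hM)

/-- Compare termwise with the binomial expansion of `(s + 1) ^ k`, using `choose s r ≤ s ^ r`. -/
theorem sum_choose_le (s k : ℕ) : ∑ r ∈ Finset.range k, s.choose r ≤ (1 + s) ^ k := by
  calc ∑ r ∈ Finset.range k, s.choose r ≤ ∑ r ∈ Finset.range k, s ^ r * 1 ^ (k - r) * k.choose r :=
        Finset.sum_le_sum fun r hr => by
          have h1 := Nat.choose_le_pow s r
          have h2 : 0 < k.choose r := Nat.choose_pos (Finset.mem_range.1 hr).le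
          simp only [one_pow, mul_one]
          exact h1.trans (Nat.le_mul_of_pos_right _ h2)
    _ ≤ ∑ r ∈ Finset.range (k + 1), s ^ r * 1 ^ (k - r) * k.choose r :=
        Finset.sum_le_sum_of_subset (Finset.range_subset_range.2 k.le_succ)
    _ = (1 + s) ^ k := by rw [add_comm 1 s, add_pow]; simp

/-- Diagonal and nilpotent part commute and have norm at most one, and the `k`-th power of the
latter vanishes, so the binomial theorem leaves only the coefficients with `r < k`. -/
theorem norm_jordan_pow_le {eig : Fin q → ℂ} (he : ∀ i, ‖eig i‖ ≤ 1) {k : ℕ}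
    (hk : ∀ i, size i ≤ k) (s : ℕ) :
    ‖Matrix.blockDiagonal' (fun i => jordanBlock (size i) (eig i)) ^ s‖ ≤ (1 + s : ℝ) ^ k := by
  have hd : ‖(Matrix.diagonal (fun a : Σ i, Fin (size i) => eig a.1))‖ ≤ 1 := by
    rw [l2_opNorm_diagonal]
    exact (pi_norm_le_iff_of_nonneg zero_le_one).2 fun a => he a.1
  rw [blockDiagonal_jordanBlock, (commute_jordanNilpotent eig).add_pow]
  refine (norm_sum_le _ _).trans ?_
  have h : ∀ r ∈ Finset.range (s + 1), ‖jordanNilpotent size ^ r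
      * Matrix.diagonal (fun a => eig a.1) ^ (s - r) * ((s.choose r : ℕ) : Matrix _ _ ℂ)‖
      ≤ if r < k then (s.choose r : ℝ) else 0 := fun r _ => by
    split_ifs with hr
    · rw [← nsmul_eq_mul']
      refine (norm_nsmul_le).trans ?_
      refine mul_le_of_le_one_right (Nat.cast_nonneg _) ?_
      exact (l2_opNorm_mul _ _).trans (mul_le_one₀ (norm_matrix_pow_le_one
        norm_jordanNilpotent_le r) (norm_nonneg _) (norm_matrix_pow_le_one hd _))
    · rw [jordanNilpotent_pow_eq_zero hk (not_lt.1 hr)]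
      simp
  refine (Finset.sum_le_sum h).trans ?_
  rw [← Finset.sum_filter]
  refine (Finset.sum_le_sum_of_subset_of_nonneg (t := Finset.range k) (fun r hr => ?_)
    fun _ _ _ => Nat.cast_nonneg _).trans ?_
  · exact Finset.mem_range.2 (Finset.mem_filter.1 hr).2
  · exact_mod_cast sum_choose_le s k

variable {n : ℕ} {A : Matrix (Fin n) (Fin n) ℝ}

/-- The image under `S` of the first basis vector of a block is an eigenvector of `A`, so the
diagonal of `J` consists of spectral values. -/
theorem JordanDecomp.norm_eig_le (J : JordanDecomp A) (hρ : spectralRadius ℂ (cplx A) ≤ 1)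
    (i : Fin J.numBlocks) : ‖J.eig i‖ ≤ 1 := by
  have hmem : J.eig i ∈ spectrum ℂ (cplx A) := by
    set a : Σ i, Fin (J.size i) := ⟨i, ⟨0, J.size_pos i⟩⟩ with ha
    set e : (Σ i, Fin (J.size i)) → ℂ := Pi.single a 1 with he
    have hJ : Matrix.blockDiagonal' (fun i => jordanBlock (J.size i) (J.eig i)) *ᵥ e
        = J.eig i • e := by
      ext b
      rw [blockDiagonal_jordanBlock, add_mulVec, he, mulVec_single_one, mulVec_single_one,
        Pi.add_apply, Pi.smul_apply, smul_eq_mul]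
      simp only [col_apply, jordanNilpotent, Matrix.diagonal_apply, ha, Pi.single_apply]
      by_cases hb : b = ⟨i, ⟨0, J.size_pos i⟩⟩
      · subst hb; simp
      · simp [hb]
    have hA : cplx A *ᵥ (J.S *ᵥ e) = J.eig i • (J.S *ᵥ e) := by
      rw [J.decomp, mulVec_mulVec, Matrix.mul_assoc, J.inv_mul, Matrix.mul_one, ← mulVec_mulVec,
        hJ, mulVec_smul]
    rw [spectrum.mem_iff]
    intro hu
    obtain ⟨U, hU⟩ := hu
    have h0 : (U : Matrix (Fin n) (Fin n) ℂ) *ᵥ (J.S *ᵥ e) = 0 := by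
      rw [hU, sub_mulVec, hA, Algebra.algebraMap_eq_smul_one, smul_mulVec, one_mulVec, sub_self]
    have h1 : J.S *ᵥ e = 0 := by
      have := congrArg ((U⁻¹ : (Matrix (Fin n) (Fin n) ℂ)ˣ) : Matrix (Fin n) (Fin n) ℂ).mulVec h0
      rwa [mulVec_mulVec, Units.inv_mul, one_mulVec, mulVec_zero] at this
    have h2 : e = 0 := by
      have := congrArg J.Sinv.mulVec h1
      rwa [mulVec_mulVec, J.inv_mul, one_mulVec, mulVec_zero] at this
    have h3 := congrFun h2 a
    simp [he] at h3
  have h : (‖J.eig i‖₊ : ENNReal) ≤ 1 :=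
    (le_iSup₂ (f := fun k (_ : k ∈ spectrum ℂ (cplx A)) => (‖k‖₊ : ENNReal)) _ hmem).trans hρ
  exact_mod_cast h

theorem JordanDecomp.opNorm_mul_pow_mul_le (J : JordanDecomp A)
    (hρ : spectralRadius ℂ (cplx A) ≤ 1) {k : ℕ} (hk : J.LargestBlock k) {m q : ℕ}
    (C : Matrix (Fin m) (Fin n) ℝ) (B : Matrix (Fin n) (Fin q) ℝ) (s : ℕ) :
    opNorm (C * A ^ s * B)
      ≤ opNorm (cplx C * J.S) * (1 + s : ℝ) ^ k * opNorm (J.Sinv * cplx B) := by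
  refine (opNorm_le_opNorm_cplx _).trans ?_
  have hpow : cplx A ^ s
      = J.S * Matrix.blockDiagonal' (fun i => jordanBlock (J.size i) (J.eig i)) ^ s * J.Sinv := by
    induction s with
    | zero => rw [pow_zero, pow_zero, Matrix.mul_one, J.mul_inv]
    | succ s ih =>
      rw [pow_succ, ih, pow_succ]
      conv_lhs => rw [J.decomp]
      simp only [Matrix.mul_assoc]
      rw [← Matrix.mul_assoc J.Sinv J.S, J.inv_mul, Matrix.one_mul]
  rw [cplx_mul, cplx_mul, cplx_pow, hpow]
  have e : cplx C * (J.S * Matrix.blockDiagonal' (fun i => jordanBlock (J.size i) (J.eig i)) ^ s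
      * J.Sinv) * cplx B = cplx C * J.S
      * Matrix.blockDiagonal' (fun i => jordanBlock (J.size i) (J.eig i)) ^ s
      * (J.Sinv * cplx B) := by simp only [Matrix.mul_assoc]
  rw [e, opNorm_eq_norm, opNorm_eq_norm, opNorm_eq_norm]
  refine (l2_opNorm_mul _ _).trans (mul_le_mul_of_nonneg_right ?_ (norm_nonneg _))
  refine (l2_opNorm_mul _ _).trans (mul_le_mul_of_nonneg_left ?_ (norm_nonneg _))
  exact norm_jordan_pow_le (J.norm_eig_le hρ) (fun i => hk.2 ⟨i, rfl⟩) s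

end Jordan

/-! ### Tails of subgaussian energies -/

section Subgaussian

variable {Ω : Type*} [mΩ : MeasurableSpace Ω] {P : Measure Ω} [IsProbabilityMeasure P]

/-- Exponential moments of the linear functionals of `X` are those of a subgaussian vector. -/
def SubgaussianVector {d : ℕ} (P : Measure Ω) (X : Ω → Fin d → ℝ) : Prop :=
  ∀ (a : ℝ) (v : Fin d → ℝ),
    ∫⁻ ω, ENNReal.ofReal (Real.exp (a * (v ⬝ᵥ X ω))) ∂P
      ≤ ENNReal.ofReal (Real.exp (a ^ 2 * normSq v))

theorem CondSubgaussian.subgaussianVector {Ω : Type*} {𝓖 : MeasurableSpace Ω}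
    [mΩ : MeasurableSpace Ω] {P : Measure Ω} [IsProbabilityMeasure P] {d : ℕ} (h𝓖 : 𝓖 ≤ mΩ)
    {X : Ω → Fin d → ℝ} (hX : CondSubgaussian P 𝓖 X) : SubgaussianVector P X := fun a v => by
  obtain ⟨hi, hle⟩ := hX a v
  rw [← ofReal_integral_eq_lintegral_ofReal hi (ae_of_all _ fun _ => (Real.exp_pos _).le)]
  refine ENNReal.ofReal_le_ofReal ?_
  rw [← integral_condExp h𝓖]
  refine (integral_mono_ae integrable_condExp (integrable_const _) hle).trans ?_
  simp

variable {n p m dw dz T N : ℕ} {𝓕 : Filtration ℤ mΩ}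
  {u : ℕ → Ω → Fin p → ℝ} {w : ℕ → Ω → Fin dw → ℝ} {z : ℕ → Ω → Fin dz → ℝ}

theorem SemiAdversarial.subgaussianVector_input (h : SemiAdversarial P 𝓕 T N u w z) {t : ℕ}
    (h1 : 1 ≤ t) (h2 : t ≤ N) : SubgaussianVector P (u t) := fun a v => by
  have hm := mgf_gaussianReal (h.map_dotProduct h1 h2 (q := v)) a
  rw [zero_mul, zero_add, Real.coe_toNNReal _ (normSq_nonneg v), mgf] at hm
  have hi : Integrable (fun ω => Real.exp (a * (v ⬝ᵥ u t ω))) P := by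
    by_contra hi
    rw [integral_undef hi] at hm
    exact (Real.exp_pos _).ne hm
  rw [← ofReal_integral_eq_lintegral_ofReal hi (ae_of_all _ fun _ => (Real.exp_pos _).le), hm]
  refine ENNReal.ofReal_le_ofReal (Real.exp_le_exp.2 ?_)
  nlinarith [mul_nonneg (sq_nonneg a) (normSq_nonneg v)]

/-- Linearization by an auxiliary Gaussian `g`: `exp (x²/8)` is the mean of `exp (g x / 2)`. After
exchanging the integrals, the subgaussian bound leaves the mean of `exp (g²/4)`, which is `√2`. -/
theorem SubgaussianVector.lintegral_exp_sq_le {d : ℕ} {X : Ω → Fin d → ℝ} (hX : Measurable X)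
    (h : SubgaussianVector P X) {v : Fin d → ℝ} (hv : normSq v ≤ 1) :
    ∫⁻ ω, ENNReal.ofReal (Real.exp ((v ⬝ᵥ X ω) ^ 2 / 8)) ∂P ≤ ENNReal.ofReal √2 := by
  have hm : Measurable fun ω => v ⬝ᵥ X ω := by
    simp only [dotProduct]
    exact Finset.measurable_fun_sum _ fun i _ => ((measurable_pi_apply i).comp hX).const_mul _
  have h1 : ∀ ω, ENNReal.ofReal (Real.exp ((v ⬝ᵥ X ω) ^ 2 / 8))
      = ∫⁻ g, ENNReal.ofReal (Real.exp (g / 2 * (v ⬝ᵥ X ω))) ∂(gaussianReal 0 1) := fun ω => by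
    have := lintegral_exp_quadratic_gaussianReal ((v ⬝ᵥ X ω) / 2) (b := 0) one_pos
    rw [sub_zero, Real.sqrt_one, div_one] at this
    convert this.symm using 3
    · ring_nf
    · ring_nf
  simp only [h1]
  rw [lintegral_lintegral_swap (by
    refine (ENNReal.measurable_ofReal.comp (Real.measurable_exp.comp ?_)).aemeasurable
    exact (measurable_snd.div_const _).mul (hm.comp measurable_fst))]
  have h2 : ∀ g : ℝ, ∫⁻ ω, ENNReal.ofReal (Real.exp (g / 2 * (v ⬝ᵥ X ω))) ∂P
      ≤ ENNReal.ofReal (Real.exp (0 * g + 1 / 2 * g ^ 2 / 2)) := fun g =>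
    (h (g / 2) v).trans (ENNReal.ofReal_le_ofReal (Real.exp_le_exp.2 (by
      nlinarith [mul_le_mul_of_nonneg_left hv (sq_nonneg (g / 2))])))
  refine (lintegral_mono h2).trans ?_
  rw [lintegral_exp_quadratic_gaussianReal 0 (by norm_num)]
  refine ENNReal.ofReal_le_ofReal (le_of_eq ?_)
  norm_num

/-- By Jensen, the exponential of the average of the `Z_i² / 8` is at most the average of their
exponentials. Hence no independence is required, and the tail does not depend on the number of
terms. -/
theorem measure_sum_sq_gt_le {σ : Type*} {S : Finset σ} {Z : σ → Ω → ℝ}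
    (hm : ∀ i ∈ S, Measurable (Z i))
    (h : ∀ i ∈ S, ∫⁻ ω, ENNReal.ofReal (Real.exp (Z i ω ^ 2 / 8)) ∂P ≤ ENNReal.ofReal √2) (x : ℝ) :
    P {ω | S.card * x < ∑ i ∈ S, Z i ω ^ 2} ≤ ENNReal.ofReal (√2 * Real.exp (-(x / 8))) := by
  rcases S.eq_empty_or_nonempty with rfl | hS
  · simp
  have hc : (0 : ℝ) < S.card := by exact_mod_cast hS.card_pos
  set c : ℝ := (S.card : ℝ) with hcd
  set f : Ω → ENNReal := fun ω => ∑ i ∈ S, ENNReal.ofReal c⁻¹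
    * ENNReal.ofReal (Real.exp (Z i ω ^ 2 / 8)) with hf
  have hfm : ∀ i ∈ S, Measurable fun ω => ENNReal.ofReal (Real.exp (Z i ω ^ 2 / 8)) := fun i hi =>
    ENNReal.measurable_ofReal.comp (Real.measurable_exp.comp (((hm i hi).pow_const 2).div_const 8))
  have hint : ∫⁻ ω, f ω ∂P ≤ ENNReal.ofReal √2 := by
    rw [hf, lintegral_finsetSum' _ fun i hi => ((hfm i hi).const_mul _).aemeasurable]
    calc _ ≤ ∑ i ∈ S, ENNReal.ofReal c⁻¹ * ENNReal.ofReal √2 :=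
          Finset.sum_le_sum fun i hi => by
            rw [lintegral_const_mul _ (hfm i hi)]
            gcongr
            exact h i hi
      _ = ENNReal.ofReal √2 := by
          rw [Finset.sum_const, nsmul_eq_mul, ← mul_assoc, ← ENNReal.ofReal_natCast,
            ← ENNReal.ofReal_mul hc.le, mul_inv_cancel₀ hc.ne', ENNReal.ofReal_one, one_mul]
  have hsub : {ω | c * x < ∑ i ∈ S, Z i ω ^ 2} ⊆ {ω | ENNReal.ofReal (Real.exp (x / 8)) ≤ f ω} := by
    intro ω hω
    have hω : c * x < ∑ i ∈ S, Z i ω ^ 2 := hω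
    have hJ := convexOn_exp.map_sum_le (t := S) (w := fun _ => c⁻¹) (p := fun i => Z i ω ^ 2 / 8)
      (fun _ _ => (inv_pos.2 hc).le)
      (by rw [Finset.sum_const, nsmul_eq_mul, mul_inv_cancel₀ hc.ne']) fun _ _ => Set.mem_univ _
    have h1 : Real.exp (x / 8) ≤ ∑ i ∈ S, c⁻¹ * Real.exp (Z i ω ^ 2 / 8) := by
      refine le_trans (Real.exp_le_exp.2 ?_) hJ
      simp only [smul_eq_mul]
      rw [← Finset.mul_sum, ← Finset.sum_div, le_inv_mul_iff₀ hc]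
      linarith
    change ENNReal.ofReal (Real.exp (x / 8)) ≤ f ω
    refine (ENNReal.ofReal_le_ofReal h1).trans (le_of_eq ?_)
    rw [ENNReal.ofReal_sum_of_nonneg fun i _ => by positivity]
    exact Finset.sum_congr rfl fun i _ => ENNReal.ofReal_mul (inv_pos.2 hc).le
  refine (measure_mono hsub).trans ?_
  have hM := (mul_meas_ge_le_lintegral₀ (μ := P)
    (Finset.measurable_sum _ fun i hi => (hfm i hi).const_mul _).aemeasurable
    (ENNReal.ofReal (Real.exp (x / 8)))).trans hint
  rw [Real.exp_neg, ← div_eq_mul_inv, ENNReal.ofReal_div_of_pos (Real.exp_pos _),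
    ENNReal.le_div_iff_mul_le (Or.inl (by simpa using Real.exp_pos _)) (Or.inl ENNReal.ofReal_ne_top),
    mul_comm]
  refine le_trans (mul_le_mul_right (measure_mono fun ω hω => ?_) _) hM
  simpa [hf, Finset.sum_apply] using hω

/-- The total energy of the vectors `M r *ᵥ X s`. -/
def energy {d : ℕ} (N : ℕ) (M : ℕ → Matrix (Fin m) (Fin d) ℝ) (X : ℕ → Fin d → ℝ) : ℝ :=
  ∑ r ∈ Finset.range N, ∑ s ∈ Finset.Icc 1 N, normSq (M r *ᵥ X s)

theorem normSq_row_le {d : ℕ} (M : Matrix (Fin m) (Fin d) ℝ) (i : Fin m) :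
    normSq (M i) ≤ opNorm M ^ 2 := by
  have h := euclNorm_mulVec_le Mᵀ (Pi.single i 1)
  have h1 : Mᵀ *ᵥ Pi.single i 1 = M i := by ext j; simp
  have h2 : euclNorm (Pi.single i (1 : ℝ)) = 1 := by
    rw [euclNorm]; simp
  rw [opNorm_transpose, h1, h2, mul_one] at h
  rw [← euclNorm_sq]
  exact pow_le_pow_left₀ (euclNorm_nonneg _) h 2

/-- The energy is a sum of `N · N · m` squares of linear functionals, whose coefficient vectors have
norm at most one after division by `Q`. -/
theorem measure_energy_gt_le {d : ℕ} {M : ℕ → Matrix (Fin m) (Fin d) ℝ} {X : ℕ → Ω → Fin d → ℝ}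
    {Q : ℝ} (hQ : 0 < Q) (hM : ∀ r < N, opNorm (M r) ≤ Q)
    (hm : ∀ s, 1 ≤ s → s ≤ N → Measurable (X s))
    (hX : ∀ s, 1 ≤ s → s ≤ N → SubgaussianVector P (X s)) (x : ℝ) :
    P {ω | (N * N * m) * (Q ^ 2 * x) < energy N M (fun s => X s ω)}
      ≤ ENNReal.ofReal (√2 * Real.exp (-(x / 8))) := by
  have e : ∀ ω, energy N M (fun s => X s ω)
      = Q ^ 2 * ∑ a ∈ (Finset.range N ×ˢ Finset.Icc 1 N) ×ˢ (Finset.univ : Finset (Fin m)),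
        ((Q⁻¹ • M a.1.1 a.2) ⬝ᵥ X a.1.2 ω) ^ 2 := fun ω => by
    rw [Finset.sum_product, Finset.sum_product, energy, Finset.mul_sum]
    refine Finset.sum_congr rfl fun r _ => ?_
    rw [Finset.mul_sum]
    refine Finset.sum_congr rfl fun s _ => ?_
    rw [normSq, Finset.mul_sum]
    refine Finset.sum_congr rfl fun i _ => ?_
    dsimp only
    rw [smul_dotProduct, smul_eq_mul, mul_pow, ← mul_assoc, ← mul_pow, mul_inv_cancel₀ hQ.ne',
      one_pow, one_mul]
    rfl
  have key := measure_sum_sq_gt_le (P := P)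
    (S := (Finset.range N ×ˢ Finset.Icc 1 N) ×ˢ (Finset.univ : Finset (Fin m)))
    (Z := fun a ω => (Q⁻¹ • M a.1.1 a.2) ⬝ᵥ X a.1.2 ω) (fun a ha => by
      simp only [Finset.mem_product, Finset.mem_Icc] at ha
      simp only [dotProduct]
      exact Finset.measurable_fun_sum _ fun i _ =>
        ((measurable_pi_apply i).comp (hm _ ha.1.2.1 ha.1.2.2)).const_mul _) (fun a ha => by
      simp only [Finset.mem_product, Finset.mem_Icc, Finset.mem_range] at ha
      refine (hX _ ha.1.2.1 ha.1.2.2).lintegral_exp_sq_le (hm _ ha.1.2.1 ha.1.2.2) ?_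
      rw [normSq_smul, inv_pow, inv_mul_le_one₀ (by positivity)]
      exact (normSq_row_le _ _).trans (pow_le_pow_left₀ (opNorm_nonneg _) (hM _ ha.1.1) 2)) x
  refine le_trans (measure_mono fun ω hω => ?_) key
  have hω : (N * N * m) * (Q ^ 2 * x) < energy N M (fun s => X s ω) := hω
  rw [e, mul_left_comm, mul_lt_mul_iff_right₀ (by positivity)] at hω
  rw [Set.mem_ofPred_eq]
  simpa [Finset.card_product] using hω

theorem energy_le {d : ℕ} {M : ℕ → Matrix (Fin m) (Fin d) ℝ} {X : ℕ → Fin d → ℝ} {Q b : ℝ}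
    (hM : ∀ r < N, opNorm (M r) ≤ Q)
    (hX : ∀ s, 1 ≤ s → s ≤ N → normSq (X s) ≤ b) : energy N M X ≤ (N * N) * (Q ^ 2 * b) := by
  calc energy N M X ≤ ∑ r ∈ Finset.range N, ∑ s ∈ Finset.Icc 1 N, Q ^ 2 * b :=
        Finset.sum_le_sum fun r hr => Finset.sum_le_sum fun s hs => by
          have hs := Finset.mem_Icc.1 hs
          have h1 := pow_le_pow_left₀ (euclNorm_nonneg _) (euclNorm_mulVec_le (M r) (X s)) 2
          rw [mul_pow, euclNorm_sq, euclNorm_sq] at h1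
          have h2 := pow_le_pow_left₀ (opNorm_nonneg _) (hM r (Finset.mem_range.1 hr)) 2
          exact h1.trans (mul_le_mul h2 (hX s hs.1 hs.2) (normSq_nonneg _) (by positivity))
    _ = _ := by simp [mul_assoc]

theorem normSq_add_le {ι : Type*} [Fintype ι] (v v' : ι → ℝ) :
    normSq (v + v') ≤ 2 * (normSq v + normSq v') := by
  rw [normSq, normSq, normSq, ← Finset.sum_add_distrib, Finset.mul_sum]
  exact Finset.sum_le_sum fun i _ => by
    rw [Pi.add_apply]; nlinarith [sq_nonneg (v i - v' i)]

theorem normSq_sum_le {ι σ : Type*} [Fintype ι] (s : Finset σ) (v : σ → ι → ℝ) :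
    normSq (∑ a ∈ s, v a) ≤ s.card * ∑ a ∈ s, normSq (v a) := by
  simp only [normSq]
  rw [Finset.sum_comm, Finset.mul_sum]
  exact Finset.sum_le_sum fun i _ => by
    rw [Finset.sum_apply]
    exact sq_sum_le_card_mul_sum_sq

theorem energy_nonneg {d : ℕ} (M : ℕ → Matrix (Fin m) (Fin d) ℝ) (X : ℕ → Fin d → ℝ) :
    0 ≤ energy N M X :=
  Finset.sum_nonneg fun _ _ => Finset.sum_nonneg fun _ _ => normSq_nonneg _

theorem normSq_mulVec_le_energy {d : ℕ} (M : ℕ → Matrix (Fin m) (Fin d) ℝ) (X : ℕ → Fin d → ℝ)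
    {r s : ℕ} (hr : r < N) (h1 : 1 ≤ s) (h2 : s ≤ N) : normSq (M r *ᵥ X s) ≤ energy N M X :=
  (Finset.single_le_sum (f := fun s => normSq (M r *ᵥ X s)) (fun _ _ => normSq_nonneg _)
    (Finset.mem_Icc.2 ⟨h1, h2⟩)).trans
  (Finset.single_le_sum (f := fun r => ∑ s ∈ Finset.Icc 1 N, normSq (M r *ᵥ X s))
    (fun _ _ => Finset.sum_nonneg fun _ _ => normSq_nonneg _) (Finset.mem_range.2 hr))

/-- Cauchy–Schwarz over at most `N` summands; each `s` occurs with a single lag below `N`, and the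
energy sums over all of them. -/
theorem normSq_convolution_le {d : ℕ} (M : ℕ → Matrix (Fin m) (Fin d) ℝ) (X : ℕ → Fin d → ℝ)
    {t r : ℕ} (h1 : r < t) (h2 : t ≤ N) :
    normSq (∑ s ∈ Finset.Icc 1 r, M (t - 1 - s) *ᵥ X s) ≤ N * energy N M X := by
  refine (normSq_sum_le _ _).trans ?_
  refine mul_le_mul ?_ ?_ (Finset.sum_nonneg fun _ _ => normSq_nonneg _) (Nat.cast_nonneg _)
  · rw [Nat.card_Icc]
    exact_mod_cast (by omega : r + 1 - 1 ≤ N)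
  · rw [energy, Finset.sum_comm]
    refine (Finset.sum_le_sum (g := fun s => ∑ r ∈ Finset.range N, normSq (M r *ᵥ X s))
      fun s hs => ?_).trans (Finset.sum_le_sum_of_subset_of_nonneg
        (Finset.Icc_subset_Icc le_rfl (by omega)) fun _ _ _ =>
          Finset.sum_nonneg fun _ _ => normSq_nonneg _)
    have hs := Finset.mem_Icc.1 hs
    exact Finset.single_le_sum (f := fun r => normSq (M r *ᵥ X s)) (fun _ _ => normSq_nonneg _)
      (Finset.mem_range.2 (by omega))

variable (sys : LTI n p m dw dz)

/-- The constants accumulate as `10 N E` for a partial output, `22 N E` for an output, and `32 N² E`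
for a regressor with its `L ≤ N` outputs. -/
theorem LTI.sum_normSq_regressor_le (u : ℕ → Fin p → ℝ) (w : ℕ → Fin dw → ℝ) (z : ℕ → Fin dz → ℝ)
    {L : ℕ} (hT : 1 ≤ T) (hL : 1 ≤ L) (hN : T * L ≤ N) {E : ℝ}
    (hu : energy N (fun r => sys.C * sys.A ^ r * sys.B) u ≤ E)
    (hw : energy N (fun r => sys.C * sys.A ^ r * sys.Bw) w ≤ E)
    (hd : energy N (fun _ => sys.D) u ≤ E) (hz : energy N (fun _ => sys.Dz) z ≤ E) :
    ∑ i ∈ Finset.range (N - T * L + 1), normSq (sys.regressor T L u w z (T * L + i))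
      ≤ 32 * N ^ 3 * E := by
  have hTL : 1 ≤ T * L := Nat.mul_pos hT hL
  have hN1 : (1 : ℝ) ≤ N := by exact_mod_cast hTL.trans hN
  have hE : 0 ≤ E := (energy_nonneg _ _).trans hu
  have partial_le : ∀ t r, r < t → t ≤ N → normSq (sys.partialOutput u w z t r) ≤ 10 * N * E := by
    intro t r h1 h2
    have a1 := normSq_convolution_le (fun r => sys.C * sys.A ^ r * sys.B) u h1 h2
    have a2 := normSq_convolution_le (fun r => sys.C * sys.A ^ r * sys.Bw) w
      (by omega : t - 1 < t) h2
    have a3 := normSq_mulVec_le_energy (fun _ => sys.Dz) z (by omega : 0 < N)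
      (by omega : 1 ≤ t) h2
    rw [LTI.partialOutput]
    have b1 := normSq_add_le (∑ s ∈ Finset.Icc 1 r, (sys.C * sys.A ^ (t - 1 - s) * sys.B) *ᵥ u s
      + ∑ s ∈ Finset.Icc 1 (t - 1), (sys.C * sys.A ^ (t - 1 - s) * sys.Bw) *ᵥ w s) (sys.Dz *ᵥ z t)
    have b2 := normSq_add_le (∑ s ∈ Finset.Icc 1 r, (sys.C * sys.A ^ (t - 1 - s) * sys.B) *ᵥ u s)
      (∑ s ∈ Finset.Icc 1 (t - 1), (sys.C * sys.A ^ (t - 1 - s) * sys.Bw) *ᵥ w s)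
    have c1 := a1.trans (mul_le_mul_of_nonneg_left hu (Nat.cast_nonneg N))
    have c2 := a2.trans (mul_le_mul_of_nonneg_left hw (Nat.cast_nonneg N))
    have c3 := a3.trans hz
    have c4 := mul_le_mul_of_nonneg_right hN1 hE
    linarith
  have output_le : ∀ t ≤ N, normSq (sys.output u w z t) ≤ 22 * N * E := by
    intro t ht
    rcases Nat.eq_zero_or_pos t with rfl | ht0
    · simp only [LTI.output, if_true]
      have : normSq (0 : Fin m → ℝ) = 0 := by simp [normSq]
      rw [this]
      positivity
    · rw [sys.output_eq u w z ht0]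
      have a1 := partial_le t (t - 1) (by omega) ht
      have a2 := (normSq_mulVec_le_energy (fun _ => sys.D) u (by omega : 0 < N) ht0 ht).trans hd
      have b := normSq_add_le (sys.partialOutput u w z t (t - 1)) (sys.D *ᵥ u t)
      have c := mul_le_mul_of_nonneg_right hN1 hE
      linarith
  have hLN : L ≤ N := (Nat.le_mul_of_pos_left L hT).trans hN
  have regressor_le : ∀ i ∈ Finset.range (N - T * L + 1),
      normSq (sys.regressor T L u w z (T * L + i)) ≤ 32 * N ^ 2 * E := by
    intro i hi
    have hi := Finset.mem_range.1 hi
    have hTt : T ≤ T * L + i := (Nat.le_mul_of_pos_right T hL).trans (Nat.le_add_right _ _)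
    rw [LTI.regressor, normSq_sum_elim, sys.output_sub_response u w z hT hTt]
    have a1 := partial_le (T * L + i) (T * L + i - T) (by omega) (by omega)
    have a2 : normSq (feature T L (sys.output u w z) (T * L + i)) ≤ N * (22 * N * E) := by
      have hl : ∀ l : Fin L, normSq (sys.output u w z (T * L + i - ((l : ℕ) + 1) * T))
          ≤ 22 * N * E := fun l => output_le _ ((Nat.sub_le _ _).trans (by omega))
      calc _ = ∑ l : Fin L, normSq (sys.output u w z (T * L + i - ((l : ℕ) + 1) * T)) := by
            simp only [normSq, Fintype.sum_prod_type, feature]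
        _ ≤ ∑ _ : Fin L, (22 * N * E : ℝ) := Finset.sum_le_sum fun l _ => hl l
        _ = L * (22 * N * E) := by simp
        _ ≤ N * (22 * N * E) := by gcongr
    have c := mul_le_mul_of_nonneg_right hN1 (mul_nonneg (Nat.cast_nonneg (α := ℝ) N) hE)
    refine (add_le_add a1 a2).trans ?_
    linarith
  calc _ ≤ ∑ i ∈ Finset.range (N - T * L + 1), (32 * N ^ 2 * E : ℝ) := Finset.sum_le_sum regressor_le
    _ = ((N - T * L + 1 : ℕ) : ℝ) * (32 * N ^ 2 * E) := by simp
    _ ≤ N * (32 * N ^ 2 * E) := by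
        gcongr
        omega
    _ = _ := by ring

end Subgaussian

/-! ### The exceptional probabilities and the effective dimension -/

section Constants

theorem deltaU_eq {T N p : ℕ} (hN : 1 ≤ N) (hp : 1 ≤ p) :
    deltaU T N p = Real.exp (-(Real.log (2 * T * p) ^ 2 * Real.log (2 * N * p) ^ 2)) := by
  have hN : (0 : ℝ) < N := by exact_mod_cast hN
  have hp : (0 : ℝ) < p := by exact_mod_cast hp
  rw [deltaU, Real.rpow_def_of_pos (by positivity)]
  congr 1
  ring

theorem log_two_le_log {T p : ℕ} (hT : 1 ≤ T) (hp : 1 ≤ p) :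
    69 / 100 ≤ Real.log (2 * T * p) := by
  have hT : (1 : ℝ) ≤ T := by exact_mod_cast hT
  have hp : (1 : ℝ) ≤ p := by exact_mod_cast hp
  have h1 := Real.log_two_gt_d9
  have h2 := Real.log_le_log two_pos (by nlinarith : (2 : ℝ) ≤ 2 * T * p)
  linarith

theorem two_mul_le_of_nmin_le {T p N L : ℕ} (hT : 1 ≤ T) (hp : 1 ≤ p)
    (hN : Nmin (10 ^ 8) T L p ≤ N) : (2 * T * p : ℝ) ≤ N := by
  have h0 := (le_max_right _ _).trans hN
  have ha := pow_le_pow_left₀ (by norm_num) (log_two_le_log hT hp) 4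
  have hTp : (0 : ℝ) ≤ T * p := by positivity
  nlinarith [mul_le_mul_of_nonneg_left ha hTp]

/-- With `X = N / (Tp)`, `a = log (2Tp)` and `b = log (2Np)` the claim is `a + a² b² ≤ X / 96`.
Since `b ≤ log X + 2a` and `log X` is below a multiple of `X^(1/4)`, the dominant terms are `a² √X`
and `a⁴`. Both are small compared with `X ≥ 10⁸ a⁴`, which explains the fourth power of the
logarithm in `Nmin`. -/
theorem illConditioned_prob_le {T p N L : ℕ} (hT : 1 ≤ T) (hp : 1 ≤ p) (hN1 : 1 ≤ N)
    (hN : Nmin (10 ^ 8) T L p ≤ N) :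
    T * p * Real.exp (-(N / (96 * T * p))) ≤ deltaU T N p / 2 := by
  rw [deltaU_eq hN1 hp]
  have h0 := (le_max_right _ _).trans hN
  have ha := log_two_le_log hT hp
  have hNTp := two_mul_le_of_nmin_le hT hp hN
  have hT : (1 : ℝ) ≤ T := by exact_mod_cast hT
  have hp : (1 : ℝ) ≤ p := by exact_mod_cast hp
  have hN1 : (1 : ℝ) ≤ N := by exact_mod_cast hN1
  set a := Real.log (2 * T * p) with had
  set b := Real.log (2 * N * p) with hbd
  have hTp : (0 : ℝ) < T * p := by positivity
  set X : ℝ := N / (T * p) with hX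
  have hX1 : 1 ≤ X := by rw [hX, le_div_iff₀ hTp]; nlinarith
  have hXN : X * (T * p) = N := div_mul_cancel₀ _ hTp.ne'
  have hXa : 10 ^ 8 * a ^ 4 ≤ X := by
    rw [hX, le_div_iff₀ hTp]
    linarith
  have hb0 : 0 ≤ b := Real.log_nonneg (by nlinarith)
  have hb : b ≤ Real.log X + 2 * a := by
    have e : Real.log (X * (2 * T * p) ^ 2) = Real.log X + 2 * a := by
      rw [Real.log_mul (by positivity) (by positivity), Real.log_pow, Nat.cast_ofNat]
    rw [← e]
    refine Real.log_le_log (by positivity) ?_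
    rw [← hXN]
    have : 0 ≤ X * (T * p) * p * (4 * T - 2) := by
      have : (0 : ℝ) ≤ 4 * T - 2 := by linarith
      positivity
    nlinarith
  set s := √X with hs
  set r := √s with hr
  have hs2 : s ^ 2 = X := Real.sq_sqrt (by positivity)
  have hr2 : r ^ 2 = s := Real.sq_sqrt (Real.sqrt_nonneg _)
  have hs0 : 0 < s := Real.sqrt_pos.2 (by positivity)
  have hr0 : 0 < r := Real.sqrt_pos.2 hs0
  have hlog : Real.log X ≤ 4 * r := by
    rw [← hs2, ← hr2, ← pow_mul, Real.log_pow]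
    have := Real.log_le_self hr0.le
    push_cast
    linarith
  have hsa : 10 ^ 4 * a ^ 2 ≤ s := by
    refine abs_le_of_sq_le_sq' ?_ hs0.le |>.2
    rw [hs2]
    nlinarith
  have hb2 : b ^ 2 ≤ 32 * s + 8 * a ^ 2 := by
    have h1 := pow_le_pow_left₀ hb0 (hb.trans (add_le_add hlog le_rfl)) 2
    rw [← hr2]
    nlinarith [sq_nonneg (4 * r - 2 * a)]
  have hab : a ^ 2 * b ^ 2 ≤ 32 * (a ^ 2 * s) + 8 * a ^ 4 := by
    nlinarith [mul_le_mul_of_nonneg_left hb2 (sq_nonneg a)]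
  have has : 10 ^ 4 * (a ^ 2 * s) ≤ X := by
    rw [← hs2]
    nlinarith [mul_le_mul_of_nonneg_right hsa hs0.le]
  have ha4 : a ≤ 4 * a ^ 4 := by
    have h3 := pow_le_pow_left₀ (by norm_num) ha 3
    have : a * (1 / 4) ≤ a * a ^ 3 := mul_le_mul_of_nonneg_left (by linarith) (by linarith)
    nlinarith
  have key : a + a ^ 2 * b ^ 2 ≤ X / 96 := by linarith
  have e1 : (N : ℝ) / (96 * T * p) = X / 96 := by rw [hX]; field_simp
  have e2 : (T * p : ℝ) = Real.exp a / 2 := by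
    rw [had, Real.exp_log (by positivity)]; ring
  rw [e1, e2, div_mul_eq_mul_div, ← Real.exp_add]
  gcongr
  linarith

/-- The only property of `p̃` that the bound uses. When `T p = 1` the logarithm makes `p̃` vanish,
and `L m ≥ 1` takes over; otherwise the minimum in `p̃` is at least `1` and at least `log T`. -/
theorem add_log_le_pTilde {T p L m : ℕ} (hT : 1 ≤ T) (hp : 1 ≤ p) (hL : 1 ≤ L) (hm : 1 ≤ m) :
    p + Real.log T ≤ 2 * (pTilde T p + L * m) := by
  have hT' : (1 : ℝ) ≤ T := by exact_mod_cast hT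
  have hp' : (1 : ℝ) ≤ p := by exact_mod_cast hp
  have hL' : (1 : ℝ) ≤ L := by exact_mod_cast hL
  have hm' : (1 : ℝ) ≤ m := by exact_mod_cast hm
  have hLm : (1 : ℝ) ≤ L * m := by nlinarith
  have hmin : 0 ≤ min (T : ℝ) (Real.log (Real.exp 1 * T * p) ^ 2 * Real.log (T * p) ^ 2) :=
    le_min (by positivity) (by positivity)
  rcases Nat.lt_or_ge (T * p) 2 with h | h
  · have hT1 : T = 1 := by nlinarith
    have hp1 : p = 1 := by nlinarith
    have : 0 ≤ pTilde T p := mul_nonneg (by positivity) hmin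
    subst hT1 hp1
    simp only [Nat.cast_one, Real.log_one]
    linarith
  · have h' : (2 : ℝ) ≤ T * p := by exact_mod_cast h
    have hθ := Real.log_le_log two_pos h'
    have h2 := Real.log_two_gt_d9
    have hTθ : Real.log T ≤ Real.log (T * p) :=
      Real.log_le_log (by linarith) (by nlinarith)
    have hTT := Real.log_le_self (by linarith : (0 : ℝ) ≤ T)
    rw [pTilde]
    have e : Real.log (Real.exp 1 * T * p) = 1 + Real.log (T * p) := by
      rw [mul_assoc, Real.log_mul (Real.exp_pos 1).ne' (by positivity), Real.log_exp]
    rw [e] at hmin ⊢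
    set θ := Real.log (T * p)
    have hθ' : 69 / 100 ≤ θ := by linarith
    have hq : 1 ≤ (1 + θ) ^ 2 * θ ^ 2 := by
      have : 1 ≤ (1 + θ) * θ := by nlinarith
      nlinarith
    have hq' : θ ≤ (1 + θ) ^ 2 * θ ^ 2 := by
      have : 1 ≤ (1 + θ) ^ 2 * θ := by nlinarith
      nlinarith
    have h3 : (1 : ℝ) ≤ min (T : ℝ) ((1 + θ) ^ 2 * θ ^ 2) := le_min hT' hq
    have h4 : Real.log T ≤ min (T : ℝ) ((1 + θ) ^ 2 * θ ^ 2) := le_min hTT (hTθ.trans hq')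
    nlinarith

theorem le_exp_logPlus (x : ℝ) : x ≤ Real.exp (logPlus x) := by
  rcases le_or_gt x 0 with h | h
  · exact h.trans (Real.exp_pos _).le
  · calc x = Real.exp (Real.log x) := (Real.exp_log h).symm
      _ ≤ _ := Real.exp_le_exp.2 (le_max_right _ _)

theorem one_le_logPlus (x : ℝ) : 1 ≤ logPlus x := le_max_left _ _

/-- The tail level at which an energy exceeds its mean with probability of order `deltaU`. -/
def tailLevel (T N p : ℕ) : ℝ :=
  8 * (Real.log (8 * √2) + Real.log (2 * T * p) ^ 2 * Real.log (2 * N * p) ^ 2)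

/-- Four energies share the probability `deltaU / 2`, whence the summand `log (8 √2)` in the tail
level. -/
theorem tail_prob_tailLevel {T N p : ℕ} (hN : 1 ≤ N) (hp : 1 ≤ p) :
    4 * (√2 * Real.exp (-(tailLevel T N p / 8))) = deltaU T N p / 2 := by
  rw [deltaU_eq hN hp, tailLevel, mul_div_cancel_left₀ _ (by norm_num), neg_add, Real.exp_add,
    Real.exp_neg, Real.exp_log (by positivity)]
  have : (0 : ℝ) < √2 := by positivity
  field_simp
  norm_num

/-- A crude polynomial bound suffices, as the level enters the radius only through a logarithm. -/
theorem tailLevel_le {T N p L : ℕ} (hT : 1 ≤ T) (hp : 1 ≤ p) (hN10 : 10 ≤ N)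
    (hN : Nmin (10 ^ 8) T L p ≤ N) : tailLevel T N p ≤ N ^ 7 := by
  have hNTp := two_mul_le_of_nmin_le hT hp hN
  have hT : (1 : ℝ) ≤ T := by exact_mod_cast hT
  have hp : (1 : ℝ) ≤ p := by exact_mod_cast hp
  have hN10 : (10 : ℝ) ≤ N := by exact_mod_cast hN10
  have hTp : (1 : ℝ) ≤ T * p := by nlinarith
  have ha0 : 0 ≤ Real.log (2 * T * p) := Real.log_nonneg (by nlinarith)
  have ha : Real.log (2 * T * p) ≤ N := (Real.log_le_self (by positivity)).trans hNTp
  have hb0 : 0 ≤ Real.log (2 * N * p) := Real.log_nonneg (by nlinarith)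
  have hb : Real.log (2 * N * p) ≤ 2 * N := by
    have h1 : Real.log (2 * N * p) ≤ Real.log (N ^ 2) :=
      Real.log_le_log (by positivity) (by nlinarith)
    rw [Real.log_pow] at h1
    have h2 := Real.log_le_self (by linarith : (0 : ℝ) ≤ N)
    push_cast at h1
    linarith
  have hc : Real.log (8 * √2) ≤ 16 := by
    refine (Real.log_le_self (by positivity)).trans ?_
    have : √2 ≤ 2 := Real.sqrt_le_left (by norm_num) |>.2 (by norm_num)
    linarith
  have h1 := mul_le_mul (pow_le_pow_left₀ ha0 ha 2) (pow_le_pow_left₀ hb0 hb 2) (by positivity)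
    (by positivity)
  have h4 : (1 : ℝ) ≤ N ^ 4 := one_le_pow₀ (by linarith)
  have h6 : (1000 : ℝ) * N ^ 4 ≤ N ^ 7 := by
    rw [show (N : ℝ) ^ 7 = N ^ 3 * N ^ 4 by ring]
    refine mul_le_mul_of_nonneg_right ?_ (by positivity)
    have := pow_le_pow_left₀ (by norm_num) hN10 3
    linarith
  have e : (N : ℝ) ^ 2 * (2 * N) ^ 2 = 4 * N ^ 4 := by ring
  rw [e] at h1
  rw [tailLevel]
  linarith

end Constants

/-! ### The error bound on the good event -/

section Assembly

variable {Ω : Type*} [mΩ : MeasurableSpace Ω] {P : Measure Ω} [IsProbabilityMeasure P]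
  {n p m dw dz T L N k : ℕ} {𝓕 : Filtration ℤ mΩ} (sys : LTI n p m dw dz)
  {u : ℕ → Ω → Fin p → ℝ} {w : ℕ → Ω → Fin dw → ℝ} {z : ℕ → Ω → Fin dz → ℝ} {μ δ : ℝ}

theorem sum_Icc_eq_sum_range {M : Type*} [AddCommMonoid M] {N₁ : ℕ} (hN : N₁ ≤ N) (f : ℕ → M) :
    ∑ t ∈ Finset.Icc N₁ N, f t = ∑ i ∈ Finset.range (N - N₁ + 1), f (N₁ + i) := by
  have : Finset.Icc N₁ N = Finset.Ico N₁ (N + 1) := by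
    ext; simp only [Finset.mem_Icc, Finset.mem_Ico]; omega
  rw [this, Finset.sum_Ico_eq_sum_range]
  have : N + 1 - N₁ = N - N₁ + 1 := by omega
  rw [this]

/-- A bound for all impulse responses up to time `N`. -/
def LTI.responseBound (J : JordanDecomp sys.A) (N k : ℕ) : ℝ :=
  Real.exp (logPlus (sys.Mbar J)) * (1 + N : ℝ) ^ k

theorem LTI.responseBound_ge_one (J : JordanDecomp sys.A) : 1 ≤ sys.responseBound J N k := by
  have h1 : 1 ≤ Real.exp (logPlus (sys.Mbar J)) :=
    Real.one_le_exp (zero_le_one.trans (one_le_logPlus _))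
  have h2 : (1 : ℝ) ≤ (1 + N : ℝ) ^ k := one_le_pow₀ (by linarith [Nat.cast_nonneg (α := ℝ) N])
  exact one_le_mul_of_one_le_of_one_le h1 h2

theorem LTI.le_responseBound (J : JordanDecomp sys.A) {x : ℝ} (hx : x ≤ sys.Mbar J) :
    x ≤ sys.responseBound J N k := by
  have h2 : (1 : ℝ) ≤ (1 + N : ℝ) ^ k := one_le_pow₀ (by linarith [Nat.cast_nonneg (α := ℝ) N])
  exact (hx.trans (le_exp_logPlus _)).trans (le_mul_of_one_le_right (Real.exp_pos _).le h2)

theorem LTI.opNorm_impulse_le (J : JordanDecomp sys.A)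
    (hρ : spectralRadius ℂ (cplx sys.A) ≤ 1) (hk : J.LargestBlock k) {q : ℕ}
    {B : Matrix (Fin n) (Fin q) ℝ}
    (hB : opNorm (cplx sys.C * J.S) * opNorm (J.Sinv * cplx B) ≤ sys.Mbar J) {r : ℕ}
    (hr : r < N) : opNorm (sys.C * sys.A ^ r * B) ≤ sys.responseBound J N k := by
  refine (J.opNorm_mul_pow_mul_le hρ hk sys.C B r).trans ?_
  rw [mul_right_comm]
  have h1 : (1 + r : ℝ) ^ k ≤ (1 + N : ℝ) ^ k := by
    have : (r : ℝ) ≤ N := by exact_mod_cast hr.le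
    gcongr
  exact mul_le_mul (hB.trans (le_exp_logPlus _)) h1 (by positivity) (Real.exp_pos _).le

/-- All the energies that enter the regressors are at most `E`. -/
def LTI.EnergyBound (N : ℕ) (E : ℝ) (u : ℕ → Fin p → ℝ) (w : ℕ → Fin dw → ℝ)
    (z : ℕ → Fin dz → ℝ) : Prop :=
  (energy N (fun r => sys.C * sys.A ^ r * sys.B) u ≤ E ∧ energy N (fun _ => sys.D) u ≤ E) ∧
  (energy N (fun r => sys.C * sys.A ^ r * sys.Bw) w ≤ E ∧ energy N (fun _ => sys.Dz) z ≤ E)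

/-- The level of the energies, inflated by `exp h`. -/
def LTI.energyLevel (J : JordanDecomp sys.A) (N k : ℕ) (h : ℝ) : ℝ :=
  (N * N * m) * (sys.responseBound J N k ^ 2 * (N ^ 7 * Real.exp h))

/-- The determinant is controlled by the trace, a polynomial in `N` times `m Q² exp h`. The
parameter `h` treats both noise models at once: it is `0` for stochastic and `log₊ (d_z + d_w)` for
adversarial noise. -/
theorem LTI.log_det_regGram_le (J : JordanDecomp sys.A) (u : ℕ → Fin p → ℝ)
    (w : ℕ → Fin dw → ℝ) (z : ℕ → Fin dz → ℝ) (hT : 1 ≤ T) (hL : 1 ≤ L) (hm : 1 ≤ m)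
    (hk : 1 ≤ k) (hN : T * L ≤ N) (hN10 : 10 ≤ N) (hμ : 1 ≤ μ) {h : ℝ} (hh : 0 ≤ h)
    (hE : sys.EnergyBound N (sys.energyLevel J N k h) u w z) :
    Real.log (regGram (fun i => μ⁻¹ • sys.regressor T L u w z (T * L + i)) (N - T * L + 1)).det
      ≤ 36 * (L * m * (logPlus (sys.Mbar J) + h + k * logPlus N)) := by
  set Q := sys.responseBound J N k with hQ
  have hQ1 : 1 ≤ Q := sys.responseBound_ge_one J
  have hN' : (10 : ℝ) ≤ N := by exact_mod_cast hN10
  have hm' : (1 : ℝ) ≤ m := by exact_mod_cast hm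
  have hL' : (1 : ℝ) ≤ L := by exact_mod_cast hL
  have hk' : (1 : ℝ) ≤ k := by exact_mod_cast hk
  have heh : 1 ≤ Real.exp h := Real.one_le_exp hh
  have hcard : (Fintype.card (Fin m ⊕ (Fin L × Fin m)) : ℝ) = m + L * m := by simp
  have hsum : ∑ i ∈ Finset.range (N - T * L + 1),
      normSq (μ⁻¹ • sys.regressor T L u w z (T * L + i))
      ≤ 32 * N ^ 3 * sys.energyLevel J N k h := by
    refine le_trans (Finset.sum_le_sum fun i _ => ?_)
      (sys.sum_normSq_regressor_le u w z hT hL hN hE.1.1 hE.2.1 hE.1.2 hE.2.2)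
    rw [normSq_smul]
    refine mul_le_of_le_one_left (normSq_nonneg _) (pow_le_one₀ (by positivity) ?_)
    exact inv_le_one_of_one_le₀ hμ
  have hc1 : 1 ≤ N ^ 12 * (Q ^ 2 * Real.exp h) :=
    one_le_mul_of_one_le_of_one_le (one_le_pow₀ (by linarith))
      (one_le_mul_of_one_le_of_one_le (one_le_pow₀ hQ1) heh)
  have htr : (regGram (fun i => μ⁻¹ • sys.regressor T L u w z (T * L + i))
      (N - T * L + 1)).trace ≤ Fintype.card (Fin m ⊕ (Fin L × Fin m))
        * (N ^ 14 * (Q ^ 2 * Real.exp h)) := by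
    rw [trace_regGram, hcard]
    refine (add_le_add_right hsum _).trans ?_
    have e : 32 * N ^ 3 * sys.energyLevel J N k h
        = m * (32 * (N ^ 12 * (Q ^ 2 * Real.exp h))) := by
      rw [LTI.energyLevel]; ring
    have e2 : (N : ℝ) ^ 14 * (Q ^ 2 * Real.exp h)
        = N ^ 2 * (N ^ 12 * (Q ^ 2 * Real.exp h)) := by ring
    rw [e, e2]
    set c := (N : ℝ) ^ 12 * (Q ^ 2 * Real.exp h)
    have h100 : 100 * c ≤ N ^ 2 * c := by
      refine mul_le_mul_of_nonneg_right ?_ (by linarith)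
      nlinarith
    have hLm : 0 ≤ (L * m : ℝ) := by positivity
    calc (m + L * m : ℝ) + m * (32 * c) ≤ (m + L * m) * c + (m + L * m) * (32 * c) := by
          refine add_le_add (le_mul_of_one_le_right (by positivity) hc1) ?_
          exact mul_le_mul_of_nonneg_right (by linarith) (by linarith)
      _ = (m + L * m) * (33 * c) := by ring
      _ ≤ (m + L * m) * (N ^ 2 * c) :=
          mul_le_mul_of_nonneg_left (by linarith) (by positivity)
  have hdet := log_det_le (posDef_regGram _ _) (by positivity) htr
  have hlogN : Real.log N ≤ logPlus N := le_max_right _ _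
  have hlogN1 : Real.log (1 + N) ≤ 2 * Real.log N := by
    have := Real.log_le_log (by positivity) (by nlinarith : (1 + N : ℝ) ≤ N ^ 2)
    rwa [Real.log_pow, Nat.cast_ofNat] at this
  have hlogQ : Real.log Q = logPlus (sys.Mbar J) + k * Real.log (1 + N) := by
    rw [hQ, LTI.responseBound, Real.log_mul (Real.exp_pos _).ne' (by positivity), Real.log_exp,
      Real.log_pow]
  -- The factor `18` is `14` from the power of `N` plus `4` from `Q²`, because `log (1 + N) ≤ 2 log
  -- N`.
  have hlog : Real.log (N ^ 14 * (Q ^ 2 * Real.exp h))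
      ≤ 18 * (logPlus (sys.Mbar J) + h + k * logPlus N) := by
    rw [Real.log_mul (by positivity) (by positivity), Real.log_mul (by positivity) (by positivity),
      Real.log_exp, Real.log_pow, Real.log_pow, hlogQ]
    push_cast
    have h1 : (k : ℝ) * Real.log (1 + N) ≤ k * (2 * logPlus N) :=
      mul_le_mul_of_nonneg_left (by linarith) (by positivity)
    have h2 : logPlus N ≤ k * logPlus N :=
      le_mul_of_one_le_left (zero_le_one.trans (one_le_logPlus _)) hk'
    have h3 := one_le_logPlus (sys.Mbar J)
    linarith
  refine hdet.trans ?_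
  rw [hcard]
  have hpos : 0 ≤ 18 * (logPlus (sys.Mbar J) + h + k * logPlus N) := by
    have h1 := one_le_logPlus (sys.Mbar J)
    have h2 := one_le_logPlus N
    positivity
  calc _ ≤ (m + L * m : ℝ) * (18 * (logPlus (sys.Mbar J) + h + k * logPlus N)) :=
        mul_le_mul_of_nonneg_left hlog (by positivity)
    _ ≤ (2 * (L * m) : ℝ) * (18 * (logPlus (sys.Mbar J) + h + k * logPlus N)) :=
        mul_le_mul_of_nonneg_right (by nlinarith) hpos
    _ = _ := by ring

/-- The terms add up to `4 · 36 d + 24 (p + log T) + 8 log (1/δ)`, hence to at most `192 d + 8 log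
(1/δ)`; the square `196 = 14²` is a convenient upper bound. -/
theorem radiusSq_le {logdet d : ℝ} (hT : 1 ≤ T) (hδ : 0 < δ) (hδ1 : δ < 1) (hld : logdet ≤ 36 * d)
    (hd : p + Real.log T ≤ 2 * d) : radiusSq T p δ logdet ≤ 196 * (d + Real.log (1 / δ)) := by
  have hT' : (0 : ℝ) < T := by exact_mod_cast hT
  have hlT : 0 ≤ Real.log T := Real.log_natCast_nonneg T
  have hδ' : 0 ≤ Real.log (1 / δ) := Real.log_nonneg (by rw [le_div_iff₀ hδ]; linarith)
  have h5 : Real.log 5 ≤ 3 := by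
    have := Real.log_le_sub_one_of_pos (show (0 : ℝ) < 5 / 2 by norm_num)
    rw [Real.log_div (by norm_num) (by norm_num)] at this
    linarith [Real.log_two_lt_d9]
  have e : Real.log (T * 5 ^ p / δ) = Real.log T + p * Real.log 5 + Real.log (1 / δ) := by
    rw [div_eq_mul_one_div, Real.log_mul (by positivity) (by positivity),
      Real.log_mul (by positivity) (by positivity), Real.log_pow]
  rw [radiusSq, e]
  have h1 : (p : ℝ) * Real.log 5 ≤ p * 3 := mul_le_mul_of_nonneg_left h5 (Nat.cast_nonneg p)
  linarith

theorem rate_eq {Opt g d : ℝ} (hN : 1 ≤ N) :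
    rate T N μ δ Opt g d = (N : ℝ)⁻¹ * (√(T * (d + Real.log (1 / δ)))
      * (Opt + g * √(T * (d + Real.log (1 / δ))) + μ)) := by
  have hN' : (0 : ℝ) < N := by exact_mod_cast hN
  have hs : 0 < √(N : ℝ) := Real.sqrt_pos.2 hN'
  rw [rate, Real.sqrt_div' _ hN'.le, div_mul_div_comm, Real.mul_self_sqrt hN'.le, div_eq_inv_mul]
  ring

theorem rate_nonneg {Opt g d : ℝ} (hN : 1 ≤ N) (hO : 0 ≤ Opt) (hg : 0 ≤ g) (hμ : 0 ≤ μ) :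
    0 ≤ rate T N μ δ Opt g d := by
  rw [rate_eq hN]; positivity

theorem opNorm_eq_zero_of_isEmpty_left {ι κ : Type*} [Fintype ι] [Fintype κ] [DecidableEq κ]
    [IsEmpty ι] (A : Matrix ι κ ℝ) : opNorm A = 0 := by
  rw [Subsingleton.elim A 0]; simp [opNorm]

theorem opNorm_eq_zero_of_isEmpty_right {ι κ : Type*} [Fintype ι] [Fintype κ] [DecidableEq κ]
    [IsEmpty κ] (A : Matrix ι κ ℝ) : opNorm A = 0 := by
  rw [Subsingleton.elim A 0]; simp [opNorm]

/-- With `κ = N / 8` and `R = 14 √(T (d + log (1/δ)))`, the constant is `1568 = 8 · 14 · 14`, the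
last `14` coming from the term `‖G⋆‖ R`. -/
theorem LTI.opNorm_sub_le_rate {u : ℕ → Fin p → ℝ} {w : ℕ → Fin dw → ℝ} {z : ℕ → Fin dz → ℝ}
    (hT : 1 ≤ T) (hL : 1 ≤ L) (hN : T * L ≤ N) (hμ : 1 ≤ μ) (hδ : 0 < δ)
    (hδ1 : δ < 1) {d : ℝ} (hd0 : 0 ≤ d)
    (hU : ∀ v, normSq v = 1 →
      (N : ℝ) / 8 ≤ ∑ t ∈ Finset.Icc (T * L) N, (stackedInput T u t ⬝ᵥ v) ^ 2)
    (hR : ∀ j < T, ∀ x : Fin m ⊕ (Fin L × Fin m) → ℝ,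
      normSq (∑ i ∈ Finset.range (N - T * L + 1),
        (sys.regressor T L u w z (T * L + i) ⬝ᵥ x) • u (T * L + i - j))
      ≤ radiusSq T p δ (Real.log (regGram (fun i => μ⁻¹ • sys.regressor T L u w z (T * L + i))
          (N - T * L + 1)).det)
        * (μ ^ 2 * normSq x + ∑ i ∈ Finset.range (N - T * L + 1),
          (sys.regressor T L u w z (T * L + i) ⬝ᵥ x) ^ 2))
    (hρ : radiusSq T p δ (Real.log (regGram (fun i => μ⁻¹ • sys.regressor T L u w z (T * L + i))
          (N - T * L + 1)).det) ≤ 196 * (d + Real.log (1 / δ)))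
    {G : Matrix (Fin m) (Fin T × Fin p) ℝ}
    (hG : IsPFLS T L (T * L) N μ (sys.output u w z) u G) :
    opNorm (G - sys.response T) ≤ 1568 * rate T N μ δ
      (opt T L (T * L) N μ (sys.output u w z) u (sys.response T)) (opNorm (sys.response T)) d := by
  have hN1 : 1 ≤ N := (show 1 ≤ T * L from Nat.mul_pos hT hL).trans hN
  have hN' : (0 : ℝ) < N := by exact_mod_cast hN1
  have hδ' : 0 ≤ Real.log (1 / δ) := Real.log_nonneg (by rw [le_div_iff₀ hδ]; linarith)
  have hμ0 : 0 ≤ μ := zero_le_one.trans hμ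
  have hmain := opNorm_sub_le_of_isPFLS (G₀ := sys.response T) (κ := N / 8)
    (ρ := 196 * (d + Real.log (1 / δ))) hN hμ0 (by positivity) (by positivity) hU
    (fun j hj x => by
      have h1 := hR j hj x
      rw [sum_Icc_eq_sum_range hN, sum_Icc_eq_sum_range hN]
      refine h1.trans (mul_le_mul_of_nonneg_right hρ ?_)
      exact add_nonneg (mul_nonneg (sq_nonneg _) (normSq_nonneg _))
        (Finset.sum_nonneg fun _ _ => sq_nonneg _)) hG
  rw [rate_eq hN1]
  have hopt := opt_nonneg (L := L) (N₁ := T * L) (N := N) (y := sys.output u w z) (u := u) hμ0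
    (sys.response T)
  have hg := opNorm_nonneg (sys.response T)
  have e : √(T * (196 * (d + Real.log (1 / δ)))) = 14 * √(T * (d + Real.log (1 / δ))) := by
    rw [mul_left_comm, Real.sqrt_mul (by norm_num), show (196 : ℝ) = 14 ^ 2 by norm_num,
      Real.sqrt_sq (by norm_num)]
  rw [e] at hmain
  have hW := Real.sqrt_nonneg (T * (d + Real.log (1 / δ)))
  set W := √(T * (d + Real.log (1 / δ)))
  refine hmain.trans ?_
  rw [inv_div, div_eq_mul_inv, mul_assoc, mul_left_comm (1568 : ℝ)]
  rw [mul_left_comm (8 : ℝ)]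
  refine mul_le_mul_of_nonneg_left ?_ (by positivity)
  nlinarith [mul_nonneg hW hopt, mul_nonneg hW hμ0, mul_nonneg hW (mul_nonneg hg hW)]

/-- A failure forces ill-conditioned inputs, too large an energy, or a violated self-normalized
bound; their probabilities are at most `deltaU / 2`, `deltaU / 2` and `δ`. -/
theorem LTI.measure_failure_le (J : JordanDecomp sys.A) (hT : 1 ≤ T) (hL : 1 ≤ L)
    (hN : Nmin (10 ^ 8) T L p ≤ N) (hk : J.LargestBlock k) (hμ : 1 ≤ μ) (hδ : 0 < δ)
    (hδ1 : δ < 1) (hsemi : SemiAdversarial P 𝓕 T N u w z) {h : ℝ} (hh : 0 ≤ h)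
    (henergy : 1 ≤ p → 1 ≤ m → P {ω | ¬ sys.EnergyBound N (sys.energyLevel J N k h) (fun t => u t ω)
      (fun t => w t ω) (fun t => z t ω)} ≤ ENNReal.ofReal (deltaU T N p / 2)) :
    P (failure sys T L N μ δ 1568
        (pTilde T p + L * m * (logPlus (sys.Mbar J) + h + k * logPlus N)) u w z)
      ≤ ENNReal.ofReal (δ + deltaU T N p) := by
  have hTL : 1 ≤ T * L := Nat.mul_pos hT hL
  have hN10 : 10 * (T * L) ≤ N := by
    have := (le_max_left _ _).trans hN
    rw [mul_assoc] at this
    exact_mod_cast this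
  have hN1 : 1 ≤ N := by omega
  have hk1 : 1 ≤ k := by
    obtain ⟨i, hi⟩ := hk.1
    rw [← hi]
    exact J.size_pos i
  -- If `m = 0` or `p = 0`, all the matrices compared are empty and the nonnegative bound cannot be
  -- violated.
  have hempty : (∀ A : Matrix (Fin m) (Fin T × Fin p) ℝ, opNorm A = 0) →
      failure sys T L N μ δ 1568
        (pTilde T p + L * m * (logPlus (sys.Mbar J) + h + k * logPlus N)) u w z = ∅ := by
    intro h0
    ext ω
    simp only [failure, Set.mem_ofPred_eq, Set.mem_empty_iff_false, iff_false, not_exists, not_and,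
      not_lt]
    intro G _
    rw [h0]
    exact mul_nonneg (by norm_num) (rate_nonneg hN1 (opt_nonneg (by linarith) _)
      (opNorm_nonneg _) (by linarith))
  rcases Nat.eq_zero_or_pos m with rfl | hm
  · rw [hempty opNorm_eq_zero_of_isEmpty_left]; simp
  rcases Nat.eq_zero_or_pos p with rfl | hp
  · rw [hempty opNorm_eq_zero_of_isEmpty_right]; simp
  set d := pTilde T p + L * m * (logPlus (sys.Mbar J) + h + k * logPlus N) with hd
  have hm' : (1 : ℝ) ≤ m := by exact_mod_cast hm
  have hL' : (1 : ℝ) ≤ L := by exact_mod_cast hL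
  have hpT : 0 ≤ pTilde T p := mul_nonneg (Nat.cast_nonneg _) (le_min (by positivity) (by positivity))
  have hlog1 : 1 ≤ logPlus (sys.Mbar J) + h + k * logPlus N := by
    have h1 := one_le_logPlus (sys.Mbar J)
    have h2 := one_le_logPlus N
    have : 0 ≤ k * logPlus N := by positivity
    linarith
  have hLm : (L * m : ℝ) ≤ L * m * (logPlus (sys.Mbar J) + h + k * logPlus N) :=
    le_mul_of_one_le_right (by positivity) hlog1
  have hd0 : 0 ≤ d := by
    have : (0 : ℝ) ≤ L * m := by positivity
    linarith
  have hpd : p + Real.log T ≤ 2 * d := by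
    have := add_log_le_pTilde hT hp hL hm
    linarith
  have hδU : 0 < deltaU T N p := by rw [deltaU_eq hN1 hp]; exact Real.exp_pos _
  have hill := (hsemi.measure_illConditioned_le hT hp hL hN10).trans
    (ENNReal.ofReal_le_ofReal (illConditioned_prob_le hT hp hN1 hN))
  have hself := sys.measure_selfNormalized_le hsemi hT hp hL (by omega : T * L ≤ N)
    (by linarith : 0 < μ) hδ
  have hen := henergy hp hm
  have hsum : ENNReal.ofReal (δ + deltaU T N p) = ENNReal.ofReal (deltaU T N p / 2)
      + ENNReal.ofReal (deltaU T N p / 2) + ENNReal.ofReal δ := by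
    rw [← ENNReal.ofReal_add (by positivity) (by positivity),
      ← ENNReal.ofReal_add (by positivity) hδ.le]
    congr 1
    ring
  rw [hsum]
  refine le_trans ?_ (add_le_add (add_le_add hill hen) hself)
  refine le_trans (measure_mono ?_) ((measure_union_le _ _).trans
    (add_le_add_left (measure_union_le _ _) _))
  rintro ω ⟨G, hG, hfail⟩
  by_contra hω
  simp only [Set.mem_union, Set.mem_ofPred_eq, not_or, not_not] at hω
  obtain ⟨⟨h1, h2⟩, h3⟩ := hω
  refine absurd (sys.opNorm_sub_le_rate hT hL (by omega) hμ hδ hδ1 hd0 (fun v hv => ?_) h3 ?_ hG)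
    (not_le.2 hfail)
  · exact (not_le.1 fun hle => h1 ⟨v, hv, hle⟩).le
  · refine radiusSq_le hT hδ hδ1 ?_ hpd
    refine (sys.log_det_regGram_le J _ _ _ hT hL hm hk1 (by omega) (by omega) hμ hh h2).trans ?_
    rw [hd]
    linarith

theorem LTI.measure_not_energy_le (J : JordanDecomp sys.A) {q : ℕ} {M : ℕ → Matrix (Fin m) (Fin q) ℝ}
    {X : ℕ → Ω → Fin q → ℝ} (hT : 1 ≤ T) (hp : 1 ≤ p) (hN10 : 10 ≤ N)
    (hN : Nmin (10 ^ 8) T L p ≤ N) {h : ℝ} (hh : 0 ≤ h)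
    (hM : ∀ r < N, opNorm (M r) ≤ sys.responseBound J N k)
    (hm : ∀ s, 1 ≤ s → s ≤ N → Measurable (X s))
    (hX : ∀ s, 1 ≤ s → s ≤ N → SubgaussianVector P (X s)) :
    P {ω | ¬ energy N M (fun s => X s ω) ≤ sys.energyLevel J N k h}
      ≤ ENNReal.ofReal (√2 * Real.exp (-(tailLevel T N p / 8))) := by
  have hQ : 0 < sys.responseBound J N k := zero_lt_one.trans_le (sys.responseBound_ge_one J)
  refine le_trans (measure_mono fun ω hω => ?_)
    (measure_energy_gt_le hQ hM hm hX (tailLevel T N p))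
  have hω : ¬ energy N M (fun s => X s ω) ≤ sys.energyLevel J N k h := hω
  refine lt_of_le_of_lt ?_ (not_le.1 hω)
  rw [LTI.energyLevel]
  have h1 := tailLevel_le hT hp hN10 hN
  have h2 : (N : ℝ) ^ 7 ≤ N ^ 7 * Real.exp h :=
    le_mul_of_one_le_right (by positivity) (Real.one_le_exp hh)
  have := h1.trans h2
  gcongr

theorem measure_setOf_or_le (A B : Ω → Prop) :
    P {ω | A ω ∨ B ω} ≤ P {ω | A ω} + P {ω | B ω} :=
  measure_union_le {ω | A ω} {ω | B ω}

theorem LTI.Mbar_bounds (J : JordanDecomp sys.A) :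
    opNorm (cplx sys.C * J.S) * opNorm (J.Sinv * cplx sys.B) ≤ sys.Mbar J ∧
    opNorm (cplx sys.C * J.S) * opNorm (J.Sinv * cplx sys.Bw) ≤ sys.Mbar J ∧
    opNorm sys.D ≤ sys.Mbar J ∧ opNorm sys.Dz ≤ sys.Mbar J := by
  have h1 := mul_nonneg (opNorm_nonneg (cplx sys.C * J.S)) (opNorm_nonneg (J.Sinv * cplx sys.B))
  have h2 := mul_nonneg (opNorm_nonneg (cplx sys.C * J.S)) (opNorm_nonneg (J.Sinv * cplx sys.Bw))
  have h3 := opNorm_nonneg sys.D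
  have h4 := opNorm_nonneg sys.Dz
  rw [LTI.Mbar, mul_add]
  refine ⟨?_, ?_, ?_, ?_⟩ <;> linarith

theorem SemiAdversarial.measurable_process (h : SemiAdversarial P 𝓕 T N u w z) {t : ℕ}
    (h1 : 1 ≤ t) (h2 : t ≤ N) : Measurable (w t) :=
  (h.process_delayed t h1 h2).mono (𝓕.le _) le_rfl

theorem SemiAdversarial.measurable_sensor (h : SemiAdversarial P 𝓕 T N u w z) {t : ℕ}
    (h1 : 1 ≤ t) (h2 : t ≤ N) : Measurable (z t) :=
  (h.sensor_delayed t h1 h2).mono (𝓕.le _) le_rfl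

theorem LTI.measure_not_inputEnergy_le (J : JordanDecomp sys.A) (hT : 1 ≤ T) (hp : 1 ≤ p)
    (hN10 : 10 ≤ N) (hN : Nmin (10 ^ 8) T L p ≤ N) (hρ : spectralRadius ℂ (cplx sys.A) ≤ 1)
    (hk : J.LargestBlock k) (hsemi : SemiAdversarial P 𝓕 T N u w z) {h : ℝ} (hh : 0 ≤ h) :
    P {ω | ¬ (energy N (fun r => sys.C * sys.A ^ r * sys.B) (fun t => u t ω)
        ≤ sys.energyLevel J N k h ∧
      energy N (fun _ => sys.D) (fun t => u t ω) ≤ sys.energyLevel J N k h)}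
      ≤ ENNReal.ofReal (deltaU T N p / 4) := by
  obtain ⟨b1, -, b3, -⟩ := sys.Mbar_bounds J
  have hm : ∀ s, 1 ≤ s → s ≤ N → Measurable (u s) := fun s h1 h2 => hsemi.measurable_input h1 h2
  have hX : ∀ s, 1 ≤ s → s ≤ N → SubgaussianVector P (u s) :=
    fun s h1 h2 => hsemi.subgaussianVector_input h1 h2
  have e1 := sys.measure_not_energy_le J hT hp hN10 hN hh
    (fun r hr => sys.opNorm_impulse_le J hρ hk b1 hr) hm hX
  have e2 := sys.measure_not_energy_le (k := k) J hT hp hN10 hN hh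
    (M := fun _ => sys.D) (fun r _ => sys.le_responseBound J b3) hm hX
  simp only [not_and_or]
  refine (measure_setOf_or_le _ _).trans ((add_le_add e1 e2).trans ?_)
  rw [← ENNReal.ofReal_add (by positivity) (by positivity)]
  refine ENNReal.ofReal_le_ofReal ?_
  have := tail_prob_tailLevel (T := T) (by omega : 1 ≤ N) hp
  linarith

theorem LTI.measure_not_noiseEnergy_le (J : JordanDecomp sys.A) (hT : 1 ≤ T) (hp : 1 ≤ p)
    (hN10 : 10 ≤ N) (hN : Nmin (10 ^ 8) T L p ≤ N) (hρ : spectralRadius ℂ (cplx sys.A) ≤ 1)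
    (hk : J.LargestBlock k) (hsemi : SemiAdversarial P 𝓕 T N u w z)
    (hnoise : StochasticNoise P 𝓕 T N w z) :
    P {ω | ¬ (energy N (fun r => sys.C * sys.A ^ r * sys.Bw) (fun t => w t ω)
        ≤ sys.energyLevel J N k 0 ∧
      energy N (fun _ => sys.Dz) (fun t => z t ω) ≤ sys.energyLevel J N k 0)}
      ≤ ENNReal.ofReal (deltaU T N p / 4) := by
  obtain ⟨-, b2, -, b4⟩ := sys.Mbar_bounds J
  have e1 := sys.measure_not_energy_le J hT hp hN10 hN le_rfl
    (fun r hr => sys.opNorm_impulse_le J hρ hk b2 hr)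
    (fun s h1 h2 => hsemi.measurable_process h1 h2)
    (fun s h1 h2 => (hnoise s h1 h2).1.subgaussianVector (𝓕.le _))
  have e2 := sys.measure_not_energy_le (k := k) J hT hp hN10 hN le_rfl
    (M := fun _ => sys.Dz) (fun r _ => sys.le_responseBound J b4)
    (fun s h1 h2 => hsemi.measurable_sensor h1 h2)
    (fun s h1 h2 => (hnoise s h1 h2).2.subgaussianVector (𝓕.le _))
  simp only [not_and_or]
  refine (measure_setOf_or_le _ _).trans ((add_le_add e1 e2).trans ?_)
  rw [← ENNReal.ofReal_add (by positivity) (by positivity)]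
  refine ENNReal.ofReal_le_ofReal ?_
  have := tail_prob_tailLevel (T := T) (by omega : 1 ≤ N) hp
  linarith

/-- The factor `exp (log₊ (d_z + d_w)) ≥ d_z + d_w` in the energy level dominates the almost sure
bounds on the noise. -/
theorem LTI.measure_not_adversarialEnergy_eq_zero (J : JordanDecomp sys.A) (hN1 : 1 ≤ N)
    (hm : 1 ≤ m) (hρ : spectralRadius ℂ (cplx sys.A) ≤ 1)
    (hk : J.LargestBlock k) (hnoise : AdversarialNoise P N w z) :
    P {ω | ¬ (energy N (fun r => sys.C * sys.A ^ r * sys.Bw) (fun t => w t ω)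
        ≤ sys.energyLevel J N k (logPlus (dz + dw)) ∧
      energy N (fun _ => sys.Dz) (fun t => z t ω)
        ≤ sys.energyLevel J N k (logPlus (dz + dw)))} = 0 := by
  obtain ⟨-, b2, -, b4⟩ := sys.Mbar_bounds J
  have hN' : (1 : ℝ) ≤ N := by exact_mod_cast hN1
  have hm' : (1 : ℝ) ≤ m := by exact_mod_cast hm
  have hexp := le_exp_logPlus ((dz : ℝ) + dw)
  have level : ∀ b : ℝ, b ≤ dz + dw → (N * N : ℝ) * (sys.responseBound J N k ^ 2 * b)
      ≤ sys.energyLevel J N k (logPlus (dz + dw)) := fun b hb => by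
    rw [LTI.energyLevel]
    have h1 : b ≤ N ^ 7 * Real.exp (logPlus (dz + dw)) :=
      (hb.trans hexp).trans (le_mul_of_one_le_left (Real.exp_pos _).le (one_le_pow₀ hN'))
    calc (N * N : ℝ) * (sys.responseBound J N k ^ 2 * b)
        ≤ (N * N : ℝ) * (sys.responseBound J N k ^ 2 * (N ^ 7 * Real.exp (logPlus (dz + dw)))) := by
          gcongr
      _ ≤ _ := by
          refine mul_le_mul_of_nonneg_right ?_ (by positivity)
          exact le_mul_of_one_le_right (by positivity) hm'
  have hw : ∀ᵐ ω ∂P, ∀ t ∈ Finset.Icc 1 N, normSq (w t ω) ≤ dw ∧ normSq (z t ω) ≤ dz := by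
    rw [Filter.eventually_all_finset]
    intro t ht
    have ht := Finset.mem_Icc.1 ht
    exact (hnoise t ht.1 ht.2).1.and (hnoise t ht.1 ht.2).2
  rw [← ae_iff]
  filter_upwards [hw] with ω hω
  constructor
  · exact (energy_le (fun r hr => sys.opNorm_impulse_le J hρ hk b2 hr)
      fun s h1 h2 => (hω s (Finset.mem_Icc.2 ⟨h1, h2⟩)).1).trans
      (level _ (by linarith [Nat.cast_nonneg (α := ℝ) dz]))
  · exact (energy_le (fun r _ => sys.le_responseBound J b4)
      fun s h1 h2 => (hω s (Finset.mem_Icc.2 ⟨h1, h2⟩)).2).trans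
      (level _ (by linarith [Nat.cast_nonneg (α := ℝ) dw]))

end Assembly

end PFLS

end

/-! ### The two noise models -/

theorem mainTheorem3 :
    ∃ c Cst : ℝ, 0 < c ∧ 0 < Cst ∧
      ∀ (Ω : Type*) [mΩ : MeasurableSpace Ω] (P : Measure Ω) [IsProbabilityMeasure P]
        (𝓕 : Filtration ℤ mΩ)
        (n p m dw dz T L N k : ℕ) (sys : PFLS.LTI n p m dw dz)
        (J : PFLS.JordanDecomp sys.A)
        (u : ℕ → Ω → Fin p → ℝ) (w : ℕ → Ω → Fin dw → ℝ) (z : ℕ → Ω → Fin dz → ℝ)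
        (μ δ : ℝ),
        1 ≤ T → 1 ≤ L → PFLS.Nmin c T L p ≤ N →
        spectralRadius ℂ (PFLS.cplx sys.A) ≤ 1 →
        J.LargestBlock k →
        1 ≤ μ → 0 < δ → δ < 1 →
        PFLS.SemiAdversarial P 𝓕 T N u w z →
        (PFLS.StochasticNoise P 𝓕 T N w z →
          P (PFLS.failure sys T L N μ δ Cst (PFLS.dBarStoch sys J T L N k) u w z)
            ≤ ENNReal.ofReal (δ + PFLS.deltaU T N p)) ∧
        (PFLS.AdversarialNoise P N w z →
          P (PFLS.failure sys T L N μ δ Cst (PFLS.dBarAdv sys J T L N k) u w z)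
            ≤ ENNReal.ofReal (δ + PFLS.deltaU T N p)) := by
  refine ⟨10 ^ 8, 1568, by norm_num, by norm_num, ?_⟩
  intro Ω mΩ P _ 𝓕 n p m dw dz T L N k sys J u w z μ δ hT hL hN hρ hk hμ hδ hδ1 hsemi
  have hN10 : 10 ≤ N := by
    have h1 := (le_max_left _ _).trans hN
    have h2 : 10 * T * L ≤ N := by exact_mod_cast h1
    have h3 := Nat.mul_pos hT hL
    rw [mul_assoc] at h2
    omega
  refine ⟨fun hnoise => ?_, fun hnoise => ?_⟩
  -- Stochastic noise: inflation `h = 0`; input and noise energies each fail with probability at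
  -- most `deltaU / 4`.
  · have e : PFLS.dBarStoch sys J T L N k = PFLS.pTilde T p
        + L * m * (PFLS.logPlus (sys.Mbar J) + 0 + k * PFLS.logPlus N) := by
      rw [PFLS.dBarStoch, add_zero]
    rw [e]
    refine sys.measure_failure_le J hT hL hN hk hμ hδ hδ1 hsemi le_rfl fun hp _ => ?_
    have hδU : 0 < PFLS.deltaU T N p := by
      rw [PFLS.deltaU_eq (by omega) hp]; exact Real.exp_pos _
    simp only [PFLS.LTI.EnergyBound, not_and_or (a := _ ∧ _)]
    refine (PFLS.measure_setOf_or_le _ _).trans ((add_le_add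
      (sys.measure_not_inputEnergy_le J hT hp hN10 hN hρ hk hsemi le_rfl)
      (sys.measure_not_noiseEnergy_le J hT hp hN10 hN hρ hk hsemi hnoise)).trans_eq ?_)
    rw [← ENNReal.ofReal_add (by positivity) (by positivity)]
    congr 1
    ring
  -- Adversarial noise: inflation `h = log₊ (d_z + d_w)`; only the input energies can fail with
  -- positive probability.
  · have hlog := PFLS.one_le_logPlus ((dz : ℝ) + dw)
    refine sys.measure_failure_le J hT hL hN hk hμ hδ hδ1 hsemi (zero_le_one.trans hlog)
      fun hp hm => ?_
    have hδU : 0 < PFLS.deltaU T N p := by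
      rw [PFLS.deltaU_eq (by omega) hp]; exact Real.exp_pos _
    simp only [PFLS.LTI.EnergyBound, not_and_or (a := _ ∧ _)]
    refine (PFLS.measure_setOf_or_le _ _).trans ((add_le_add
      (sys.measure_not_inputEnergy_le J hT hp hN10 hN hρ hk hsemi (zero_le_one.trans hlog))
      (sys.measure_not_adversarialEnergy_eq_zero J (by omega) hm hρ hk hnoise).le).trans ?_)
    rw [add_zero]
    exact ENNReal.ofReal_le_ofReal (by linarith)
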